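/- Let $r\ge 1$, $s\ge 0$, $\kappa>0$, $\lambda>0$, $0<p\le 1$, $q=1-p$. Let $0<\mu_1<\dots<\mu_r$ and $0<\nu_1<\dots<\nu_s$, and let $\alpha_k,\beta_d$ be nonzero reals with $\alpha_1>0$, $\beta_1>0$ (if $s\geq 1$), $\sum_k\alpha_k=1$ and $\sum_d\beta_d=1$, such that $\sum_k\alpha_k\mu_ke^{\mu_ku}\ge 0$ for $u<0$ and $\sum_d\beta_d\nu_de^{-\nu_du}\ge 0$ for $u>0$. (If $p=1$ there are no upward jumps; then $s=0$ and the conditions on $\beta,\nu$ are void. If $p<1$ then $s\ge1$.) These are the parameters of the process $dX_t=\kappa X_t\,dt+dU_t$, where $U$ is a compound Poisson process of intensity $\lambda$ whose jump law has the density $p\sum_k\alpha_k\mu_ke^{\mu_ku}$ on $u<0$ and $q\sum_d\beta_d\nu_de^{-\nu_du}$ on $u>0$. Put $$\psi(z)=z^{-1}\psi_{\setminus\{0\}}(z),\qquad \psi_{\setminus\{0\}}(z)=\prod_{k=1}^r(z-\mu_k)^{-p\lambda\alpha_k/\kappa}\prod_{d=1}^s(z+\nu_d)^{-q\lambda\beta_d/\kappa}.$$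 Write $p_{-s}<\dots<p_r$ for the points $-\nu_s,\dots,-\nu_1,0,\mu_1,\dots,\mu_r$. Each $p_j$ is called a singularity of $\psi$ if its exponent in $\psi$ is negative (so $0$ is one) and a zero if its exponent is positive. Right contours: for $i=1,\dots,r$, if $\mu_i$ is a zero let $\Gamma_{i1}=\{\mu_i+(1+\mathrm i)t:0\le t<\infty\}$; if $\mu_i$ is a singularity let $\Gamma_{i1}=\{b+(-1+\mathrm i)t:-\infty<t\le0\}\cup\{b+(1+\mathrm i)t:0\le t<\infty\}$ for some $b\in(p_{i-1},p_i)$. Left contours: for $j=-s,\dots,r-1$, if $p_j$ is a zero let $\Gamma_{j2}=\{p_j+(-1+\mathrm i)t:0\le t<\infty\}$; if $p_j$ is a singularity let $\Gamma_{j2}=\{b+(1+\mathrm i)t:-\infty<t\le0\}\cup\{b+(-1+\mathrm i)t:0\le t<\infty\}$ for some $b\in(p_j,p_{j+1})$. On each contour (without its starting point if that is a zero) fix any version of $\psi$ given by holomorphic branches of $\log(z-\mu_k)$ and $\log(z+\nu_d)$ on an open set containing it; for $\Gamma_{02}$ this open set also contains the segment from $0$ to the base point $b$ of $\Gamma_{02}$,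 and $\psi_{\setminus\{0\}}(0)$ is the value at $0$ of that same version. Let $$M^{1k}_{\Gamma_i}=\int_{\Gamma_{i1}}\frac{\psi(z)}{z-\mu_k}dz,\quad M^{2d}_{\Gamma_i}=\int_{\Gamma_{i1}}\frac{\psi(z)}{\nu_d+z}dz,\quad N^{1k}_{\Gamma_j}=\int_{\Gamma_{j2}}\frac{\psi(z)}{\mu_k-z}dz,\quad N^{2d}_{\Gamma_j}=\int_{\Gamma_{j2}}\frac{\psi(z)}{\nu_d+z}dz,\quad N^{3k}_{\Gamma_j}(\ell)=\int_{\Gamma_{j2}}\frac{\psi(z)}{z-\mu_k}e^{-\ell z}dz .$$ For $\ell<0$ consider the linear system for $c_1(\ell),\dots,c_r(\ell),b_{-s}(\ell),\dots,b_{r-1}(\ell)$ $$\sum_{j=-s}^{r-1}N^{3k}_{\Gamma_j}(\ell)b_j=\frac1{\mu_k},\qquad \sum_{i=1}^rM^{1k}_{\Gamma_i}c_i+\sum_{j=-s}^{r-1}N^{1k}_{\Gamma_j}b_j=0\quad(1\le k\le r),\qquad -\sum_{i=1}^rM^{2d}_{\Gamma_i}c_i+\sum_{j=-s}^{r-1}N^{2d}_{\Gamma_j}b_j=0\quad(1\le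 d\le s).$$ Associate with $\Gamma_{i1}$ the column $(M^{11}_{\Gamma_i},\dots,M^{1r}_{\Gamma_i},-M^{21}_{\Gamma_i},\dots,-M^{2s}_{\Gamma_i})^T$ and with $\Gamma_{j2}$ the column $(N^{11}_{\Gamma_j},\dots,N^{1r}_{\Gamma_j},N^{21}_{\Gamma_j},\dots,N^{2s}_{\Gamma_j})^T$. Let $M$ be the square matrix with the columns of $\Gamma_{11},\dots,\Gamma_{r1},\Gamma_{-s,2},\dots,\Gamma_{-1,2}$ in this order, and let $M_i$ be the square matrix with the columns of $\Gamma_{11},\dots,\Gamma_{r1},\Gamma_{-s,2},\dots,\Gamma_{-1,2},\Gamma_{02}$ in this order, with that of $\Gamma_{i1}$ deleted. For $a>0$ let $\tilde\Gamma_a=\{a+(1+\mathrm i)t:-\infty<t\le0\}\cup\{a+(-1+\mathrm i)t:0\le t<\infty\}$. Then $\det(M)\neq0$, the linear system has exactly one solution for all sufficiently negative $\ell$, and for $i=1,\dots,r$ and every $a>0$ $$\lim_{\ell\to-\infty}c_i(\ell)=(-1)^{r+s-i}\,\frac{\det(M_i)}{\det(M)}\left(\psi_{\setminus\{0\}}(0)\int_{\tilde\Gamma_a}z^{-1}e^z\,dz\right)^{-1}.$$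 -/

import Mathlib

open Filter Topology

noncomputable section

/-- Parameters of the process `dX = κ X dt + dU` with positive drift `κ`, where `U` is compound
Poisson of intensity `lam` and with jump law `p G₋ + (1 - p) G₊`.  The laws `G₋` on `(-∞, 0)` and
`G₊` on `(0, ∞)` have the densities `∑ α_k μ_k e^{μ_k u}` and `∑ β_d ν_d e^{-ν_d u}`.  Indices
start at `0`, so that `α 0`, `μ 0` are what is usually written `α₁`, `μ₁`.  If `p = 1` there are no upward
jumps, and then there are no parameters `β`, `ν` either. -/
structure JumpModel (r s : ℕ) [NeZero r] where
  κ : ℝ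
  lam : ℝ
  p : ℝ
  α : Fin r → ℝ
  μ : Fin r → ℝ
  β : Fin s → ℝ
  ν : Fin s → ℝ
  kappa_pos : 0 < κ
  lam_pos : 0 < lam
  p_pos : 0 < p
  p_le_one : p ≤ 1
  mu_pos : ∀ k, 0 < μ k
  nu_pos : ∀ d, 0 < ν d
  mu_strictMono : StrictMono μ
  nu_strictMono : StrictMono ν
  alpha_ne : ∀ k, α k ≠ 0
  beta_ne : ∀ d, β d ≠ 0
  alpha_first : 0 < α 0
  beta_first : ∀ d : Fin s, d.val = 0 → 0 < β d
  alpha_sum : ∑ k, α k = 1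
  beta_sum : p < 1 → ∑ d, β d = 1
  no_upward : p = 1 → s = 0
  density_neg : ∀ u : ℝ, u < 0 → 0 ≤ ∑ k, α k * μ k * Real.exp (μ k * u)
  density_pos : ∀ u : ℝ, 0 < u → 0 ≤ ∑ d, β d * ν d * Real.exp (-ν d * u)

/-- Integral of `F` over the ray `{b + w t : 0 ≤ t < ∞}`. -/
def rayIntegral (b w : ℂ) (F : ℂ → ℂ) : ℂ :=
  ∫ t in Set.Ioi (0 : ℝ), F (b + w * t) * w

/-- Integral of `F` over `{b + v t : -∞ < t ≤ 0} ∪ {b + w t : 0 ≤ t < ∞}`. -/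
def wedgeIntegral (b v w : ℂ) (F : ℂ → ℂ) : ℂ :=
  (∫ t in Set.Iic (0 : ℝ), F (b + v * t) * v) + ∫ t in Set.Ioi (0 : ℝ), F (b + w * t) * w

/-- The ray `{b + w t : 0 < t < ∞}`, without its starting point. -/
def raySet (b w : ℂ) : Set ℂ := {z | ∃ t : ℝ, 0 < t ∧ z = b + w * t}

/-- The contour `{b + v t : -∞ < t ≤ 0} ∪ {b + w t : 0 ≤ t < ∞}`. -/
def wedgeSet (b v w : ℂ) : Set ℂ :=
  {z | (∃ t : ℝ, t ≤ 0 ∧ z = b + v * t) ∨ ∃ t : ℝ, 0 ≤ t ∧ z = b + w * t}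

namespace JumpModel

variable {r s : ℕ} [NeZero r] (P : JumpModel r s)

/-- Probability of an upward jump. -/
def q : ℝ := 1 - P.p

/-- Exponent of `z - μ_k` in the kernel `ψ`; `μ_k` is a singularity of `ψ` if it is negative and a
zero if it is positive. -/
def expMu (k : Fin r) : ℝ := -(P.p * P.lam * P.α k / P.κ)

/-- Exponent of `z + ν_d` in the kernel `ψ`. -/
def expNu (d : Fin s) : ℝ := -(P.q * P.lam * P.β d / P.κ)

/-- The point preceding `μ_i` in the list `0 < μ_1 < ⋯ < μ_r`. -/
def below (i : Fin r) : ℝ :=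
  if i = 0 then 0 else P.μ ⟨i.val - 1, lt_of_le_of_lt (Nat.sub_le _ _) i.isLt⟩

/-- Exponent in `ψ` that belongs to the point `P.below i`; it is `-1` at the point `0`. -/
def expBelow (i : Fin r) : ℝ :=
  if i = 0 then -1 else P.expMu ⟨i.val - 1, lt_of_le_of_lt (Nat.sub_le _ _) i.isLt⟩

/-- The point following `-ν_d` in the list `-ν_s < ⋯ < -ν_1 < 0`. -/
def aboveNeg (d : Fin s) : ℝ :=
  if d.val = 0 then 0 else -P.ν ⟨d.val - 1, lt_of_le_of_lt (Nat.sub_le _ _) d.isLt⟩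

/-- The points `-ν_s, …, -ν_1, 0, μ_1, …, μ_{r-1}` at which the left contours
`Γ_{-s}, …, Γ_{r-1}` sit: `inl d` is the point `-ν_d`, and `inr j` is the point preceding `μ_j`
(so `inr 0` is the point `0`). -/
def leftPoint : Fin s ⊕ Fin r → ℝ := Sum.elim (fun d => -P.ν d) P.below

/-- Exponent in `ψ` that belongs to a left point. -/
def leftExp : Fin s ⊕ Fin r → ℝ := Sum.elim P.expNu P.expBelow

/-- The point following a left point in the list `-ν_s, …, -ν_1, 0, μ_1, …, μ_r`. -/
def leftNext : Fin s ⊕ Fin r → ℝ := Sum.elim P.aboveNeg P.μ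

open Classical in
/-- Integral over the right contour of `μ_i`: a ray from `μ_i` if `μ_i` is a zero of `ψ`, and a
wedge through the base point `b` if it is a singularity. -/
def rightIntegral (i : Fin r) (b : ℝ) (F : ℂ → ℂ) : ℂ :=
  if P.expMu i < 0 then wedgeIntegral b (-1 + Complex.I) (1 + Complex.I) F
  else rayIntegral (P.μ i) (1 + Complex.I) F

open Classical in
/-- Point set of the right contour of `μ_i` (without the starting point `μ_i` if that is a zero
of `ψ`). -/
def rightSet (i : Fin r) (b : ℝ) : Set ℂ :=
  if P.expMu i < 0 then wedgeSet b (-1 + Complex.I) (1 + Complex.I)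
  else raySet (P.μ i) (1 + Complex.I)

open Classical in
/-- Integral over the left contour of the point `j`. -/
def leftIntegral (j : Fin s ⊕ Fin r) (b : ℝ) (F : ℂ → ℂ) : ℂ :=
  if P.leftExp j < 0 then wedgeIntegral b (1 + Complex.I) (-1 + Complex.I) F
  else rayIntegral (P.leftPoint j) (-1 + Complex.I) F

open Classical in
/-- Point set of the left contour of the point `j` (without its starting point if that is a zero
of `ψ`). -/
def leftSet (j : Fin s ⊕ Fin r) (b : ℝ) : Set ℂ :=
  if P.leftExp j < 0 then wedgeSet b (1 + Complex.I) (-1 + Complex.I)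
  else raySet (P.leftPoint j) (-1 + Complex.I)

/-- The part of the plane on which the version of `ψ` used on a left contour has to be defined:
the contour itself and, for the contour `Γ_0` of the point `0`, also the segment from `0` to the
base point (so that the same version of `ψ_{∖{0}}` can be evaluated at `0`). -/
def leftRegion (j : Fin s ⊕ Fin r) (b : ℝ) : Set ℂ :=
  P.leftSet j b ∪ {z | j = Sum.inr 0 ∧ ∃ x : ℝ, 0 ≤ x ∧ x ≤ b ∧ z = x}

/-- A holomorphic version of the multivalued kernel `ψ` near `S`: a choice of holomorphic
logarithms of the functions `z - μ_k` and `z + ν_d` on an open set that contains `S`. -/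
structure Version (S : Set ℂ) where
  dom : Set ℂ
  isOpen_dom : IsOpen dom
  subset_dom : S ⊆ dom
  logMu : Fin r → ℂ → ℂ
  logNu : Fin s → ℂ → ℂ
  differentiableOn_logMu : ∀ k, DifferentiableOn ℂ (logMu k) dom
  differentiableOn_logNu : ∀ d, DifferentiableOn ℂ (logNu d) dom
  exp_logMu : ∀ k, ∀ z ∈ dom, Complex.exp (logMu k z) = z - P.μ k
  exp_logNu : ∀ d, ∀ z ∈ dom, Complex.exp (logNu d z) = z + P.ν d

variable {P}

/-- The kernel without the factor `z⁻¹`: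
`ψ_{∖{0}}(z) = ∏ (z - μ_k)^{-pλα_k/κ} ∏ (z + ν_d)^{-qλβ_d/κ}`. -/
def Version.psiNoZero {S : Set ℂ} (V : P.Version S) (z : ℂ) : ℂ :=
  (∏ k, Complex.exp (P.expMu k * V.logMu k z)) * ∏ d, Complex.exp (P.expNu d * V.logNu d z)

/-- The kernel `ψ(z) = z⁻¹ ∏ (z - μ_k)^{-pλα_k/κ} ∏ (z + ν_d)^{-qλβ_d/κ}`. -/
def Version.psi {S : Set ℂ} (V : P.Version S) (z : ℂ) : ℂ := z⁻¹ * V.psiNoZero z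

variable (P)

/-- A choice of the base points of all contours, and of a version of `ψ` on each of them. -/
structure Contours where
  baseR : Fin r → ℝ
  baseL : Fin s ⊕ Fin r → ℝ
  baseR_mem : ∀ i, baseR i ∈ Set.Ioo (P.below i) (P.μ i)
  baseL_mem : ∀ j, baseL j ∈ Set.Ioo (P.leftPoint j) (P.leftNext j)
  verR : ∀ i, P.Version (P.rightSet i (baseR i))
  verL : ∀ j, P.Version (P.leftRegion j (baseL j))

namespace Contours

variable {P} (C : P.Contours)

/-- `M^{1k}_{Γ_i} = ∫_{Γ_{i1}} ψ(z) / (z - μ_k) dz`. -/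
def M1 (i k : Fin r) : ℂ :=
  P.rightIntegral i (C.baseR i) fun z => (C.verR i).psi z / (z - P.μ k)

/-- `M^{2d}_{Γ_i} = ∫_{Γ_{i1}} ψ(z) / (ν_d + z) dz`. -/
def M2 (i : Fin r) (d : Fin s) : ℂ :=
  P.rightIntegral i (C.baseR i) fun z => (C.verR i).psi z / (P.ν d + z)

/-- `N^{1k}_{Γ_j} = ∫_{Γ_{j2}} ψ(z) / (μ_k - z) dz`. -/
def N1 (j : Fin s ⊕ Fin r) (k : Fin r) : ℂ :=
  P.leftIntegral j (C.baseL j) fun z => (C.verL j).psi z / (P.μ k - z)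

/-- `N^{2d}_{Γ_j} = ∫_{Γ_{j2}} ψ(z) / (ν_d + z) dz`. -/
def N2 (j : Fin s ⊕ Fin r) (d : Fin s) : ℂ :=
  P.leftIntegral j (C.baseL j) fun z => (C.verL j).psi z / (P.ν d + z)

/-- `N^{3k}_{Γ_j}(ℓ) = ∫_{Γ_{j2}} ψ(z) / (z - μ_k) e^{-ℓ z} dz`. -/
def N3 (l : ℝ) (j : Fin s ⊕ Fin r) (k : Fin r) : ℂ :=
  P.leftIntegral j (C.baseL j) fun z => (C.verL j).psi z / (z - P.μ k) * Complex.exp (-(l * z))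

/-- The matrix `A(ℓ)` of the linear system for `c_1(ℓ), …, c_r(ℓ), b_{-s}(ℓ), …, b_{r-1}(ℓ)`. -/
def A (l : ℝ) : Matrix (Fin r ⊕ (Fin r ⊕ Fin s)) (Fin r ⊕ (Fin s ⊕ Fin r)) ℂ :=
  Matrix.fromBlocks
    0 (Matrix.of fun k j => C.N3 l j k)
    (Matrix.fromRows (Matrix.of fun k i => C.M1 i k) (Matrix.of fun d i => -C.M2 i d))
    (Matrix.fromRows (Matrix.of fun k j => C.N1 j k) (Matrix.of fun d j => C.N2 j d))

/-- The column `(M^{11}, …, M^{1r}, -M^{21}, …, -M^{2s})` of the contour `Γ_{i1}`. -/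
def rightCol (i : Fin r) : Fin (r + s) → ℂ :=
  Fin.append (fun k => C.M1 i k) (fun d => -C.M2 i d)

/-- The column `(N^{11}, …, N^{1r}, N^{21}, …, N^{2s})` of the contour `Γ_{j2}`. -/
def leftCol (j : Fin s ⊕ Fin r) : Fin (r + s) → ℂ :=
  Fin.append (fun k => C.N1 j k) (fun d => C.N2 j d)

/-- The columns of `Γ_{11}, …, Γ_{r1}, Γ_{-s,2}, …, Γ_{-1,2}, Γ_{0,2}`, in this order. -/
def cols : Fin (r + s + 1) → Fin (r + s) → ℂ :=
  Fin.snoc (α := fun _ => Fin (r + s) → ℂ)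
    (Fin.append C.rightCol (fun n : Fin s => C.leftCol (Sum.inl n.rev)))
    (C.leftCol (Sum.inr 0))

/-- The matrix `M`: all columns but the last one. -/
def M : Matrix (Fin (r + s)) (Fin (r + s)) ℂ :=
  Matrix.of fun row col => C.cols col.castSucc row

/-- The matrix `M_i`: all columns but the one of `Γ_{i1}`. -/
def Mdel (i : Fin r) : Matrix (Fin (r + s)) (Fin (r + s)) ℂ :=
  Matrix.of fun row col => C.cols ((Fin.castAdd s i).castSucc.succAbove col) row

end Contours

/-- The right-hand side `(1/μ_1, …, 1/μ_r, 0, …, 0)` of the linear system. -/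
def rhs : Fin r ⊕ (Fin r ⊕ Fin s) → ℂ := Sum.elim (fun k => 1 / (P.μ k : ℂ)) 0

end JumpModel

end

/-! Two facts carry the proof: the period matrix `M` is invertible, and the integrals `N³` have
explicit leading asymptotics as ℓ → -∞.

Invertibility (`det_M_ne_zero`). A row vector that annihilates `M` gives, up to signs, the residues
of a rational function R with simple poles at the nonzero singular points, such that ψR has integral
zero over each contour that enters `M`. Integration from i∞ yields a primitive of ψR for the branch
of ψ in the upper half-plane, and integration from -i∞ one for the branch in the lower half-plane. A
wedge integral measures the mismatch of the two primitives at its base point; an integral over a ray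
from a zero of ψ is minus the primitive at that zero. Far out on the real axis the primitives match
because they decay. The vanishing integrals carry the matching inwards from both ends, one interval
after the other, up to the origin, where no condition is needed. So the quotient primitive / ψ,
which does not depend on the constant in the choice of a branch, is a single-valued holomorphic
function outside the singular points. Counting exponents shows that it is bounded near each of them
and at infinity, hence constant by the theorems of Riemann and Liouville. At the origin ψ has a
simple pole while R is regular, so the primitive grows more slowly than ψ and the constant is zero.
Then ψR = 0, and all residues vanish (`eq_zero_of_good`).

Asymptotics. With L = -ℓ the factor e^{Lz} concentrates a left contour at its point p. Watson's
lemma on the scale 1/L (`tendsto_scaled_left_integral`) gives a limit of N³ times e^{-Lp} L^α, where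
α is the exponent of p (and 0 at the origin). Its constant contains a Hankel integral, which is
nonzero because its imaginary part satisfies a Gamma-type recurrence. At p = μ_j the limit vanishes
unless k = j, since only then does 1 / (z - μ_k) have a pole there; at p = 0 it is proportional to
-1/μ_k; at p < 0 the integral itself tends to zero.

Linear algebra. Once the unknowns of the contours at μ_1, …, μ_{r-1} are rescaled, the system
converges to an invertible one. Its r-th equation determines b_0, and the lower equations become a
linear relation between the r + s + 1 columns that define `M` and the `M_i`. Such a relation has
coefficients proportional to alternating minors, which gives the formula for the limit of c_i. -/

noncomputable section

/-! ### Primitives along vertical half-lines -/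

open MeasureTheory Set

/-- Primitive of `f` obtained by integrating `f` along vertical half-lines, normalised to vanish
at `+i∞`. -/
def upPrim (f : ℂ → ℂ) (z : ℂ) : ℂ := -∫ t in Ioi (0 : ℝ), f (z + Complex.I * t) * Complex.I

/-- `f` is holomorphic on the open set `E`, which is stable under upward translations, and decays
quadratically at infinity. -/
structure UpDecay (E : Set ℂ) (f : ℂ → ℂ) : Prop where
  isOpen : IsOpen E
  add_mem : ∀ z ∈ E, ∀ t : ℝ, 0 ≤ t → z + Complex.I * t ∈ E
  differentiableOn : DifferentiableOn ℂ f E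
  bound : ∃ C ρ : ℝ, 0 < C ∧ 0 < ρ ∧ ∀ z ∈ E, ρ ≤ ‖z‖ → ‖f z‖ ≤ C / ‖z‖ ^ 2

/-- A function that is continuous on `(0, ∞)`, integrable near `0` and decays quadratically is
integrable. -/
lemma integrableOn_Ioi_of_decay {g : ℝ → ℂ} {C T : ℝ} (hT : 0 < T)
    (hc : ContinuousOn g (Ioi 0)) (h0 : IntegrableOn g (Ioc 0 T))
    (h : ∀ t, T < t → ‖g t‖ ≤ C / t ^ 2) : IntegrableOn g (Ioi 0) := by
  have hs : Ioi (0 : ℝ) = Ioc 0 T ∪ Ioi T := (Ioc_union_Ioi_eq_Ioi hT.le).symm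
  rw [hs]
  refine h0.union ?_
  have hi : IntegrableOn (fun t : ℝ => C * t ^ (-2 : ℝ)) (Ioi T) :=
    (integrableOn_Ioi_rpow_of_lt (by norm_num) hT).const_mul C
  refine Integrable.mono' hi ?_ ?_
  · exact (hc.mono (Ioi_subset_Ioi hT.le)).aestronglyMeasurable measurableSet_Ioi
  · filter_upwards [ae_restrict_mem measurableSet_Ioi] with t ht
    have ht0 : 0 < t := hT.trans ht
    have := h t ht
    rwa [Real.rpow_neg ht0.le, Real.rpow_two, ← div_eq_mul_inv]

lemma norm_add_mul_ge {w : ℂ} (z : ℂ) {t : ℝ} (ht : 0 ≤ t) : ‖w‖ * t - ‖z‖ ≤ ‖z + w * t‖ := by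
  have h := norm_sub_norm_le (w * t) (-z)
  rw [norm_neg, norm_mul, Complex.norm_real, Real.norm_of_nonneg ht] at h
  have e : w * t - -z = z + w * t := by ring
  rwa [e] at h

namespace UpDecay

variable {E : Set ℂ} {f : ℂ → ℂ}

/-- Quadratic decay along a ray. -/
lemma exists_ray_bound (h : UpDecay E f) (z : ℂ) {w : ℂ} (hw : w ≠ 0) :
    ∃ C T : ℝ, 0 < T ∧ 0 < C ∧ ∀ t : ℝ, T < t → z + w * t ∈ E → ‖f (z + w * t)‖ ≤ C / t ^ 2 := by
  obtain ⟨C, ρ, hC, hρ, hb⟩ := h.bound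
  have hw' : 0 < ‖w‖ := norm_pos_iff.2 hw
  refine ⟨4 * C / ‖w‖ ^ 2, 2 * (‖z‖ + ρ) / ‖w‖, by positivity, by positivity, fun t ht hz => ?_⟩
  have ht0 : 0 < t := lt_trans (by positivity) ht
  rw [div_lt_iff₀ hw'] at ht
  have h1 := norm_add_mul_ge (w := w) z ht0.le
  have h2 : ‖w‖ * t / 2 ≤ ‖z + w * t‖ := by nlinarith [norm_nonneg z]
  refine (hb _ hz (by nlinarith [norm_nonneg z])).trans ?_
  rw [div_div, div_le_div_iff₀ (by have : 0 < ‖w‖ * t / 2 := by positivity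
                                   have := this.trans_le h2
                                   positivity) (by positivity)]
  have : (‖w‖ * t / 2) ^ 2 ≤ ‖z + w * t‖ ^ 2 := by gcongr
  nlinarith

lemma integrableOn_ray (h : UpDecay E f) (z : ℂ) {w : ℂ} (hw : w ≠ 0)
    (hz : ∀ t : ℝ, 0 ≤ t → z + w * t ∈ E) :
    IntegrableOn (fun t : ℝ => f (z + w * t)) (Ioi 0) := by
  obtain ⟨C, T, hT, -, hb⟩ := h.exists_ray_bound z hw
  have hc : ContinuousOn (fun t : ℝ => f (z + w * t)) (Ici 0) :=
    h.differentiableOn.continuousOn.comp (by fun_prop) fun t ht => hz t ht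
  refine integrableOn_Ioi_of_decay hT (hc.mono Ioi_subset_Ici_self) ?_
    fun t ht => hb t ht (hz t (hT.trans ht).le)
  exact ((hc.mono Icc_subset_Ici_self).integrableOn_Icc).mono_set Ioc_subset_Icc_self

/-- A vertical half-strip serves: convexity provides some primitive on it, and stability under
upward translations allows that primitive to be compared with `upPrim`. -/
lemma exists_convex (h : UpDecay E f) {z₀ : ℂ} (hz : z₀ ∈ E) :
    ∃ S : Set ℂ, z₀ ∈ S ∧ IsOpen S ∧ Convex ℝ S ∧ S ⊆ E ∧
      (∀ z ∈ S, ∀ t : ℝ, 0 ≤ t → z + Complex.I * t ∈ S) := by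
  obtain ⟨ε, hε, hb⟩ := Metric.isOpen_iff.1 h.isOpen z₀ hz
  refine ⟨Complex.re ⁻¹' (Ioo (z₀.re - ε / 2) (z₀.re + ε / 2)) ∩ Complex.im ⁻¹' (Ioi (z₀.im - ε / 2)),
    ⟨⟨by linarith, by linarith⟩, by simp [hε]⟩, ?_, ?_, ?_, ?_⟩
  · exact (isOpen_Ioo.preimage Complex.continuous_re).inter
      (isOpen_Ioi.preimage Complex.continuous_im)
  · exact ((convex_Ioo _ _).linear_preimage Complex.reLm).inter
      ((convex_Ioi _).linear_preimage Complex.imLm)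
  · rintro z ⟨⟨h1, h2⟩, h3⟩
    simp only [mem_preimage, mem_Ioi] at h1 h2 h3
    -- Lowered to height at most `z₀.im`, the point lies in the ball of radius `ε`; translating it
    -- back up stays in `E`.
    set z' : ℂ := ⟨z.re, min z.im z₀.im⟩
    have hz' : z' ∈ E := by
      apply hb
      rw [Metric.mem_ball, dist_eq_norm]
      refine (Complex.norm_le_abs_re_add_abs_im _).trans_lt ?_
      have a1 : |(z' - z₀).re| < ε / 2 := by
        rw [abs_lt]; simp only [Complex.sub_re, z']; constructor <;> linarith
      have a2 : |(z' - z₀).im| < ε / 2 := by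
        rw [abs_lt]; simp only [Complex.sub_im, z']
        rcases le_total z.im z₀.im with h | h
        · rw [min_eq_left h]; constructor <;> linarith
        · rw [min_eq_right h]; constructor <;> linarith
      linarith
    have := h.add_mem z' hz' (z.im - min z.im z₀.im) (by linarith [min_le_left z.im z₀.im])
    convert this using 1
    apply Complex.ext <;> simp [z']
  · rintro z ⟨⟨h1, h2⟩, h3⟩ t ht
    simp only [mem_preimage, mem_Ioi] at h1 h2 h3
    refine ⟨⟨?_, ?_⟩, ?_⟩ <;> simp <;> linarith

/-- The vertical primitive is a primitive. -/
lemma hasDerivAt_upPrim (h : UpDecay E f) {z₀ : ℂ} (hz₀ : z₀ ∈ E) :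
    HasDerivAt (upPrim f) (f z₀) z₀ := by
  obtain ⟨S, hzS, hSo, hSc, hSE, hSt⟩ := h.exists_convex hz₀
  obtain ⟨Φ, hΦ⟩ := hSc.exists_forall_hasDerivWithinAt (h.differentiableOn.mono hSE)
  replace hΦ : ∀ z ∈ S, HasDerivAt Φ (f z) z := fun z hz => (hΦ z hz).hasDerivAt (hSo.mem_nhds hz)
  have hder : ∀ z ∈ S, ∀ t : ℝ, 0 ≤ t → HasDerivAt (fun t : ℝ => Φ (z + Complex.I * t))
      (f (z + Complex.I * t) * Complex.I) t := by
    intro z hz t ht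
    have h1 : HasDerivAt (fun t : ℝ => z + Complex.I * (t : ℂ)) Complex.I t := by
      simpa using ((Complex.ofRealCLM.hasDerivAt (x := t)).const_mul Complex.I).const_add z
    exact (hΦ _ (hSt z hz t ht)).comp t h1
  have hint : ∀ z ∈ S, IntegrableOn (fun t : ℝ => f (z + Complex.I * t) * Complex.I) (Ioi 0) :=
    fun z hz => (h.integrableOn_ray z Complex.I_ne_zero
      fun t ht => hSE (hSt z hz t ht)).mul_const _
  -- The two primitives differ by the limit of `Φ` at the upper end of the half-line. It remains to
  -- see that this limit is the same for all half-lines in `S`.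
  have hlim : ∀ z ∈ S, Tendsto (fun t : ℝ => Φ (z + Complex.I * t)) atTop (𝓝 (Φ z - upPrim f z)) := by
    intro z hz
    have h1 := tendsto_limUnder_of_hasDerivAt_of_integrableOn_Ioi (a := 0)
      (fun t ht => hder z hz t (le_of_lt ht)) (hint z hz)
    have h2 := integral_Ioi_of_hasDerivAt_of_tendsto' (a := 0)
      (fun t ht => hder z hz t ht) (hint z hz) h1
    have h3 : limUnder atTop (fun t : ℝ => Φ (z + Complex.I * t)) = Φ z - upPrim f z := by
      rw [upPrim, h2]; simp
    rwa [h3] at h1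
  have hconst : ∀ z ∈ S, Φ z - upPrim f z = Φ z₀ - upPrim f z₀ := by
    intro z hz
    -- The segment between the two points stays in `S` at height at least `d`, where `‖f‖ ≤ C / d ^
    -- 2`; the mean value inequality applies.
    have h0 : Tendsto (fun t : ℝ => Φ (z + Complex.I * t) - Φ (z₀ + Complex.I * t)) atTop (𝓝 0) := by
      obtain ⟨C, ρ, hC, hρ, hb⟩ := h.bound
      have hlim0 : Tendsto (fun t : ℝ => C / (t - (|z₀.im| + |z.im|)) ^ 2 * ‖z - z₀‖) atTop (𝓝 0) := by
        rw [← zero_mul ‖z - z₀‖]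
        refine Tendsto.mul_const _ (Tendsto.const_div_atTop ?_ _)
        exact (tendsto_pow_atTop two_ne_zero).comp (tendsto_atTop_add_const_right _ _ tendsto_id)
      refine squeeze_zero_norm' ?_ hlim0
      filter_upwards [eventually_ge_atTop (|z₀.im| + |z.im| + ρ)] with t ht
      have habs := abs_nonneg z.im
      have habs' := abs_nonneg z₀.im
      have ht0 : 0 ≤ t := by linarith
      set d := t - (|z₀.im| + |z.im|) with hd
      have hd0 : ρ ≤ d := by linarith
      have key := (hSc.inter ((convex_Ici d).linear_preimage Complex.imLm)).norm_image_sub_le_of_norm_hasDerivWithin_le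
        (f := Φ) (f' := f) (C := C / d ^ 2) (x := z₀ + Complex.I * t) (y := z + Complex.I * t)
        (fun y hy => (hΦ y hy.1).hasDerivWithinAt) ?_ ?_ ?_
      · simpa using key
      · rintro y ⟨hy1, hy2⟩
        have hy2' : d ≤ y.im := hy2
        have : d ≤ ‖y‖ := hy2'.trans ((le_abs_self _).trans (Complex.abs_im_le_norm y))
        refine (hb y (hSE hy1) (hd0.trans this)).trans ?_
        have : 0 < d := hρ.trans_le hd0
        gcongr
      · refine ⟨hSt _ hzS t ht0, ?_⟩
        have := neg_abs_le z₀.im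
        change d ≤ (z₀ + Complex.I * t).im
        simp; linarith
      · refine ⟨hSt _ hz t ht0, ?_⟩
        have := neg_abs_le z.im
        change d ≤ (z + Complex.I * t).im
        simp; linarith
    have h1 := (hlim z hz).sub (hlim z₀ hzS)
    exact sub_eq_zero.1 (tendsto_nhds_unique h1 h0)
  have heq : upPrim f =ᶠ[𝓝 z₀] fun z => Φ z - (Φ z₀ - upPrim f z₀) := by
    filter_upwards [hSo.mem_nhds hzS] with z hz
    rw [← hconst z hz]; ring
  exact ((hΦ z₀ hzS).sub_const _).congr_of_eventuallyEq heq

end UpDecay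

lemma norm_add_I_mul_ge {z : ℂ} (hz : 0 ≤ z.im) {t : ℝ} (ht : 0 ≤ t) :
    (‖z‖ + t) / 2 ≤ ‖z + Complex.I * t‖ := by
  have h1 : ‖z‖ ^ 2 = z.re ^ 2 + z.im ^ 2 := by rw [Complex.sq_norm, Complex.normSq_apply]; ring
  have h2 : ‖z + Complex.I * t‖ ^ 2 = z.re ^ 2 + (z.im + t) ^ 2 := by
    rw [Complex.sq_norm, Complex.normSq_apply]; simp; ring
  refine (abs_le_of_sq_le_sq' ?_ (norm_nonneg _)).2
  nlinarith [mul_nonneg hz ht, sq_nonneg (‖z‖ - t)]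

lemma norm_le_norm_add_I_mul {z : ℂ} (hz : 0 ≤ z.im) {t : ℝ} (ht : 0 ≤ t) :
    ‖z‖ ≤ ‖z + Complex.I * t‖ := by
  have h1 : ‖z‖ ^ 2 = z.re ^ 2 + z.im ^ 2 := by rw [Complex.sq_norm, Complex.normSq_apply]; ring
  have h2 : ‖z + Complex.I * t‖ ^ 2 = z.re ^ 2 + (z.im + t) ^ 2 := by
    rw [Complex.sq_norm, Complex.normSq_apply]; simp; ring
  refine (abs_le_of_sq_le_sq' ?_ (norm_nonneg _)).2
  nlinarith [mul_nonneg hz ht]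

lemma integrableOn_add_rpow {a x : ℝ} (ha : a < 0) (hx : 0 < x) :
    IntegrableOn (fun t : ℝ => (x + t) ^ (a - 1)) (Ioi 0) := by
  have := (integrableOn_Ioi_rpow_of_lt (a := a - 1) (by linarith) hx)
  have h2 := (measurePreserving_add_left volume x).integrableOn_comp_preimage
    (Homeomorph.addLeft x).measurableEmbedding (f := fun t : ℝ => t ^ (a - 1)) (s := Ioi x)
  have h3 : (fun t => x + t) ⁻¹' Ioi x = Ioi (0 : ℝ) := by ext t; simp
  rw [h3] at h2
  exact h2.2 this

lemma integral_add_rpow {a x : ℝ} (ha : a < 0) (hx : 0 < x) :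
    ∫ t in Ioi (0 : ℝ), (x + t) ^ (a - 1) = x ^ a / (-a) := by
  have h2 := (measurePreserving_add_left volume x).setIntegral_preimage_emb
    (Homeomorph.addLeft x).measurableEmbedding (fun t : ℝ => t ^ (a - 1)) (Ioi x)
  have h3 : (fun t => x + t) ⁻¹' Ioi x = Ioi (0 : ℝ) := by ext t; simp
  rw [h3] at h2
  rw [h2, integral_Ioi_rpow_of_lt (by linarith) hx]
  simp [div_neg, neg_div]

lemma norm_upPrim_le {f : ℂ → ℂ} {z : ℂ} {g : ℝ → ℝ} (hg : IntegrableOn g (Ioi 0))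
    (h : ∀ t : ℝ, 0 < t → ‖f (z + Complex.I * t)‖ ≤ g t) :
    ‖upPrim f z‖ ≤ ∫ t in Ioi (0 : ℝ), g t := by
  rw [upPrim, norm_neg]
  refine norm_integral_le_of_norm_le hg ?_
  filter_upwards [ae_restrict_mem measurableSet_Ioi] with t ht
  simpa using h t ht

namespace UpDecay

variable {E : Set ℂ} {f : ℂ → ℂ}

/-- In the closed upper half-plane ‖z + it‖ ≥ (‖z‖ + t) / 2, so quadratic decay integrates to 1 /
‖z‖. This removes the contribution of infinity in `integral_ray` and starts the matching in
`good_of_unbounded`. -/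
lemma exists_norm_upPrim_le (h : UpDecay E f) : ∃ C ρ : ℝ, 0 < ρ ∧ ∀ z ∈ E, 0 ≤ z.im → ρ ≤ ‖z‖ →
    ‖upPrim f z‖ ≤ C / ‖z‖ := by
  obtain ⟨C, ρ, hC, hρ, hb⟩ := h.bound
  refine ⟨4 * C, ρ, hρ, fun z hz him hn => ?_⟩
  have hz0 : 0 < ‖z‖ := hρ.trans_le hn
  have h1 := norm_upPrim_le (f := f) (z := z)
    (g := fun t => 4 * C * (‖z‖ + t) ^ ((-1 : ℝ) - 1))
    ((integrableOn_add_rpow (by norm_num) hz0).const_mul _) ?_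
  · rw [integral_const_mul, integral_add_rpow (by norm_num) hz0, Real.rpow_neg_one] at h1
    simpa [div_eq_mul_inv] using h1
  · intro t ht
    have h2 := norm_add_I_mul_ge him ht.le
    refine (hb _ (h.add_mem z hz t ht.le) (hn.trans (norm_le_norm_add_I_mul him ht.le))).trans ?_
    have h3 : 0 < ‖z‖ + t := by positivity
    have e : (‖z‖ + t) ^ ((-1 : ℝ) - 1) = 1 / (‖z‖ + t) ^ 2 := by
      rw [show (-1 : ℝ) - 1 = -(2 : ℝ) by norm_num, Real.rpow_neg h3.le, Real.rpow_two, one_div]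
    rw [e, mul_one_div]
    have h4 : ((‖z‖ + t) / 2) ^ 2 ≤ ‖z + Complex.I * t‖ ^ 2 := by gcongr
    have h5 : 0 < ‖z + Complex.I * t‖ := lt_of_lt_of_le (by positivity) h2
    rw [div_le_div_iff₀ (by positivity) (by positivity)]
    nlinarith

/-- The integral over a ray that goes up to infinity is minus the value of the vertical primitive
at the starting point. -/
lemma integral_ray (h : UpDecay E f) {z w : ℂ} (hz : 0 ≤ z.im) (hw : 0 < w.im)
    (hE : ∀ t : ℝ, 0 < t → z + w * t ∈ E)
    (hc : ContinuousWithinAt (fun t : ℝ => upPrim f (z + w * t)) (Ici 0) 0)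
    (hi : IntegrableOn (fun t : ℝ => f (z + w * t)) (Ioi 0)) :
    ∫ t in Ioi (0 : ℝ), f (z + w * t) * w = -upPrim f z := by
  have hw0 : w ≠ 0 := by rintro rfl; simp at hw
  have hlim : Tendsto (fun t : ℝ => upPrim f (z + w * t)) atTop (𝓝 0) := by
    obtain ⟨C, ρ, hρ, hb⟩ := h.exists_norm_upPrim_le
    have hn : Tendsto (fun t : ℝ => ‖z + w * t‖) atTop atTop := by
      refine tendsto_atTop_mono' _ (f₁ := fun t : ℝ => ‖w‖ * t - ‖z‖) ?_ ?_
      · filter_upwards [eventually_ge_atTop 0] with t ht using norm_add_mul_ge z ht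
      · exact tendsto_atTop_add_const_right _ _
          (tendsto_id.const_mul_atTop (norm_pos_iff.2 hw0))
    refine squeeze_zero_norm' ?_ (hn.const_div_atTop C)
    filter_upwards [hn.eventually_ge_atTop ρ, eventually_gt_atTop 0] with t h1 h2
    refine hb _ (hE t h2) ?_ h1
    simp; nlinarith
  have h1 : ∀ t ∈ Ioi (0 : ℝ), HasDerivAt (fun t : ℝ => upPrim f (z + w * t)) (f (z + w * t) * w) t := by
    intro t ht
    have h1 : HasDerivAt (fun t : ℝ => z + w * (t : ℂ)) w t := by
      simpa using ((Complex.ofRealCLM.hasDerivAt (x := t)).const_mul w).const_add z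
    exact HasDerivAt.comp (h₂ := upPrim f) t (h.hasDerivAt_upPrim (hE t ht)) h1
  rw [integral_Ioi_of_hasDerivAt_of_tendsto hc h1 (hi.mul_const w) hlim]
  simp

lemma integral_ray_of_mem (h : UpDecay E f) {z w : ℂ} (hz : 0 ≤ z.im) (hw : 0 < w.im)
    (hE : ∀ t : ℝ, 0 ≤ t → z + w * t ∈ E) :
    ∫ t in Ioi (0 : ℝ), f (z + w * t) * w = -upPrim f z := by
  have hw0 : w ≠ 0 := by rintro rfl; simp at hw
  refine h.integral_ray hz hw (fun t ht => hE t ht.le) ?_ (h.integrableOn_ray z hw0 hE)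
  have h0 : z + w * (0 : ℝ) ∈ E := hE 0 le_rfl
  have h1 : ContinuousAt (fun t : ℝ => z + w * (t : ℂ)) 0 := by fun_prop
  have h2 : ContinuousAt (upPrim f) (z + w * (0 : ℝ)) := (h.hasDerivAt_upPrim h0).continuousAt
  exact (ContinuousAt.comp (f := fun t : ℝ => z + w * (t : ℂ)) h2 h1).continuousWithinAt

end UpDecay

end

/-! ### The kernel, its branches and its size -/

noncomputable section

open MeasureTheory Set

/-- Data of a multivalued kernel `z⁻¹ ∏ (z - pt m) ^ ex m` with real points and real exponents. -/
structure KernelData (ι : Type*) [Fintype ι] where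
  pt : ι → ℝ
  ex : ι → ℝ
  pt_ne : ∀ m, pt m ≠ 0
  pt_inj : Function.Injective pt
  ex_ne : ∀ m, ex m ≠ 0
  sum_ex : ∑ m, ex m < 0

namespace KernelData

variable {ι : Type*} [Fintype ι] (K : KernelData ι)

/-- The kernel data reflected at the origin. -/
@[simps] def neg : KernelData ι where
  pt m := -K.pt m
  ex := K.ex
  pt_ne m := neg_ne_zero.2 (K.pt_ne m)
  pt_inj := fun _ _ h => K.pt_inj (neg_injective h)
  ex_ne := K.ex_ne
  sum_ex := K.sum_ex

/-- All singular points, including the origin. -/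
def point : Option ι → ℝ := fun o => o.elim 0 K.pt

/-- The exponents at all singular points; the one at the origin is `-1`. -/
def expo : Option ι → ℝ := fun o => o.elim (-1) K.ex

@[simp] lemma point_none : K.point none = 0 := rfl
@[simp] lemma point_some (m : ι) : K.point (some m) = K.pt m := rfl
@[simp] lemma expo_none : K.expo none = -1 := rfl
@[simp] lemma expo_some (m : ι) : K.expo (some m) = K.ex m := rfl

@[simp] lemma neg_point (o : Option ι) : K.neg.point o = -K.point o := by cases o <;> simp
@[simp] lemma neg_expo (o : Option ι) : K.neg.expo o = K.expo o := by cases o <;> simp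

lemma point_injective : Function.Injective K.point := by
  intro a b h
  cases a <;> cases b
  · rfl
  · exact absurd h.symm (K.pt_ne _)
  · exact absurd h (K.pt_ne _)
  · exact congrArg some (K.pt_inj h)

/-- The branch without the factor `z⁻¹` that is holomorphic in the upper half-plane. -/
def kernReg (z : ℂ) : ℂ := ∏ m, Complex.exp (K.ex m * Complex.log (-Complex.I * (z - K.pt m)))

/-- The branch of the kernel that is holomorphic in the upper half-plane. -/
def kern (z : ℂ) : ℂ := z⁻¹ * K.kernReg z

/-- The plane cut along downward half-lines from the points `pt m`. -/
def cutReg : Set ℂ := {z | 0 < z.im ∨ ∀ m, z.re ≠ K.pt m}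

/-- The plane cut along downward half-lines from the singular points. -/
def cutDomain : Set ℂ := {z | 0 < z.im ∨ ∀ o, z.re ≠ K.point o}

/-- The complement of the singular points. -/
def regular : Set ℂ := {z | ∀ o, z ≠ K.point o}

lemma isOpen_cutDomain : IsOpen K.cutDomain := by
  have : K.cutDomain = {z | 0 < z.im} ∪ ⋂ m, {z | z.re ≠ K.point m} := by
    ext z; simp [cutDomain]
  rw [this]
  exact (isOpen_lt continuous_const Complex.continuous_im).union
    (isOpen_iInter_of_finite fun m => isOpen_ne_fun Complex.continuous_re continuous_const)

lemma cutDomain_subset_cutReg : K.cutDomain ⊆ K.cutReg := by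
  rintro z (h | h)
  · exact Or.inl h
  · exact Or.inr fun m => h (some m)

lemma cutDomain_subset_regular : K.cutDomain ⊆ K.regular := by
  rintro z (h | h) o rfl
  · simp at h
  · exact h o (by simp)

lemma regular_ne_zero {z : ℂ} (hz : z ∈ K.regular) : z ≠ 0 := by simpa using hz none

lemma regular_sub_ne {z : ℂ} (hz : z ∈ K.regular) (m : ι) : z - K.pt m ≠ 0 :=
  sub_ne_zero.2 (hz (some m))

lemma mem_neg_regular {z : ℂ} : z ∈ K.neg.regular ↔ -z ∈ K.regular := by
  simp [regular, neg_eq_iff_eq_neg]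

lemma add_mem_cutDomain {z : ℂ} (hz : z ∈ K.cutDomain) {t : ℝ} (ht : 0 ≤ t) :
    z + Complex.I * t ∈ K.cutDomain := by
  rcases hz with h | h
  · left; simp; linarith
  · right; simpa using h

lemma mem_slitPlane {z : ℂ} (hz : z ∈ K.cutReg) (m : ι) :
    -Complex.I * (z - K.pt m) ∈ Complex.slitPlane := by
  rw [Complex.mem_slitPlane_iff]
  rcases hz with h | h
  · left; simpa using h
  · right; simpa [sub_eq_zero, eq_comm (a := (0 : ℝ))] using fun h' => h m h'.symm

lemma differentiableOn_kernReg : DifferentiableOn ℂ K.kernReg K.cutReg := by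
  intro z hz
  refine DifferentiableAt.differentiableWithinAt ?_
  unfold kernReg
  refine DifferentiableAt.fun_finsetProd fun m _ => ?_
  have h : DifferentiableAt ℂ (fun z => -Complex.I * (z - (K.pt m : ℂ))) z := by fun_prop
  exact ((h.clog (K.mem_slitPlane hz m)).const_mul _).cexp

lemma differentiableOn_kern : DifferentiableOn ℂ K.kern K.cutDomain := by
  refine DifferentiableOn.mul ?_ (K.differentiableOn_kernReg.mono K.cutDomain_subset_cutReg)
  exact differentiableOn_inv.mono fun z hz => K.regular_ne_zero (K.cutDomain_subset_regular hz)

lemma kernReg_ne_zero (z : ℂ) : K.kernReg z ≠ 0 :=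
  Finset.prod_ne_zero_iff.2 fun _ _ => Complex.exp_ne_zero _

lemma kern_ne_zero {z : ℂ} (hz : z ≠ 0) : K.kern z ≠ 0 :=
  mul_ne_zero (inv_ne_zero hz) (K.kernReg_ne_zero z)

lemma norm_exp_mul_log {w : ℂ} (hw : w ≠ 0) (e : ℝ) : ‖Complex.exp (e * Complex.log w)‖ = ‖w‖ ^ e := by
  rw [Complex.norm_exp, Complex.re_ofReal_mul, Complex.log_re,
    Real.rpow_def_of_pos (norm_pos_iff.2 hw), mul_comm]

/-- The exponents are real, so the modulus is single-valued and the size estimates serve for every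
branch. The index `none` accounts for the factor `z⁻¹`. -/
lemma norm_kern {z : ℂ} (hz : z ∈ K.regular) : ‖K.kern z‖ = ∏ o, ‖z - K.point o‖ ^ K.expo o := by
  rw [kern, kernReg, norm_mul, norm_prod, Fintype.prod_option]
  congr 1
  · simp [Real.rpow_neg_one]
  · refine Finset.prod_congr rfl fun m _ => ?_
    rw [norm_exp_mul_log (mul_ne_zero (by simp) (K.regular_sub_ne hz m))]
    simp

lemma exists_radius (o : Option ι) : ∃ r : ℝ, 0 < r ∧ ∀ z : ℂ, 0 < ‖z - K.point o‖ →
    ‖z - K.point o‖ < r → z ∈ K.regular := by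
  have : ∀ᶠ z : ℂ in 𝓝 (K.point o : ℂ), ∀ o', o' ≠ o → z ≠ K.point o' := by
    rw [eventually_all]
    intro o'
    by_cases h : o' = o
    · simp [h]
    · have : (K.point o : ℂ) ≠ K.point o' := fun hh => h (K.point_injective (by exact_mod_cast hh.symm))
      filter_upwards [isOpen_ne.mem_nhds this] with z hz _ using hz
  obtain ⟨r, hr, h⟩ := Metric.eventually_nhds_iff.1 this
  refine ⟨r, hr, fun z h0 h1 o' => ?_⟩
  by_cases ho : o' = o
  · rw [ho]; exact sub_ne_zero.1 (norm_pos_iff.1 h0)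
  · exact h (by rwa [dist_eq_norm]) o' ho

/-- Near a singular point the kernel has the size given by the exponent of that point. -/
lemma exists_kern_bounds_near (o : Option ι) : ∃ c C r : ℝ, 0 < c ∧ 0 < C ∧ 0 < r ∧
    ∀ z : ℂ, 0 < ‖z - K.point o‖ → ‖z - K.point o‖ < r →
      z ∈ K.regular ∧ c * ‖z - K.point o‖ ^ K.expo o ≤ ‖K.kern z‖ ∧
        ‖K.kern z‖ ≤ C * ‖z - K.point o‖ ^ K.expo o := by
  classical
  obtain ⟨r, hr, hreg⟩ := K.exists_radius o
  set A : ℂ → ℝ := fun z => ∏ o' ∈ Finset.univ.erase o, ‖z - K.point o'‖ ^ K.expo o' with hA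
  have hne : ∀ o' ∈ Finset.univ.erase o, ‖(K.point o : ℂ) - K.point o'‖ ≠ 0 := by
    intro o' ho'
    rw [norm_ne_zero_iff, sub_ne_zero]
    exact fun h => (Finset.mem_erase.1 ho').1 (K.point_injective (by exact_mod_cast h.symm))
  have hcont : ContinuousAt A (K.point o) := by
    refine tendsto_finsetProd _ fun o' ho' => ?_
    exact ContinuousAt.rpow_const (by fun_prop) (Or.inl (hne o' ho'))
  have hpos : 0 < A (K.point o) := Finset.prod_pos fun o' ho' =>
    Real.rpow_pos_of_pos ((norm_nonneg _).lt_of_ne' (hne o' ho')) _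
  have hev := (Tendsto.eventually_const_lt (half_lt_self hpos) hcont).and
    (Tendsto.eventually_lt_const (lt_two_mul_self hpos) hcont)
  obtain ⟨r', hr', hA'⟩ := Metric.eventually_nhds_iff.1 hev
  refine ⟨A (K.point o) / 2, 2 * A (K.point o), min r r', by positivity, by positivity,
    lt_min hr hr', fun z h0 h1 => ?_⟩
  have hz := hreg z h0 (h1.trans_le (min_le_left _ _))
  obtain ⟨h2, h3⟩ := hA' (y := z) (by rw [dist_eq_norm]; exact h1.trans_le (min_le_right _ _))
  have e : ‖K.kern z‖ = A z * ‖z - K.point o‖ ^ K.expo o := by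
    rw [K.norm_kern hz, hA, Finset.prod_erase_mul _ _ (Finset.mem_univ o)]
  rw [e]
  exact ⟨hz, by gcongr, by gcongr⟩

lemma sum_expo : ∑ o, K.expo o = -1 + ∑ m, K.ex m := by simp [Fintype.sum_option]

/-- Size of the kernel at infinity. -/
lemma exists_kern_bounds_infty : ∃ c C ρ : ℝ, 0 < c ∧ 0 < C ∧ 0 < ρ ∧
    ∀ z : ℂ, ρ ≤ ‖z‖ → z ∈ K.regular ∧
      c * ‖z‖ ^ (-1 + ∑ m, K.ex m) ≤ ‖K.kern z‖ ∧ ‖K.kern z‖ ≤ C * ‖z‖ ^ (-1 + ∑ m, K.ex m) := by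
  set B : ℝ := ∑ o, |K.point o|
  have hB : ∀ o, |K.point o| ≤ B := fun o =>
    Finset.single_le_sum (f := fun o => |K.point o|) (fun _ _ => abs_nonneg _) (Finset.mem_univ o)
  have hB0 : 0 ≤ B := (abs_nonneg _).trans (hB none)
  have key : ∀ z : ℂ, 2 * B + 1 ≤ ‖z‖ → ∀ o, ‖z‖ / 2 ≤ ‖z - K.point o‖ ∧ ‖z - K.point o‖ ≤ 2 * ‖z‖ := by
    intro z hz o
    have h1 := norm_sub_norm_le z (K.point o)
    have h2 := norm_sub_le z (K.point o)
    have h3 := hB o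
    rw [Complex.norm_real, Real.norm_eq_abs] at h1 h2
    constructor <;> linarith
  have hpow : ∀ z : ℂ, 2 * B + 1 ≤ ‖z‖ → ∀ o,
      (2 : ℝ) ^ (-|K.expo o|) * ‖z‖ ^ K.expo o ≤ ‖z - K.point o‖ ^ K.expo o ∧
        ‖z - K.point o‖ ^ K.expo o ≤ (2 : ℝ) ^ |K.expo o| * ‖z‖ ^ K.expo o := by
    intro z hz o
    obtain ⟨h1, h2⟩ := key z hz o
    have hz0 : 0 < ‖z‖ := by linarith
    rcases le_total 0 (K.expo o) with he | he
    · rw [abs_of_nonneg he, Real.rpow_neg (by norm_num), inv_mul_eq_div,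
        ← Real.div_rpow hz0.le (by norm_num), ← Real.mul_rpow (by norm_num) hz0.le]
      exact ⟨Real.rpow_le_rpow (by positivity) h1 he, Real.rpow_le_rpow (by positivity) h2 he⟩
    · rw [abs_of_nonpos he, neg_neg, Real.rpow_neg (by norm_num), inv_mul_eq_div,
        ← Real.div_rpow hz0.le (by norm_num), ← Real.mul_rpow (by norm_num) hz0.le]
      exact ⟨Real.rpow_le_rpow_of_nonpos (by linarith) h2 he,
        Real.rpow_le_rpow_of_nonpos (by linarith) h1 he⟩
  refine ⟨∏ o, (2 : ℝ) ^ (-|K.expo o|), ∏ o, (2 : ℝ) ^ |K.expo o|, 2 * B + 1,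
    Finset.prod_pos fun _ _ => by positivity, Finset.prod_pos fun _ _ => by positivity,
    by positivity, fun z hz => ?_⟩
  have hz0 : 0 < ‖z‖ := by linarith
  have hreg : z ∈ K.regular := by
    intro o h
    have := (key z hz o).1
    rw [h, sub_self, norm_zero, ← h] at this
    linarith
  rw [K.norm_kern hreg, ← K.sum_expo, Real.rpow_sum_of_pos hz0, ← Finset.prod_mul_distrib,
    ← Finset.prod_mul_distrib]
  refine ⟨hreg, Finset.prod_le_prod (fun o _ => by positivity) fun o _ => (hpow z hz o).1,
    Finset.prod_le_prod (fun o _ => by positivity) fun o _ => (hpow z hz o).2⟩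

/-- The kernel times a holomorphic function that is `O(1 / z)` over the set `T` of real parts
decays quadratically. -/
lemma upDecay {R : ℂ → ℂ} {T : Set ℝ} (hT : IsOpen T) (hR : DifferentiableOn ℂ R K.regular)
    (hb : ∃ C ρ : ℝ, ∀ z : ℂ, z.re ∈ T → ρ ≤ ‖z‖ → ‖R z‖ ≤ C / ‖z‖) :
    UpDecay (K.cutDomain ∩ Complex.re ⁻¹' T) (fun z => K.kern z * R z) where
  isOpen := K.isOpen_cutDomain.inter (hT.preimage Complex.continuous_re)
  add_mem z hz t ht := ⟨K.add_mem_cutDomain hz.1 ht, by simpa using hz.2⟩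
  differentiableOn := (K.differentiableOn_kern.mono inter_subset_left).mul
    (hR.mono (inter_subset_left.trans K.cutDomain_subset_regular))
  bound := by
    obtain ⟨C, ρ, h⟩ := hb
    obtain ⟨c, C', ρ', hc, hC', hρ', h'⟩ := K.exists_kern_bounds_infty
    refine ⟨C' * (|C| + 1), max (max ρ ρ') 1, by positivity,
      lt_of_lt_of_le one_pos (le_max_right _ _), fun z hz hn => ?_⟩
    have h1 : 1 ≤ ‖z‖ := (le_max_right _ _).trans hn
    have h2 : ρ ≤ ‖z‖ := (le_max_left _ _).trans ((le_max_left _ _).trans hn)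
    have h3 : ρ' ≤ ‖z‖ := (le_max_right _ _).trans ((le_max_left _ _).trans hn)
    have hz0 : 0 < ‖z‖ := by linarith
    -- The exponents `ex` have a negative sum and `‖z‖ ≥ 1`, so the kernel decays at least like 1 /
    -- ‖z‖.
    have h4 : ‖K.kern z‖ ≤ C' / ‖z‖ := by
      refine (h' z h3).2.2.trans ?_
      rw [div_eq_mul_inv, ← Real.rpow_neg_one]
      gcongr
      · linarith [K.sum_ex]
    have h5 : ‖R z‖ ≤ (|C| + 1) / ‖z‖ := by
      refine (h z hz.2 h2).trans ?_
      gcongr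
      linarith [le_abs_self C]
    rw [norm_mul]
    calc ‖K.kern z‖ * ‖R z‖ ≤ C' / ‖z‖ * ((|C| + 1) / ‖z‖) := by gcongr
      _ = _ := by field_simp

end KernelData

/-- A continuous function with constant exponential on a preconnected set is constant. -/
lemma eqOn_of_exp_eq {S : Set ℂ} (hS : IsPreconnected S) {h : ℂ → ℂ} (hc : ContinuousOn h S)
    {γ : ℂ} (he : ∀ z ∈ S, Complex.exp (h z) = γ) {z₀ z : ℂ} (hz₀ : z₀ ∈ S) (hz : z ∈ S) :
    h z = h z₀ := by
  -- `h` and the constant `h z₀` are lifts of the same map through the covering `exp`, and they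
  -- agree at `z₀`.
  have := Complex.isCoveringMap_exp.eqOn_of_comp_eqOn (A := ℂ) hS hc
    (continuousOn_const (c := h z₀)) (fun y hy => by
      simp only [Function.comp, Subtype.mk.injEq]
      rw [he y hy, he z₀ hz₀]) hz₀ rfl
  exact this hz

/-- Two families of branches of logarithms of the same functions (up to constants) give the same
product of powers, up to a constant. -/
lemma exists_prod_exp_eq {ι : Type*} [Fintype ι] {S : Set ℂ} (hS : IsPreconnected S)
    {ex : ι → ℝ} {l₁ l₂ : ι → ℂ → ℂ} {γ₁ γ₂ : ℂ} {p : ι → ℂ → ℂ}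
    (h₁ : ∀ m, ContinuousOn (l₁ m) S) (h₂ : ∀ m, ContinuousOn (l₂ m) S)
    (e₁ : ∀ m, ∀ z ∈ S, Complex.exp (l₁ m z) = γ₁ * p m z)
    (e₂ : ∀ m, ∀ z ∈ S, Complex.exp (l₂ m z) = γ₂ * p m z) :
    ∃ c : ℂ, c ≠ 0 ∧ ∀ z ∈ S, ∏ m, Complex.exp (ex m * l₁ m z) =
      c * ∏ m, Complex.exp (ex m * l₂ m z) := by
  rcases S.eq_empty_or_nonempty with rfl | ⟨z₀, hz₀⟩
  · exact ⟨1, one_ne_zero, by simp⟩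
  refine ⟨∏ m, Complex.exp (ex m * (l₁ m z₀ - l₂ m z₀)),
    Finset.prod_ne_zero_iff.2 fun _ _ => Complex.exp_ne_zero _, fun z hz => ?_⟩
  rw [← Finset.prod_mul_distrib]
  refine Finset.prod_congr rfl fun m _ => ?_
  rw [← Complex.exp_add]
  have hγ : ∀ z ∈ S, Complex.exp (l₁ m z - l₂ m z) = γ₁ / γ₂ := by
    intro z hz
    have hne := Complex.exp_ne_zero (l₂ m z)
    rw [Complex.exp_sub, e₁ m z hz, e₂ m z hz]
    rw [e₂ m z hz] at hne
    exact mul_div_mul_right _ _ (right_ne_zero_of_mul hne)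
  have := eqOn_of_exp_eq hS ((h₁ m).sub (h₂ m)) hγ hz₀ hz
  rw [Pi.sub_apply, Pi.sub_apply] at this
  congr 1
  linear_combination (ex m : ℂ) * this

end

/-! ### Growth of the primitive compared with the kernel -/

noncomputable section

open MeasureTheory Set

namespace KernelData

variable {ι : Type*} [Fintype ι] (K : KernelData ι)

/-- The kernel times a function `R`. -/
def form (R : ℂ → ℂ) (z : ℂ) : ℂ := K.kern z * R z

/-- `R` is holomorphic outside the singular points, has at most simple poles there and is
`O(1 / z)` at infinity. -/
structure PoleFactor (R : ℂ → ℂ) : Prop where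
  differentiableOn : DifferentiableOn ℂ R K.regular
  near : ∀ o, ∃ C r : ℝ, 0 < r ∧ ∀ z : ℂ, 0 < ‖z - K.point o‖ → ‖z - K.point o‖ < r →
    ‖R z‖ ≤ C / ‖z - K.point o‖
  infty : ∃ C ρ : ℝ, ∀ z : ℂ, ρ ≤ ‖z‖ → ‖R z‖ ≤ C / ‖z‖

variable {K}

lemma mem_cutDomain_of_regular {z : ℂ} (hz : z ∈ K.regular) (h : 0 ≤ z.im) : z ∈ K.cutDomain := by
  rcases h.eq_or_lt with h | h
  · refine Or.inr fun o ho => hz o (Complex.ext (by simpa using ho) (by simpa using h.symm))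
  · exact Or.inl h

lemma PoleFactor.neg {R : ℂ → ℂ} (h : K.PoleFactor R) : K.neg.PoleFactor fun z => R (-z) where
  differentiableOn := h.differentiableOn.comp (differentiableOn_neg _)
    fun z hz => K.mem_neg_regular.1 hz
  near o := by
    obtain ⟨C, r, hr, hb⟩ := h.near o
    refine ⟨C, r, hr, fun z h0 h1 => ?_⟩
    have e : ‖-z - K.point o‖ = ‖z - K.neg.point o‖ := by
      rw [← norm_neg]; congr 1; simp; ring
    rw [← e] at h0 h1 ⊢
    exact hb _ h0 h1
  infty := by
    obtain ⟨C, ρ, hb⟩ := h.infty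
    exact ⟨C, ρ, fun z hz => by simpa using hb (-z) (by simpa using hz)⟩

lemma PoleFactor.upDecay {R : ℂ → ℂ} (h : K.PoleFactor R) : UpDecay K.cutDomain (K.form R) := by
  obtain ⟨C, ρ, hb⟩ := h.infty
  have := K.upDecay isOpen_univ h.differentiableOn ⟨C, ρ, fun z _ hz => hb z hz⟩
  rwa [preimage_univ, inter_univ] at this

lemma PoleFactor.exists_form_bound_near {R : ℂ → ℂ} (h : K.PoleFactor R) (o : Option ι) :
    ∃ C r : ℝ, 0 < C ∧ 0 < r ∧ ∀ z : ℂ, 0 < ‖z - K.point o‖ → ‖z - K.point o‖ < r →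
      z ∈ K.regular ∧ ‖K.form R z‖ ≤ C * ‖z - K.point o‖ ^ (K.expo o - 1) := by
  obtain ⟨c, C, r, hc, hC, hr, hb⟩ := K.exists_kern_bounds_near o
  obtain ⟨C', r', hr', hb'⟩ := h.near o
  refine ⟨C * (|C'| + 1), min r r', by positivity, lt_min hr hr', fun z h0 h1 => ?_⟩
  obtain ⟨h2, -, h3⟩ := hb z h0 (h1.trans_le (min_le_left _ _))
  have h4 : ‖R z‖ ≤ (|C'| + 1) / ‖z - K.point o‖ := by
    refine (hb' z h0 (h1.trans_le (min_le_right _ _))).trans ?_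
    gcongr
    linarith [le_abs_self C']
  refine ⟨h2, ?_⟩
  rw [form, norm_mul, Real.rpow_sub_one h0.ne']
  calc _ ≤ C * ‖z - K.point o‖ ^ K.expo o * ((|C'| + 1) / ‖z - K.point o‖) := by gcongr
    _ = _ := by ring

/-- Uniform decay in a vertical half-strip. -/
lemma exists_strip_bound {f : ℂ → ℂ} (h : UpDecay K.cutDomain f) {y₀ : ℝ} (hy : 0 < y₀) (X : ℝ) :
    ∃ M : ℝ, 0 < M ∧ ∀ z : ℂ, |z.re| ≤ X → y₀ ≤ z.im → ‖f z‖ ≤ M * (1 + z.im) ^ ((-1 : ℝ) - 1) := by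
  obtain ⟨C, ρ, hC, hρ, hb⟩ := h.bound
  set ρ' := max ρ 1
  have hcomp : IsCompact (Icc (-X) X ×ℂ Icc y₀ ρ') := isCompact_Icc.reProdIm isCompact_Icc
  obtain ⟨M, hM⟩ := hcomp.exists_bound_of_continuousOn
    (h.differentiableOn.continuousOn.mono fun z hz => Or.inl (hy.trans_le hz.2.1))
  refine ⟨max (4 * C) (|M| * (1 + ρ') ^ 2), lt_max_of_lt_left (by positivity), fun z h1 h2 => ?_⟩
  have h3 : 0 < 1 + z.im := by linarith
  -- The bound is stated with exponent `a - 1`, `a = -1`, to match `integrableOn_add_rpow`.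
  have e : (1 + z.im) ^ ((-1 : ℝ) - 1) = 1 / (1 + z.im) ^ 2 := by
    rw [show (-1 : ℝ) - 1 = -(2 : ℝ) by norm_num, Real.rpow_neg h3.le, Real.rpow_two, one_div]
  rw [e, mul_one_div]
  rcases le_total z.im ρ' with h4 | h4
  · refine (hM z ⟨abs_le.1 h1, h2, h4⟩).trans ?_
    rw [le_div_iff₀ (by positivity)]
    refine le_trans ?_ (le_max_right _ _)
    gcongr
    exact le_abs_self M
  · have h5 : z.im ≤ ‖z‖ := (le_abs_self _).trans (Complex.abs_im_le_norm z)
    have h6 : 1 ≤ z.im := (le_max_right _ _).trans h4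
    refine (hb z (Or.inl (by linarith)) ((le_max_left _ _).trans (h4.trans h5))).trans ?_
    have h7 : 0 < ‖z‖ := by linarith
    rw [div_le_div_iff₀ (by positivity) (by positivity)]
    have : (1 + z.im) ^ 2 ≤ 4 * ‖z‖ ^ 2 := by nlinarith
    calc C * (1 + z.im) ^ 2 ≤ C * (4 * ‖z‖ ^ 2) := by gcongr
      _ = 4 * C * ‖z‖ ^ 2 := by ring
      _ ≤ _ := by gcongr; exact le_max_left _ _

/-- Pointwise bounds along the vertical half-lines that start near a real point `q`. -/
lemma exists_vertical_bound {f : ℂ → ℂ} (h : UpDecay K.cutDomain f) (q : ℝ) {g : ℝ → ℝ} {r : ℝ}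
    (hr : 0 < r) (hf : ∀ z : ℂ, 0 < ‖z - q‖ → ‖z - q‖ < r → ‖f z‖ ≤ g ‖z - q‖) :
    ∃ M : ℝ, 0 < M ∧ ∀ z : ℂ, 0 ≤ z.im → ‖z - q‖ < r / 2 → ∀ t : ℝ, 0 < t →
      (‖z + Complex.I * t - q‖ < r ∧ ‖f (z + Complex.I * t)‖ ≤ g ‖z + Complex.I * t - q‖) ∨
        ‖f (z + Complex.I * t)‖ ≤ M * (1 + t) ^ ((-1 : ℝ) - 1) := by
  obtain ⟨M, hM, hb⟩ := exists_strip_bound h (y₀ := r / 2) (by positivity) (|q| + r)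
  refine ⟨M, hM, fun z him hz t ht => ?_⟩
  have e : z + Complex.I * t - q = (z - q) + Complex.I * t := by ring
  have him' : 0 ≤ (z - q).im := by simpa using him
  by_cases hlt : ‖z + Complex.I * t - q‖ < r
  · left
    refine ⟨hlt, hf _ ?_ hlt⟩
    rw [e]
    have := norm_add_I_mul_ge him' ht.le
    exact lt_of_lt_of_le (by positivity) this
  · right
    have h1 : ‖z + Complex.I * t - q‖ ≤ ‖z - q‖ + t := by
      rw [e]
      refine (norm_add_le _ _).trans ?_
      simp [abs_of_pos ht]
    -- The half-line starts within `r / 2` of `q`, so it cannot leave the disc of radius `r`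
    -- earlier; beyond that the strip bound applies.
    have h2 : r / 2 ≤ t := by linarith
    have h3 : |z.re| ≤ |q| + r := by
      have h4 := Complex.abs_re_le_norm (z - q)
      simp only [Complex.sub_re, Complex.ofReal_re] at h4
      have h5 := abs_add_le (z.re - q) q
      rw [sub_add_cancel] at h5
      linarith
    refine (hb (z + Complex.I * t) (by simpa using h3) (by simp; linarith)).trans ?_
    refine mul_le_mul_of_nonneg_left ?_ hM.le
    refine Real.rpow_le_rpow_of_nonpos (by linarith) ?_ (by norm_num)
    simpa using him

/-- For a negative exponent the near part of the half-line contributes the integral of (‖z - q‖ +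
t)^(a - 1), which is ‖z - q‖^a / (-a). The far part contributes a constant, which is absorbed
because ‖z - q‖^a ≥ 1 within distance one of `q`. -/
lemma exists_upPrim_bound_near {f : ℂ → ℂ} (h : UpDecay K.cutDomain f) (q : ℝ) {a C r : ℝ}
    (ha : a < 0) (hC : 0 < C) (hr : 0 < r)
    (hf : ∀ z : ℂ, 0 < ‖z - q‖ → ‖z - q‖ < r → ‖f z‖ ≤ C * ‖z - q‖ ^ (a - 1)) :
    ∃ C' r' : ℝ, 0 < r' ∧ ∀ z : ℂ, 0 ≤ z.im → 0 < ‖z - q‖ → ‖z - q‖ < r' →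
      ‖upPrim f z‖ ≤ C' * ‖z - q‖ ^ a := by
  obtain ⟨M, hM, hb⟩ := exists_vertical_bound h q (g := fun x => C * x ^ (a - 1)) hr hf
  refine ⟨C * 2 ^ (1 - a) / (-a) + M, min (r / 2) 1, by positivity, fun z him h0 h1 => ?_⟩
  set x := ‖z - q‖ with hx
  have hi1 := (integrableOn_add_rpow ha h0).const_mul (C * 2 ^ (1 - a))
  have hi2 := (integrableOn_add_rpow (a := -1) (by norm_num) one_pos).const_mul M
  have h2 := norm_upPrim_le (f := f) (z := z) (hi1.add hi2) ?_
  · simp only [Pi.add_apply] at h2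
    rw [integral_add hi1 hi2, integral_const_mul, integral_const_mul, integral_add_rpow ha h0,
      integral_add_rpow (by norm_num) one_pos] at h2
    refine h2.trans ?_
    have h3 : 1 ≤ x ^ a :=
      Real.one_le_rpow_of_pos_of_le_one_of_nonpos h0 (h1.le.trans (min_le_right _ _)) ha.le
    simp only [Real.one_rpow, neg_neg, div_one, mul_one]
    rw [add_mul]
    refine add_le_add (le_of_eq (by ring)) ?_
    nlinarith
  · intro t ht
    have him' : 0 ≤ (z - q).im := by simpa using him
    have n1 : 0 ≤ C * 2 ^ (1 - a) * (x + t) ^ (a - 1) := by positivity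
    have n2 : 0 ≤ M * (1 + t) ^ ((-1 : ℝ) - 1) := by positivity
    rcases hb z him (h1.trans_le (min_le_left _ _)) t ht with ⟨-, h3⟩ | h3
    · refine (h3.trans ?_).trans (le_add_of_nonneg_right n2)
      have h4 := norm_add_I_mul_ge him' ht.le
      rw [← hx, show (z - q) + Complex.I * t = z + Complex.I * t - q by ring] at h4
      calc C * ‖z + Complex.I * t - q‖ ^ (a - 1) ≤ C * ((x + t) / 2) ^ (a - 1) := by
            refine mul_le_mul_of_nonneg_left ?_ hC.le
            exact Real.rpow_le_rpow_of_nonpos (by positivity) h4 (by linarith)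
        _ = _ := by
            rw [Real.div_rpow (by positivity) (by norm_num), show (1 - a) = -(a - 1) by ring,
              Real.rpow_neg (by norm_num)]
            ring
    · exact h3.trans (le_add_of_nonneg_left n1)

/-- At a point where the kernel has a positive exponent the vertical primitive is continuous. -/
lemma continuousWithinAt_upPrim {f : ℂ → ℂ} (h : UpDecay K.cutDomain f) (q : ℝ) {a C r : ℝ}
    (ha : 0 < a) (hC : 0 < C) (hr : 0 < r)
    (hf : ∀ z : ℂ, 0 < ‖z - q‖ → ‖z - q‖ < r → ‖f z‖ ≤ C * ‖z - q‖ ^ (a - 1)) :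
    ContinuousWithinAt (upPrim f) {z | 0 ≤ z.im} q := by
  obtain ⟨M, hM, hb⟩ := exists_vertical_bound h q (g := fun x => C * x ^ (a - 1))
    (r := min r 1) (by positivity) fun z h0 h1 => hf z h0 (h1.trans_le (min_le_left _ _))
  -- Capping the exponent at one makes x^(a' - 1) nonincreasing in x, so the distance to `q` may be
  -- replaced by its lower bound `t`.
  set a' := min a 1
  have ha' : 0 < a' := lt_min ha one_pos
  -- The local bound is used only for `t ≤ 1`, where `exp 1 * exp (-t) ≥ 1`. Inserting this factor
  -- turns the local part of the majorant into a Gamma integrand, integrable on the whole half-line.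
  refine Tendsto.neg (tendsto_integral_filter_of_dominated_convergence
    (fun t => C * Real.exp 1 * (Real.exp (-t) * t ^ (a' - 1)) + M * (1 + t) ^ ((-1 : ℝ) - 1))
    ?_ ?_ ?_ ?_)
  · filter_upwards [self_mem_nhdsWithin] with z hz
    refine ContinuousOn.aestronglyMeasurable ?_ measurableSet_Ioi
    refine ContinuousOn.mul_const (h.differentiableOn.continuousOn.comp (by fun_prop) ?_) _
    intro t ht
    left
    replace hz : 0 ≤ z.im := hz
    replace ht : 0 < t := ht
    simp; linarith
  · have hball : ∀ᶠ z : ℂ in 𝓝[{z | 0 ≤ z.im}] (q : ℂ), ‖z - q‖ < min r 1 / 2 := by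
      refine mem_nhdsWithin_of_mem_nhds ?_
      filter_upwards [Metric.ball_mem_nhds (q : ℂ) (show 0 < min r 1 / 2 by positivity)] with z hz
      rwa [Metric.mem_ball, dist_eq_norm] at hz
    filter_upwards [self_mem_nhdsWithin, hball] with z hz hzb
    filter_upwards [ae_restrict_mem measurableSet_Ioi] with t ht
    replace hz : 0 ≤ z.im := hz
    replace ht : 0 < t := ht
    have n1 : 0 ≤ C * Real.exp 1 * (Real.exp (-t) * t ^ (a' - 1)) := by positivity
    have n2 : 0 ≤ M * (1 + t) ^ ((-1 : ℝ) - 1) := by positivity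
    rw [norm_mul, Complex.norm_I, mul_one]
    rcases hb z hz hzb t ht with ⟨h2, h3⟩ | h3
    · refine (h3.trans ?_).trans (le_add_of_nonneg_right n2)
      have h4 : t ≤ ‖z + Complex.I * t - q‖ := by
        have := (le_abs_self _).trans (Complex.abs_im_le_norm (z + Complex.I * t - q))
        simp at this
        linarith
      have h5 : ‖z + Complex.I * t - q‖ ≤ 1 := h2.le.trans (min_le_right _ _)
      have h6 : ‖z + Complex.I * t - q‖ ^ (a - 1) ≤ t ^ (a' - 1) :=
        calc _ ≤ ‖z + Complex.I * t - q‖ ^ (a' - 1) :=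
              Real.rpow_le_rpow_of_exponent_ge (ht.trans_le h4) h5
                (by linarith [min_le_left a 1])
          _ ≤ _ := Real.rpow_le_rpow_of_nonpos ht h4 (by linarith [min_le_right a 1])
      have h7 : 1 ≤ Real.exp 1 * Real.exp (-t) := by
        rw [← Real.exp_add]
        exact Real.one_le_exp (by linarith)
      calc C * ‖z + Complex.I * t - q‖ ^ (a - 1) ≤ C * (1 * t ^ (a' - 1)) := by
            rw [one_mul]; gcongr
        _ ≤ C * (Real.exp 1 * Real.exp (-t) * t ^ (a' - 1)) := by gcongr
        _ = _ := by ring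
    · exact h3.trans (le_add_of_nonneg_left n1)
  · exact ((Real.GammaIntegral_convergent ha').const_mul _).add
      ((integrableOn_add_rpow (a := -1) (by norm_num) one_pos).const_mul M)
  · filter_upwards [ae_restrict_mem measurableSet_Ioi] with t ht
    refine Tendsto.mul_const _ (Tendsto.mono_left ?_ nhdsWithin_le_nhds)
    have h0 : (q : ℂ) + Complex.I * t ∈ K.cutDomain := Or.inl (by simpa using ht)
    have h1 : ContinuousAt f (q + Complex.I * t) :=
      (h.differentiableOn.differentiableAt (h.isOpen.mem_nhds h0)).continuousAt
    have h2 : ContinuousAt (fun z : ℂ => z + Complex.I * t) q := by fun_prop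
    exact ContinuousAt.comp (f := fun z : ℂ => z + Complex.I * t) h1 h2

/-- For a positive exponent the primitive is the integral of `f` over the segment from `q` to `z`,
since it vanishes at `q`, and s^(a - 1) is integrable at 0. The vanishing is essential: near a zero
of the kernel, a primitive with a nonzero value would not be bounded by the kernel. -/
lemma exists_upPrim_bound_near_of_eq_zero {f : ℂ → ℂ} (h : UpDecay K.cutDomain f) (q : ℝ)
    {a C r : ℝ} (ha : 0 < a) (hC : 0 < C) (hr : 0 < r)
    (hf : ∀ z : ℂ, 0 < ‖z - q‖ → ‖z - q‖ < r →
      z ∈ K.regular ∧ ‖f z‖ ≤ C * ‖z - q‖ ^ (a - 1)) (h0 : upPrim f q = 0) :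
    ∃ C' r' : ℝ, 0 < r' ∧ ∀ z : ℂ, 0 ≤ z.im → 0 < ‖z - q‖ → ‖z - q‖ < r' →
      ‖upPrim f z‖ ≤ C' * ‖z - q‖ ^ a := by
  refine ⟨C / a, r, hr, fun z him hz0 hzr => ?_⟩
  set x := ‖z - q‖ with hx
  have hpos : ∀ s : ℝ, 0 < s → ‖(q : ℂ) + (z - q) * s - q‖ = x * s := by
    intro s hs
    rw [add_sub_cancel_left, norm_mul, Complex.norm_real, Real.norm_of_nonneg hs.le]
  have hreg : ∀ s : ℝ, 0 < s → s ≤ 1 → (q : ℂ) + (z - q) * s ∈ K.cutDomain ∧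
      ‖f (q + (z - q) * s)‖ ≤ C * (x * s) ^ (a - 1) := by
    intro s hs hs1
    have h1 := hf (q + (z - q) * s) (by rw [hpos s hs]; positivity)
      (by rw [hpos s hs]; nlinarith)
    rw [hpos s hs] at h1
    exact ⟨mem_cutDomain_of_regular h1.1 (by simp; positivity), h1.2⟩
  have hcont : ContinuousOn (fun s : ℝ => upPrim f (q + (z - q) * s)) (Icc 0 1) := by
    intro s hs
    rcases hs.1.eq_or_lt with rfl | hs0
    · have h1 : ContinuousWithinAt (upPrim f) {z | 0 ≤ z.im} (q + (z - q) * (0 : ℝ)) := by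
        simpa using continuousWithinAt_upPrim h q ha hC hr fun z h0 h1 => (hf z h0 h1).2
      refine ContinuousWithinAt.comp (f := fun s : ℝ => (q : ℂ) + (z - q) * s) h1
        (by fun_prop) fun s hs => ?_
      have := hs.1
      simp; positivity
    · have h1 := (h.hasDerivAt_upPrim (hreg s hs0 hs.2).1).continuousAt
      have h2 : ContinuousAt (fun s : ℝ => (q : ℂ) + (z - q) * s) s := by fun_prop
      exact (ContinuousAt.comp (f := fun s : ℝ => (q : ℂ) + (z - q) * s) h1 h2).continuousWithinAt
  have hder : ∀ s ∈ Ioo (0 : ℝ) 1, HasDerivAt (fun s : ℝ => upPrim f (q + (z - q) * s))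
      (f (q + (z - q) * s) * (z - q)) s := by
    intro s hs
    have h1 : HasDerivAt (fun t : ℝ => (q : ℂ) + (z - q) * (t : ℂ)) (z - q) s := by
      simpa using ((Complex.ofRealCLM.hasDerivAt (x := s)).const_mul (z - q)).const_add (q : ℂ)
    exact HasDerivAt.comp (h₂ := upPrim f) s (h.hasDerivAt_upPrim (hreg s hs.1 hs.2.le).1) h1
  have hbd : ∀ s ∈ Ioc (0 : ℝ) 1, ‖f (q + (z - q) * s) * (z - q)‖ ≤ C * x ^ a * s ^ (a - 1) := by
    intro s hs
    rw [norm_mul, ← hx]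
    refine (mul_le_mul_of_nonneg_right (hreg s hs.1 hs.2).2 hz0.le).trans (le_of_eq ?_)
    rw [Real.mul_rpow hz0.le hs.1.le, Real.rpow_sub_one hz0.ne']
    field_simp
  have hgi : IntervalIntegrable (fun s : ℝ => C * x ^ a * s ^ (a - 1)) volume 0 1 :=
    (intervalIntegral.intervalIntegrable_rpow' (by linarith)).const_mul _
  have hfi : IntervalIntegrable (fun s : ℝ => f (q + (z - q) * s) * (z - q)) volume 0 1 := by
    rw [intervalIntegrable_iff_integrableOn_Ioc_of_le zero_le_one] at hgi ⊢
    refine Integrable.mono' hgi (ContinuousOn.aestronglyMeasurable ?_ measurableSet_Ioc) ?_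
    · exact (h.differentiableOn.continuousOn.comp (by fun_prop)
        fun s hs => (hreg s hs.1 hs.2).1).mul_const _
    · filter_upwards [ae_restrict_mem measurableSet_Ioc] with s hs using hbd s hs
  have hftc := intervalIntegral.integral_eq_sub_of_hasDerivAt_of_le zero_le_one hcont hder hfi
  have e1 : (q : ℂ) + (z - q) * (1 : ℝ) = z := by push_cast; ring
  have e0 : (q : ℂ) + (z - q) * (0 : ℝ) = q := by push_cast; ring
  rw [e1, e0, h0, sub_zero] at hftc
  rw [← hftc]
  refine (intervalIntegral.norm_integral_le_of_norm_le zero_le_one ?_ hgi).trans (le_of_eq ?_)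
  · exact Eventually.of_forall fun s hs => hbd s hs
  · rw [intervalIntegral.integral_const_mul, integral_rpow (Or.inl (by linarith))]
    simp [ha.ne']
    ring

namespace PoleFactor

variable {R : ℂ → ℂ}

/-- At infinity the kernel has exact order `S = -1 + ∑ ex < 0`. The factor `R` costs one power of
‖z‖, and the vertical integration regains it. -/
lemma exists_upPrim_le_kern_infty (h : K.PoleFactor R) : ∃ C ρ : ℝ, ∀ z : ℂ, 0 ≤ z.im → ρ ≤ ‖z‖ →
    ‖upPrim (K.form R) z‖ ≤ C * ‖K.kern z‖ := by
  obtain ⟨c, C, ρ, hc, hC, hρ, hb⟩ := K.exists_kern_bounds_infty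
  obtain ⟨C', ρ', hb'⟩ := h.infty
  set S := -1 + ∑ m, K.ex m with hS
  have hS0 : S < 0 := by linarith [K.sum_ex]
  -- The power of two is the factor 1/2 of `norm_add_I_mul_ge` raised to `S - 1`.
  set D := C * (|C'| + 1) * 2 ^ (1 - S)
  have hD : 0 < D := by positivity
  refine ⟨D / (-S) / c, max ρ ρ', fun z him hz => ?_⟩
  have hz0 : 0 < ‖z‖ := hρ.trans_le ((le_max_left _ _).trans hz)
  have h1 := norm_upPrim_le (f := K.form R) (z := z)
    (g := fun t => D * (‖z‖ + t) ^ (S - 1))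
    ((integrableOn_add_rpow hS0 hz0).const_mul _) ?_
  · rw [integral_const_mul, integral_add_rpow hS0 hz0] at h1
    refine h1.trans ?_
    have h2 := (hb z ((le_max_left _ _).trans hz)).2.1
    rw [div_mul_eq_mul_div, le_div_iff₀ hc]
    have h3 : 0 ≤ D / (-S) := div_nonneg hD.le (by linarith)
    calc D * (‖z‖ ^ S / -S) * c = D / (-S) * (c * ‖z‖ ^ S) := by ring
      _ ≤ _ := by gcongr
  · intro t ht
    have h2 := norm_add_I_mul_ge him ht.le
    have h3 : max ρ ρ' ≤ ‖z + Complex.I * t‖ := hz.trans (norm_le_norm_add_I_mul him ht.le)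
    set y := z + Complex.I * t
    have hy : 0 < ‖y‖ := lt_of_lt_of_le (by positivity) h2
    have h4 := (hb y ((le_max_left _ _).trans h3)).2.2
    have h5 : ‖R y‖ ≤ (|C'| + 1) / ‖y‖ := by
      refine (hb' y ((le_max_right _ _).trans h3)).trans ?_
      gcongr
      linarith [le_abs_self C']
    rw [form, norm_mul]
    calc ‖K.kern y‖ * ‖R y‖ ≤ C * ‖y‖ ^ S * ((|C'| + 1) / ‖y‖) := by gcongr
      _ = C * (|C'| + 1) * ‖y‖ ^ (S - 1) := by rw [Real.rpow_sub_one hy.ne']; ring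
      _ ≤ C * (|C'| + 1) * ((‖z‖ + t) / 2) ^ (S - 1) := by
          refine mul_le_mul_of_nonneg_left ?_ (by positivity)
          exact Real.rpow_le_rpow_of_nonpos (by positivity) h2 (by linarith)
      _ = _ := by
          rw [Real.div_rpow (by positivity) (by norm_num), show D = C * (|C'| + 1) * 2 ^ (-(S - 1)) by
            rw [_root_.neg_sub], Real.rpow_neg (by norm_num)]
          ring

/-- A simple pole of `R` lowers the exponent by one and integration raises it again. A negative
exponent needs no condition, whereas at a positive one the constant of integration has to be zero.
-/
lemma exists_upPrim_le_kern_near (h : K.PoleFactor R) (o : Option ι)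
    (ho : 0 < K.expo o → upPrim (K.form R) (K.point o) = 0) : ∃ C r : ℝ, 0 < r ∧ ∀ z : ℂ,
    0 ≤ z.im → 0 < ‖z - K.point o‖ → ‖z - K.point o‖ < r →
      ‖upPrim (K.form R) z‖ ≤ C * ‖K.kern z‖ := by
  obtain ⟨C, r, hC, hr, hb⟩ := h.exists_form_bound_near o
  obtain ⟨c, _, r₁, hc, _, hr₁, hb₁⟩ := K.exists_kern_bounds_near o
  have hne : K.expo o ≠ 0 := by cases o <;> simp [K.ex_ne]
  obtain ⟨C', r', hr', hb'⟩ : ∃ C' r' : ℝ, 0 < r' ∧ ∀ z : ℂ, 0 ≤ z.im → 0 < ‖z - K.point o‖ →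
      ‖z - K.point o‖ < r' → ‖upPrim (K.form R) z‖ ≤ C' * ‖z - K.point o‖ ^ K.expo o := by
    rcases hne.lt_or_gt with h0 | h0
    · exact exists_upPrim_bound_near h.upDecay _ h0 hC hr fun z h1 h2 => (hb z h1 h2).2
    · exact exists_upPrim_bound_near_of_eq_zero h.upDecay _ h0 hC hr hb (ho h0)
  refine ⟨|C'| / c, min r₁ r', lt_min hr₁ hr', fun z him h0 h1 => ?_⟩
  refine (hb' z him h0 (h1.trans_le (min_le_right _ _))).trans ?_
  have h2 := (hb₁ z h0 (h1.trans_le (min_le_left _ _))).2.1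
  rw [div_mul_eq_mul_div, le_div_iff₀ hc]
  calc _ ≤ |C'| * ‖z - K.point o‖ ^ K.expo o * c := by gcongr; exact le_abs_self _
    _ = |C'| * (c * ‖z - K.point o‖ ^ K.expo o) := by ring
    _ ≤ _ := by gcongr

end PoleFactor

end KernelData

end

/-! ### Comparison of the upper and the lower branch -/

noncomputable section

open MeasureTheory Set

namespace KernelData

variable {ι : Type*} [Fintype ι] (K : KernelData ι)

/-- The set `T` of reals contains no singular point. -/
def IsFree (T : Set ℝ) : Prop := ∀ x ∈ T, ∀ o, x ≠ K.point o

variable {K}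

lemma IsFree.mem_cutDomain {T : Set ℝ} (hT : K.IsFree T) {z : ℂ} (hz : z.re ∈ T) :
    z ∈ K.cutDomain := Or.inr (hT _ hz)

lemma IsFree.neg_mem_cutDomain {T : Set ℝ} (hT : K.IsFree T) {z : ℂ} (hz : z.re ∈ T) :
    -z ∈ K.neg.cutDomain := Or.inr fun o => by simpa using hT _ hz o

lemma IsFree.ne_zero {T : Set ℝ} (hT : K.IsFree T) {z : ℂ} (hz : z.re ∈ T) : z ≠ 0 := by
  rintro rfl
  exact hT _ hz none (by simp)

/-- Over a convex set of real parts without singular points the upper and the lower branch of the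
kernel differ by a constant. -/
lemma IsFree.exists_kern_eq {T : Set ℝ} (hT : K.IsFree T) (hc : Convex ℝ T) :
    ∃ c : ℂ, c ≠ 0 ∧ ∀ z : ℂ, z.re ∈ T → K.kern z = c * K.neg.kern (-z) := by
  have hS : IsPreconnected (Complex.re ⁻¹' T) :=
    (hc.linear_preimage Complex.reLm).isPreconnected
  have h₁ : ∀ m, ContinuousOn (fun z => Complex.log (-Complex.I * (z - K.pt m)))
      (Complex.re ⁻¹' T) := fun m => ContinuousOn.clog (by fun_prop) fun z hz =>
    K.mem_slitPlane (K.cutDomain_subset_cutReg (hT.mem_cutDomain hz)) m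
  have h₂ : ∀ m, ContinuousOn (fun z => Complex.log (-Complex.I * (-z - K.neg.pt m)))
      (Complex.re ⁻¹' T) := fun m => ContinuousOn.clog (by fun_prop) fun z hz =>
    K.neg.mem_slitPlane (K.neg.cutDomain_subset_cutReg (hT.neg_mem_cutDomain hz)) m
  obtain ⟨c, hc0, h⟩ := exists_prod_exp_eq hS (ex := K.ex) h₁ h₂
    (γ₁ := -Complex.I) (γ₂ := Complex.I) (p := fun m z => z - K.pt m)
    (fun m z hz => Complex.exp_log (Complex.slitPlane_ne_zero
      (K.mem_slitPlane (K.cutDomain_subset_cutReg (hT.mem_cutDomain hz)) m)))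
    (fun m z hz => by
      rw [Complex.exp_log (Complex.slitPlane_ne_zero
        (K.neg.mem_slitPlane (K.neg.cutDomain_subset_cutReg (hT.neg_mem_cutDomain hz)) m))]
      simp only [neg_pt, Complex.ofReal_neg]
      ring)
  -- The sign comes from the factor (-z)⁻¹ of the reflected kernel.
  refine ⟨-c, neg_ne_zero.2 hc0, fun z hz => ?_⟩
  have := h z hz
  simp only [kern, kernReg, neg_ex]
  rw [this, inv_neg]
  ring

/-- If the combination of the two branches given by `c`, `c'` is continuous across `T`, then the
corresponding combination of primitives is constant over `T`. -/
lemma upPrim_combination_eq {R : ℂ → ℂ} {E E' : Set ℂ} (h : UpDecay E (K.form R))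
    (h' : UpDecay E' (K.neg.form fun z => R (-z))) {T : Set ℝ} (hTo : IsOpen T) (hTc : Convex ℝ T)
    {c c' : ℂ} (hE : ∀ z : ℂ, z.re ∈ T → z ∈ E) (hE' : ∀ z : ℂ, z.re ∈ T → -z ∈ E')
    (hc : ∀ z : ℂ, z.re ∈ T → c * K.kern z = c' * K.neg.kern (-z)) {z z₀ : ℂ} (hz : z.re ∈ T)
    (hz₀ : z₀.re ∈ T) :
    c * upPrim (K.form R) z + c' * upPrim (K.neg.form fun z => R (-z)) (-z) =
      c * upPrim (K.form R) z₀ + c' * upPrim (K.neg.form fun z => R (-z)) (-z₀) := by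
  have hSo : IsOpen (Complex.re ⁻¹' T) := hTo.preimage Complex.continuous_re
  have hSc : Convex ℝ (Complex.re ⁻¹' T) := hTc.linear_preimage Complex.reLm
  have hder : ∀ y ∈ Complex.re ⁻¹' T, HasDerivAt (fun z => c * upPrim (K.form R) z +
      c' * upPrim (K.neg.form fun z => R (-z)) (-z)) 0 y := by
    intro y hy
    have h1 := (h.hasDerivAt_upPrim (hE y hy)).const_mul c
    have h2 := (HasDerivAt.comp (h₂ := upPrim (K.neg.form fun z => R (-z))) y
      (h'.hasDerivAt_upPrim (hE' y hy)) (hasDerivAt_neg y)).const_mul c'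
    refine (h1.add h2).congr_deriv ?_
    have := hc y hy
    simp only [form, neg_neg]
    linear_combination R y * this
  exact hSo.is_const_of_deriv_eq_zero hSc.isPreconnected
    (fun y hy => (hder y hy).differentiableAt.differentiableWithinAt)
    (fun y hy => (hder y hy).deriv) hz hz₀

variable (K) in
/-- The quotients primitive / kernel of the upper and of the lower branch agree at `z`. -/
def Good (R : ℂ → ℂ) (z : ℂ) : Prop :=
  upPrim (K.form R) z * K.neg.kern (-z) +
    upPrim (K.neg.form fun z => R (-z)) (-z) * K.kern z = 0

/-- The normalisation of the branches is irrelevant for goodness. Any constants that match the two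
branches at `z` turn it into the vanishing of the combination that `upPrim_combination_eq` shows to
be constant on strips. -/
lemma good_iff {R : ℂ → ℂ} {z c c' : ℂ} (hz : z ≠ 0) (hc : c ≠ 0)
    (h : c * K.kern z = c' * K.neg.kern (-z)) :
    K.Good R z ↔ c * upPrim (K.form R) z + c' * upPrim (K.neg.form fun z => R (-z)) (-z) = 0 := by
  have hk : K.neg.kern (-z) ≠ 0 := K.neg.kern_ne_zero (neg_ne_zero.2 hz)
  have : c * (upPrim (K.form R) z * K.neg.kern (-z) +
      upPrim (K.neg.form fun z => R (-z)) (-z) * K.kern z) = K.neg.kern (-z) *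
      (c * upPrim (K.form R) z + c' * upPrim (K.neg.form fun z => R (-z)) (-z)) := by
    linear_combination upPrim (K.neg.form fun z => R (-z)) (-z) * h
  rw [Good, ← mul_eq_zero_iff_left hc, this, mul_eq_zero_iff_left hk]

namespace PoleFactor

variable {R : ℂ → ℂ}

/-- Goodness spreads over vertical strips without singular points. -/
lemma good_of_good (h : K.PoleFactor R) {T : Set ℝ} (hTo : IsOpen T) (hTc : Convex ℝ T)
    (hT : K.IsFree T) {z z₀ : ℂ} (hz : z.re ∈ T) (hz₀ : z₀.re ∈ T) (hg : K.Good R z₀) :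
    K.Good R z := by
  obtain ⟨c, hc, he⟩ := hT.exists_kern_eq hTc
  rw [good_iff (c := 1) (c' := c) (hT.ne_zero hz) one_ne_zero (by rw [one_mul, he z hz])]
  rw [good_iff (c := 1) (c' := c) (hT.ne_zero hz₀) one_ne_zero (by rw [one_mul, he z₀ hz₀])] at hg
  rw [← hg]
  exact upPrim_combination_eq h.upDecay h.neg.upDecay hTo hTc (fun z hz => hT.mem_cutDomain hz)
    (fun z hz => hT.neg_mem_cutDomain hz) (fun z hz => by rw [one_mul, he z hz]) hz hz₀

/-- All points of an unbounded strip without singular points are good. -/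
lemma good_of_unbounded (h : K.PoleFactor R) {T : Set ℝ} (hTo : IsOpen T) (hTc : Convex ℝ T)
    (hT : K.IsFree T) {l : Filter ℝ} [l.NeBot] (hl : ∀ᶠ x in l, x ∈ T)
    (hl' : Tendsto (fun x : ℝ => |x|) l atTop) {z : ℂ} (hz : z.re ∈ T) : K.Good R z := by
  obtain ⟨c, hc, he⟩ := hT.exists_kern_eq hTc
  rw [good_iff (c := 1) (c' := c) (hT.ne_zero hz) one_ne_zero (by rw [one_mul, he z hz])]
  obtain ⟨C₁, ρ₁, -, hb₁⟩ := h.upDecay.exists_norm_upPrim_le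
  obtain ⟨C₂, ρ₂, -, hb₂⟩ := h.neg.upDecay.exists_norm_upPrim_le
  -- Both primitives tend to zero along the unbounded real interval, so their constant combination
  -- is zero.
  have h1 : Tendsto (fun x : ℝ => upPrim (K.form R) x) l (𝓝 0) := by
    refine squeeze_zero_norm' ?_ (hl'.const_div_atTop C₁)
    filter_upwards [hl, hl'.eventually_ge_atTop ρ₁] with x hx hx'
    simpa using hb₁ x (hT.mem_cutDomain (by simpa using hx)) (by simp) (by simpa using hx')
  have h2 : Tendsto (fun x : ℝ => upPrim (K.neg.form fun z => R (-z)) (-x)) l (𝓝 0) := by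
    refine squeeze_zero_norm' ?_ (hl'.const_div_atTop C₂)
    filter_upwards [hl, hl'.eventually_ge_atTop ρ₂] with x hx hx'
    simpa using hb₂ (-x) (hT.neg_mem_cutDomain (by simpa using hx)) (by simp) (by simpa using hx')
  have h3 := (h1.const_mul 1).add (h2.const_mul c)
  rw [mul_zero, mul_zero, add_zero] at h3
  refine tendsto_nhds_unique (f := fun _ : ℝ => (_ : ℂ)) (l := l) tendsto_const_nhds (h3.congr' ?_)
  filter_upwards [hl] with x hx
  exact upPrim_combination_eq h.upDecay h.neg.upDecay hTo hTc (fun z hz => hT.mem_cutDomain hz)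
    (fun z hz => hT.neg_mem_cutDomain hz) (fun z hz => by rw [one_mul, he z hz])
    (by simpa using hx) hz

lemma continuousWithinAt_upPrim (h : K.PoleFactor R) {o : Option ι} (ho : 0 < K.expo o) :
    ContinuousWithinAt (upPrim (K.form R)) {z | 0 ≤ z.im} (K.point o) := by
  obtain ⟨C, r, hC, hr, hb⟩ := h.exists_form_bound_near o
  exact KernelData.continuousWithinAt_upPrim h.upDecay _ ho hC hr fun z h1 h2 => (hb z h1 h2).2

/-- Goodness next to a point with a positive exponent. -/
lemma good_iff_of_pos (h : K.PoleFactor R) {o : Option ι} (ho : 0 < K.expo o) {T : Set ℝ}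
    (hTo : IsOpen T) (hTc : Convex ℝ T) (hT : K.IsFree T) (hcl : K.point o ∈ closure T) :
    ∃ c : ℂ, c ≠ 0 ∧ ∀ z : ℂ, z.re ∈ T → (K.Good R z ↔ upPrim (K.form R) (K.point o) +
      c * upPrim (K.neg.form fun z => R (-z)) (-K.point o) = 0) := by
  obtain ⟨c, hc, he⟩ := hT.exists_kern_eq hTc
  refine ⟨c, hc, fun z hz => ?_⟩
  rw [good_iff (c := 1) (c' := c) (hT.ne_zero hz) one_ne_zero (by rw [one_mul, he z hz])]
  have := mem_closure_iff_nhdsWithin_neBot.1 hcl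
  have h1 : Tendsto (fun x : ℝ => upPrim (K.form R) x) (𝓝[T] (K.point o))
      (𝓝 (upPrim (K.form R) (K.point o))) := by
    refine (h.continuousWithinAt_upPrim ho).tendsto.comp (tendsto_nhdsWithin_iff.2 ⟨?_, ?_⟩)
    · exact (Complex.continuous_ofReal.tendsto _).mono_left nhdsWithin_le_nhds
    · exact Eventually.of_forall fun x => by simp
  have h2 : Tendsto (fun x : ℝ => upPrim (K.neg.form fun z => R (-z)) (-x)) (𝓝[T] (K.point o))
      (𝓝 (upPrim (K.neg.form fun z => R (-z)) (-K.point o))) := by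
    have := (h.neg.continuousWithinAt_upPrim (o := o) (by simpa using ho)).tendsto
    rw [neg_point, Complex.ofReal_neg] at this
    refine this.comp (tendsto_nhdsWithin_iff.2 ⟨?_, ?_⟩)
    · exact (Complex.continuous_ofReal.neg.tendsto _).mono_left nhdsWithin_le_nhds
    · exact Eventually.of_forall fun x => by simp
  have h3 := (h1.const_mul 1).add (h2.const_mul c)
  -- The combination is constant over `T` and both primitives extend continuously to the end point,
  -- so the constant is the value there.
  have h4 : (1 : ℂ) * upPrim (K.form R) z + c * upPrim (K.neg.form fun z => R (-z)) (-z) =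
      1 * upPrim (K.form R) (K.point o) + c * upPrim (K.neg.form fun z => R (-z)) (-K.point o) := by
    refine tendsto_nhds_unique (f := fun _ : ℝ => (_ : ℂ)) (l := 𝓝[T] (K.point o))
      tendsto_const_nhds (h3.congr' ?_)
    filter_upwards [self_mem_nhdsWithin] with x hx
    exact upPrim_combination_eq h.upDecay h.neg.upDecay hTo hTc (fun z hz => hT.mem_cutDomain hz)
      (fun z hz => hT.neg_mem_cutDomain hz) (fun z hz => by rw [one_mul, he z hz])
      (by simpa using hx) hz
  rw [h4, one_mul]

end PoleFactor

end KernelData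

/-! ### Vanishing periods force vanishing residues -/

/-- A bounded function that is holomorphic outside a finite set is constant there. -/
lemma exists_const_of_bounded (S : Finset ℂ) : ∀ G : ℂ → ℂ,
    (∀ z ∉ S, DifferentiableAt ℂ G z) → (∃ B : ℝ, ∀ z ∉ S, ‖G z‖ ≤ B) → ∃ k, ∀ z ∉ S, G z = k := by
  induction S using Finset.induction_on with
  | empty =>
    rintro G hd ⟨B, hB⟩
    refine ⟨G 0, fun z _ => ?_⟩
    refine Differentiable.apply_eq_apply_of_bounded (fun z => hd z (by simp)) ?_ _ _
    exact isBounded_iff_forall_norm_le.2 ⟨B, by rintro _ ⟨z, rfl⟩; exact hB z (by simp)⟩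
  | insert p S hp ih =>
    rintro G hd ⟨B, hB⟩
    have hopen : IsOpen ((S : Set ℂ)ᶜ) := S.finite_toSet.isClosed.isOpen_compl
    have hmem : (S : Set ℂ)ᶜ ∈ 𝓝 p := hopen.mem_nhds (by simpa using hp)
    -- Riemann's theorem removes one exceptional point at a time; Liouville's theorem is the base
    -- case.
    have hupd := Complex.differentiableOn_update_limUnder_of_bddAbove (f := G) hmem
      (fun z hz => (hd z (by
        simp only [Finset.mem_insert, not_or]
        exact ⟨hz.2, by simpa using hz.1⟩)).differentiableWithinAt)
      ⟨B, by
        rintro _ ⟨z, hz, rfl⟩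
        exact hB z (by
          simp only [Finset.mem_insert, not_or]
          exact ⟨hz.2, by simpa using hz.1⟩)⟩
    obtain ⟨k, hk⟩ := ih (Function.update G p (limUnder (𝓝[≠] p) G))
      (fun z hz => (hupd z (by simpa using hz)).differentiableAt (hopen.mem_nhds (by simpa using hz)))
      ⟨max B ‖limUnder (𝓝[≠] p) G‖, fun z hz => by
        by_cases h : z = p
        · subst h; simp
        · rw [Function.update_of_ne h]
          exact (hB z (by simp [h, hz])).trans (le_max_left _ _)⟩
    refine ⟨k, fun z hz => ?_⟩
    simp only [Finset.mem_insert, not_or] at hz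
    rw [← hk z hz.2, Function.update_of_ne hz.1]

namespace KernelData

variable {ι : Type*} [Fintype ι] {K : KernelData ι}

/-- Without neighbourhoods of infinity and of the singular points, what is left of the plane is
compact. -/
lemma exists_bound_of_local {G : ℂ → ℂ} (hc : ContinuousOn G K.regular)
    (hinf : ∃ C ρ : ℝ, ∀ z : ℂ, ρ ≤ ‖z‖ → z ∈ K.regular → ‖G z‖ ≤ C)
    (hnear : ∀ o, ∃ C r : ℝ, 0 < r ∧ ∀ z : ℂ, 0 < ‖z - K.point o‖ → ‖z - K.point o‖ < r →
      z ∈ K.regular → ‖G z‖ ≤ C) : ∃ B : ℝ, ∀ z ∈ K.regular, ‖G z‖ ≤ B := by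
  obtain ⟨C, ρ, hC⟩ := hinf
  choose c r hr hcr using hnear
  have hcomp : IsCompact (Metric.closedBall (0 : ℂ) ρ \ ⋃ o, Metric.ball (K.point o : ℂ) (r o)) :=
    (isCompact_closedBall _ _).diff (isOpen_iUnion fun _ => Metric.isOpen_ball)
  obtain ⟨M, hM⟩ := hcomp.exists_bound_of_continuousOn (f := G) (hc.mono fun z hz o ho => by
    refine hz.2 (mem_iUnion.2 ⟨o, ?_⟩)
    rw [ho]
    exact Metric.mem_ball_self (hr o))
  have hsum : ∀ o, |c o| ≤ ∑ o, |c o| := fun o =>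
    Finset.single_le_sum (f := fun o => |c o|) (fun _ _ => abs_nonneg _) (Finset.mem_univ o)
  have hs0 : 0 ≤ ∑ o, |c o| := Finset.sum_nonneg fun _ _ => abs_nonneg _
  refine ⟨|C| + |M| + ∑ o, |c o|, fun z hz => ?_⟩
  have a1 := abs_nonneg C
  have a2 := abs_nonneg M
  by_cases h1 : ρ ≤ ‖z‖
  · linarith [hC z h1 hz, le_abs_self C]
  by_cases h2 : ∃ o, ‖z - K.point o‖ < r o
  · obtain ⟨o, ho⟩ := h2
    have := hcr o z (norm_pos_iff.2 (sub_ne_zero.2 (hz o))) ho hz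
    linarith [hsum o, le_abs_self (c o)]
  · push Not at h1 h2
    have := hM z ⟨by simpa using h1.le, by simpa [dist_eq_norm] using h2⟩
    linarith [le_abs_self M]

lemma exists_isFree_Ioo {x : ℝ} (hx : ∀ o, x ≠ K.point o) :
    ∃ r : ℝ, 0 < r ∧ K.IsFree (Ioo (x - r) (x + r)) := by
  have : ∀ᶠ y : ℝ in 𝓝 x, ∀ o, y ≠ K.point o := by
    rw [eventually_all]
    exact fun o => isOpen_ne.mem_nhds (hx o)
  obtain ⟨r, hr, h⟩ := Metric.eventually_nhds_iff.1 this
  refine ⟨r, hr, fun y hy => h ?_⟩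
  rw [Real.dist_eq, abs_lt]
  constructor <;> linarith [hy.1, hy.2]

lemma exists_isFree_right (o : Option ι) : ∃ r : ℝ, 0 < r ∧
    K.IsFree (Ioo (K.point o) (K.point o + r)) := by
  obtain ⟨r, hr, h⟩ := K.exists_radius o
  refine ⟨r, hr, fun x hx o' ho' => ?_⟩
  have e : ‖(x : ℂ) - K.point o‖ = x - K.point o := by
    rw [← Complex.ofReal_sub, Complex.norm_real, Real.norm_of_nonneg (by linarith [hx.1])]
  exact h x (by rw [e]; linarith [hx.1]) (by rw [e]; linarith [hx.2]) o' (by rw [ho'])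

variable (K) in
/-- The rational function with simple poles and residues `e m` at `pt m`. -/
def poles (e : ι → ℂ) (z : ℂ) : ℂ := ∑ m, e m / (z - K.pt m)

lemma poleFactor_inv (m : ι) (e : ℂ) : K.PoleFactor fun z => e / (z - K.pt m) where
  differentiableOn := (differentiableOn_const _).div (by fun_prop) fun z hz => K.regular_sub_ne hz m
  near o := by
    by_cases h : o = some m
    · exact ⟨‖e‖, 1, one_pos, fun z _ _ => by rw [norm_div, h, point_some]⟩
    · set d := ‖(K.point o : ℂ) - K.pt m‖
      have hd : 0 < d := by
        rw [norm_pos_iff, sub_ne_zero]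
        exact fun hh => h (K.point_injective (by exact_mod_cast hh))
      refine ⟨‖e‖, d / 2, by positivity, fun z h0 h1 => ?_⟩
      rw [norm_div]
      have h2 : d ≤ ‖z - K.pt m‖ + ‖z - K.point o‖ := by
        have := norm_sub_le (z - K.pt m) (z - K.point o)
        rwa [sub_sub_sub_cancel_left] at this
      gcongr
      linarith
  infty := by
    refine ⟨2 * ‖e‖, 2 * |K.pt m| + 1, fun z hz => ?_⟩
    have h1 := norm_sub_norm_le z (K.pt m)
    rw [Complex.norm_real, Real.norm_eq_abs] at h1
    have h0 := abs_nonneg (K.pt m)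
    rw [norm_div, div_le_div_iff₀ (by linarith) (by linarith)]
    nlinarith [norm_nonneg e]

lemma PoleFactor.add {R R' : ℂ → ℂ} (h : K.PoleFactor R) (h' : K.PoleFactor R') :
    K.PoleFactor fun z => R z + R' z where
  differentiableOn := h.differentiableOn.add h'.differentiableOn
  near o := by
    obtain ⟨C, r, hr, hb⟩ := h.near o
    obtain ⟨C', r', hr', hb'⟩ := h'.near o
    refine ⟨C + C', min r r', lt_min hr hr', fun z h0 h1 => (norm_add_le _ _).trans ?_⟩
    rw [add_div]
    exact add_le_add (hb z h0 (h1.trans_le (min_le_left _ _)))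
      (hb' z h0 (h1.trans_le (min_le_right _ _)))
  infty := by
    obtain ⟨C, ρ, hb⟩ := h.infty
    obtain ⟨C', ρ', hb'⟩ := h'.infty
    refine ⟨C + C', max ρ ρ', fun z hz => (norm_add_le _ _).trans ?_⟩
    rw [add_div]
    exact add_le_add (hb z ((le_max_left _ _).trans hz)) (hb' z ((le_max_right _ _).trans hz))

lemma poleFactor_poles (e : ι → ℂ) : K.PoleFactor (K.poles e) := by
  have : ∀ s : Finset ι, K.PoleFactor fun z => ∑ m ∈ s, e m / (z - K.pt m) := by
    classical
    intro s
    induction s using Finset.induction_on with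
    | empty => exact ⟨by simp, fun o => ⟨0, 1, one_pos, by simp⟩, 0, 0, by simp⟩
    | insert a s ha ih =>
      simp_rw [Finset.sum_insert ha]
      exact (poleFactor_inv a _).add ih
  exact this _

/-- The residue at `pt m` is recovered by multiplying with `I * t` at `pt m + I * t` and letting `t`
decrease to 0. -/
lemma poles_eq_zero {e : ι → ℂ} (h : ∀ z : ℂ, 0 < z.im → K.poles e z = 0) : e = 0 := by
  classical
  funext m
  have h1 : Tendsto (fun t : ℝ => ∑ m', Complex.I * t * (e m' / (K.pt m + Complex.I * t - K.pt m')))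
      (𝓝[>] 0) (𝓝 (∑ m', if m' = m then e m else 0)) := by
    refine tendsto_finsetSum _ fun m' _ => ?_
    by_cases hm : m' = m
    · rw [if_pos hm, hm]
      refine tendsto_const_nhds.congr' ?_
      filter_upwards [self_mem_nhdsWithin] with t ht
      have : (t : ℂ) ≠ 0 := by exact_mod_cast (ne_of_gt ht)
      rw [add_sub_cancel_left]
      field_simp
    · rw [if_neg hm]
      have hne : (K.pt m : ℂ) + Complex.I * (0 : ℝ) - K.pt m' ≠ 0 := by
        simp only [Complex.ofReal_zero, mul_zero, add_zero]
        rw [sub_ne_zero]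
        exact fun hh => hm (K.pt_inj (by exact_mod_cast hh.symm))
      have : ContinuousAt (fun t : ℝ => Complex.I * t * (e m' / (K.pt m + Complex.I * t - K.pt m'))) 0 := by
        refine ContinuousAt.mul (by fun_prop) (ContinuousAt.div (by fun_prop) (by fun_prop) hne)
      have h2 := this.tendsto.mono_left (nhdsWithin_le_nhds (s := Ioi 0))
      simpa using h2
  simp only [Finset.sum_ite_eq', Finset.mem_univ, if_true] at h1
  refine tendsto_nhds_unique h1 (tendsto_const_nhds.congr' ?_)
  filter_upwards [self_mem_nhdsWithin] with t ht
  rw [← Finset.mul_sum]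
  have := h (K.pt m + Complex.I * t) (by simpa using ht)
  rw [poles] at this
  rw [this, mul_zero]
  rfl

/-- If all periods of `kern * ∑ e m / (z - pt m)` vanish, then all residues `e m` vanish. -/
theorem eq_zero_of_good {e : ι → ℂ} (hg : ∀ x : ℝ, (∀ o, x ≠ K.point o) → K.Good (K.poles e) x)
    (h0 : ∀ o, 0 < K.expo o → upPrim (K.form (K.poles e)) (K.point o) = 0) : e = 0 := by
  set R := K.poles e with hR
  have h : K.PoleFactor R := poleFactor_poles e
  -- Goodness on an adjacent interval transfers the vanishing at a zero of the kernel from the upper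
  -- primitive to the lower one.
  have h0' : ∀ o, 0 < K.neg.expo o →
      upPrim (K.neg.form fun z => R (-z)) (K.neg.point o) = 0 := by
    intro o ho
    rw [neg_expo] at ho
    obtain ⟨r, hr, hfree⟩ := K.exists_isFree_right o
    obtain ⟨c, hc, hiff⟩ := h.good_iff_of_pos ho isOpen_Ioo (convex_Ioo _ _) hfree
      (by rw [closure_Ioo (by linarith)]; exact ⟨le_rfl, by linarith⟩)
    have hm : K.point o + r / 2 ∈ Ioo (K.point o) (K.point o + r) := ⟨by linarith, by linarith⟩
    have h1 := (hiff ((K.point o + r / 2 : ℝ) : ℂ) (by rwa [Complex.ofReal_re])).1 (hg _ (hfree _ hm))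
    rw [h0 o ho, zero_add, mul_eq_zero_iff_left hc] at h1
    rw [neg_point, Complex.ofReal_neg, h1]
  set Gu : ℂ → ℂ := fun z => upPrim (K.form R) z / K.kern z with hGu
  set Gl : ℂ → ℂ := fun z => -(upPrim (K.neg.form fun z => R (-z)) (-z) / K.neg.kern (-z)) with hGl
  -- The quotient primitive / kernel, glued along the real axis. Near a regular real point goodness
  -- says that `Gu` and `Gl` coincide, which makes `G` holomorphic there.
  set G : ℂ → ℂ := fun z => if 0 ≤ z.im then Gu z else Gl z with hG
  have hdu : ∀ z ∈ K.cutDomain, DifferentiableAt ℂ Gu z := fun z hz =>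
    (h.upDecay.hasDerivAt_upPrim hz).differentiableAt.div
      (K.differentiableOn_kern.differentiableAt (K.isOpen_cutDomain.mem_nhds hz))
      (K.kern_ne_zero (K.regular_ne_zero (K.cutDomain_subset_regular hz)))
  have hdl : ∀ z, -z ∈ K.neg.cutDomain → DifferentiableAt ℂ Gl z := by
    intro z hz
    have h1 : DifferentiableAt ℂ (fun z => upPrim (K.neg.form fun z => R (-z)) z / K.neg.kern z) (-z) :=
      (h.neg.upDecay.hasDerivAt_upPrim hz).differentiableAt.div
      (K.neg.differentiableOn_kern.differentiableAt (K.neg.isOpen_cutDomain.mem_nhds hz))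
      (K.neg.kern_ne_zero (K.neg.regular_ne_zero (K.neg.cutDomain_subset_regular hz)))
    exact (DifferentiableAt.comp z h1 differentiableAt_id.fun_neg).neg
  have hdiff : ∀ z ∈ K.regular, DifferentiableAt ℂ G z := by
    intro z hz
    rcases lt_trichotomy z.im 0 with him | him | him
    · refine (hdl z (Or.inl (by simpa using him))).congr_of_eventuallyEq ?_
      filter_upwards [(isOpen_lt Complex.continuous_im continuous_const).mem_nhds him] with y hy
      exact if_neg (not_le.2 hy)
    · have hz' : z = (z.re : ℂ) := Complex.ext rfl (by simpa using him)
      obtain ⟨r, hr, hfree⟩ := exists_isFree_Ioo (K := K) (x := z.re)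
        (fun o ho => hz o (by rw [hz', ho]))
      have hm : z.re ∈ Ioo (z.re - r) (z.re + r) := ⟨by linarith, by linarith⟩
      refine (hdu z (hfree.mem_cutDomain hm)).congr_of_eventuallyEq ?_
      filter_upwards [(isOpen_Ioo.preimage Complex.continuous_re).mem_nhds hm] with y hy
      simp only [hG]
      split_ifs with hy0
      · rfl
      · have hgy : K.Good R y := h.good_of_good isOpen_Ioo (convex_Ioo _ _) hfree hy
          (z₀ := z) hm (by rw [hz']; exact hg _ (hfree _ hm))
        have h1 : K.kern y ≠ 0 := K.kern_ne_zero (hfree.ne_zero hy)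
        have h2 : K.neg.kern (-y) ≠ 0 := K.neg.kern_ne_zero (neg_ne_zero.2 (hfree.ne_zero hy))
        rw [hGu, hGl]
        simp only
        rw [eq_comm, eq_neg_iff_add_eq_zero, div_add_div _ _ h1 h2, div_eq_zero_iff]
        left
        rw [Good] at hgy
        linear_combination hgy
    · refine (hdu z (Or.inl him)).congr_of_eventuallyEq ?_
      filter_upwards [(isOpen_lt continuous_const Complex.continuous_im).mem_nhds him] with y hy
      exact if_pos (le_of_lt hy)
  have hcomb : ∀ {z : ℂ} {C C' : ℝ}, z ∈ K.regular →
      (0 ≤ z.im → ‖upPrim (K.form R) z‖ ≤ C * ‖K.kern z‖) →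
      (0 ≤ (-z).im → ‖upPrim (K.neg.form fun z => R (-z)) (-z)‖ ≤ C' * ‖K.neg.kern (-z)‖) →
      ‖G z‖ ≤ max C C' := by
    intro z C C' hz h1 h2
    have hz0 := K.regular_ne_zero hz
    simp only [hG]
    split_ifs with him
    · refine le_trans ?_ (le_max_left _ _)
      rw [hGu]
      simp only
      rw [norm_div, div_le_iff₀ (norm_pos_iff.2 (K.kern_ne_zero hz0))]
      exact h1 him
    · refine le_trans ?_ (le_max_right _ _)
      rw [hGl]
      simp only
      rw [norm_neg, norm_div, div_le_iff₀ (norm_pos_iff.2 (K.neg.kern_ne_zero (neg_ne_zero.2 hz0)))]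
      exact h2 (by simp; linarith)
  -- The comparison of primitive and kernel bounds both quotients; at positive exponents it uses
  -- `h0` and `h0'`.
  have hbdd : ∃ B : ℝ, ∀ z ∈ K.regular, ‖G z‖ ≤ B := by
    refine exists_bound_of_local (fun z hz => (hdiff z hz).continuousAt.continuousWithinAt) ?_ ?_
    · obtain ⟨C, ρ, hb⟩ := h.exists_upPrim_le_kern_infty
      obtain ⟨C', ρ', hb'⟩ := h.neg.exists_upPrim_le_kern_infty
      refine ⟨max C C', max ρ ρ', fun z hz hreg => hcomb hreg
        (fun him => hb z him ((le_max_left _ _).trans hz))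
        (fun him => hb' (-z) him ((le_max_right _ _).trans (by simpa using hz)))⟩
    · intro o
      obtain ⟨C, r, hr, hb⟩ := h.exists_upPrim_le_kern_near o (h0 o)
      obtain ⟨C', r', hr', hb'⟩ := h.neg.exists_upPrim_le_kern_near o (h0' o)
      refine ⟨max C C', min r r', lt_min hr hr', fun z hz0 hz1 hreg => hcomb hreg
        (fun him => hb z him hz0 (hz1.trans_le (min_le_left _ _))) (fun him => ?_)⟩
      have e : ‖-z - K.neg.point o‖ = ‖z - K.point o‖ := by
        rw [← norm_neg]; congr 1; simp; ring
      exact hb' (-z) him (by rwa [e]) (by rw [e]; exact hz1.trans_le (min_le_right _ _))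
  have hreg_iff : ∀ z : ℂ, z ∉ Finset.univ.image (fun o => (K.point o : ℂ)) ↔ z ∈ K.regular := by
    intro z
    simp [regular, eq_comm]
  obtain ⟨k, hk⟩ := exists_const_of_bounded (Finset.univ.image (fun o => (K.point o : ℂ))) G
    (fun z hz => hdiff z ((hreg_iff z).1 hz))
    (by obtain ⟨B, hB⟩ := hbdd; exact ⟨B, fun z hz => hB z ((hreg_iff z).1 hz)⟩)
  have hup : ∀ z : ℂ, 0 < z.im → upPrim (K.form R) z = k * K.kern z := by
    intro z hz
    have hreg : z ∈ K.regular := K.cutDomain_subset_regular (Or.inl hz)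
    have := hk z ((hreg_iff z).2 hreg)
    rw [hG] at this
    simp only [hz.le, if_true] at this
    rw [← this, div_mul_cancel₀ _ (K.kern_ne_zero (K.regular_ne_zero hreg))]
  -- At the origin the kernel has size 1 / ‖z‖, and `R` is regular because no `pt m` is zero. So the
  -- form is O(1 / ‖z‖) and its primitive is O(‖z‖ ^ (-1/2)), too small for a nonzero multiple of
  -- the kernel. Any exponent strictly between -1 and 0 would do in place of -1/2.
  have hk0 : k = 0 := by
    obtain ⟨c, C, r, hc, hC, hr, hb⟩ := K.exists_kern_bounds_near none
    have hRc : ContinuousAt R 0 := by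
      refine tendsto_finsetSum _ fun m _ => ?_
      refine ContinuousAt.div (by fun_prop) (by fun_prop) ?_
      simpa using K.pt_ne m
    obtain ⟨r₁, hr₁, hb₁⟩ := Metric.eventually_nhds_iff.1
      (Tendsto.eventually_lt_const (lt_add_one ‖R 0‖) hRc.norm)
    simp only [point_none, expo_none, Complex.ofReal_zero, sub_zero] at hb
    have hM : 0 < ‖R 0‖ + 1 := by positivity
    obtain ⟨C', r', hr', hb'⟩ := exists_upPrim_bound_near h.upDecay 0 (a := -(1 / 2))
      (C := C * (‖R 0‖ + 1)) (r := min (min r r₁) 1) (by norm_num) (by positivity) (by positivity)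
      (by
        intro z hz0 hz1
        rw [Complex.ofReal_zero, sub_zero] at hz0 hz1 ⊢
        have h1 := (hb z hz0 (hz1.trans_le ((min_le_left _ _).trans (min_le_left _ _)))).2.2
        have h2 := hb₁ (y := z) (by
          rw [dist_zero_right]
          exact hz1.trans_le ((min_le_left _ _).trans (min_le_right _ _)))
        have h3 : ‖z‖ ^ (-1 : ℝ) ≤ ‖z‖ ^ (-(1 / 2) - 1 : ℝ) :=
          Real.rpow_le_rpow_of_exponent_ge hz0 (hz1.le.trans (min_le_right _ _)) (by norm_num)
        rw [form, norm_mul]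
        calc _ ≤ C * ‖z‖ ^ (-1 : ℝ) * (‖R 0‖ + 1) := by gcongr
          _ ≤ C * ‖z‖ ^ (-(1 / 2) - 1 : ℝ) * (‖R 0‖ + 1) := by gcongr
          _ = _ := by ring)
    have hlim : Tendsto (fun t : ℝ => |C'| / c * t ^ (1 / 2 : ℝ)) (𝓝[>] 0) (𝓝 0) := by
      have : ContinuousAt (fun t : ℝ => |C'| / c * t ^ (1 / 2 : ℝ)) 0 :=
        (Real.continuousAt_rpow_const 0 (1 / 2) (Or.inr (by norm_num))).const_mul _
      simpa using this.tendsto.mono_left (nhdsWithin_le_nhds (s := Ioi 0))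
    have hle : ∀ᶠ t : ℝ in 𝓝[>] 0, ‖k‖ ≤ |C'| / c * t ^ (1 / 2 : ℝ) := by
      filter_upwards [Ioo_mem_nhdsGT (show (0 : ℝ) < min r r' from lt_min hr hr')] with t ht
      have ht0 : 0 < t := ht.1
      have e : ‖Complex.I * t‖ = t := by simp [abs_of_pos ht0]
      have h1 := (hb (Complex.I * t) (by rwa [e]) (by rw [e]; exact ht.2.trans_le (min_le_left _ _))).2.1
      have h2 := hb' (Complex.I * t) (by simp [ht0.le]) (by simp [ht0.ne'])
        (by rw [Complex.ofReal_zero, sub_zero, e]; exact ht.2.trans_le (min_le_right _ _))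
      rw [hup _ (by simpa using ht0), norm_mul, Complex.ofReal_zero, sub_zero, e] at h2
      rw [e] at h1
      have h3 : ‖k‖ * (c * t ^ (-1 : ℝ)) ≤ |C'| * t ^ (-(1 / 2) : ℝ) :=
        (mul_le_mul_of_nonneg_left h1 (norm_nonneg _)).trans
          (h2.trans (mul_le_mul_of_nonneg_right (le_abs_self _) (by positivity)))
      rw [Real.rpow_neg_one] at h3
      have h4 : t ^ (1 / 2 : ℝ) = t ^ (-(1 / 2) : ℝ) * t := by
        rw [← Real.rpow_add_one ht0.ne']; norm_num
      rw [h4]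
      field_simp at h3 ⊢
      linarith
    exact norm_le_zero_iff.1 (ge_of_tendsto hlim hle)
  -- The primitive vanishes in the upper half-plane, hence so does its derivative `kern * R`, and
  -- the kernel has no zeros there.
  refine poles_eq_zero (K := K) fun z hz => ?_
  have hzc : z ∈ K.cutDomain := Or.inl hz
  have h1 := h.upDecay.hasDerivAt_upPrim hzc
  have h2 : upPrim (K.form R) =ᶠ[𝓝 z] fun _ => 0 := by
    filter_upwards [(isOpen_lt continuous_const Complex.continuous_im).mem_nhds hz] with y hy
    rw [hup y hy, hk0, zero_mul]
  have h3 := h1.unique ((hasDerivAt_const z (0 : ℂ)).congr_of_eventuallyEq h2)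
  rw [form] at h3
  exact (mul_eq_zero.1 h3).resolve_left (K.kern_ne_zero (K.regular_ne_zero (K.cutDomain_subset_regular hzc)))

end KernelData

end

/-! ### Contour integrals as values of primitives -/

noncomputable section

open MeasureTheory Set

namespace KernelData

variable {ι : Type*} [Fintype ι] {K : KernelData ι} {R : ℂ → ℂ}

lemma add_mul_mem_cutDomain {z w : ℂ} (hz : z ∈ K.cutDomain) (hz0 : 0 ≤ z.im) (hw : 0 < w.im)
    {t : ℝ} (ht : 0 ≤ t) : z + w * t ∈ K.cutDomain := by
  rcases ht.eq_or_lt with rfl | ht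
  · simpa using hz
  · left
    have := mul_pos hw ht
    simp
    linarith

lemma point_add_mul_mem_cutDomain (o : Option ι) {w : ℂ} (hw : 0 < w.im) {t : ℝ} (ht : 0 < t) :
    (K.point o : ℂ) + w * t ∈ K.cutDomain := by
  left
  simpa using mul_pos hw ht

lemma PoleFactor.integrableOn_ray (h : K.PoleFactor R) {o : Option ι} (ho : 0 < K.expo o) {w : ℂ}
    (hw : 0 < w.im) : IntegrableOn (fun t : ℝ => K.form R (K.point o + w * t)) (Ioi 0) := by
  have hw0 : w ≠ 0 := by rintro rfl; simp at hw
  have hwn : 0 < ‖w‖ := norm_pos_iff.2 hw0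
  obtain ⟨C, T, hT, hC, hb⟩ := h.upDecay.exists_ray_bound (K.point o) hw0
  have hc : ContinuousOn (fun t : ℝ => K.form R (K.point o + w * t)) (Ioi 0) :=
    h.upDecay.differentiableOn.continuousOn.comp (by fun_prop)
      fun t ht => point_add_mul_mem_cutDomain o hw ht
  refine integrableOn_Ioi_of_decay hT hc ?_
    fun t ht => hb t ht (point_add_mul_mem_cutDomain o hw (hT.trans ht))
  obtain ⟨C', r, hC', hr, hb'⟩ := h.exists_form_bound_near o
  set δ := r / (2 * ‖w‖)
  have hδ : 0 < δ := by positivity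
  have h1 : IntegrableOn (fun t : ℝ => K.form R (K.point o + w * t)) (Ioc 0 δ) := by
    have hg : IntegrableOn (fun t : ℝ => C' * ‖w‖ ^ (K.expo o - 1) * t ^ (K.expo o - 1)) (Ioc 0 δ) := by
      have := (intervalIntegral.intervalIntegrable_rpow' (a := 0) (b := δ)
        (show -1 < K.expo o - 1 by linarith)).const_mul (C' * ‖w‖ ^ (K.expo o - 1))
      rwa [intervalIntegrable_iff_integrableOn_Ioc_of_le hδ.le] at this
    refine Integrable.mono' hg
      ((hc.mono Ioc_subset_Ioi_self).aestronglyMeasurable measurableSet_Ioc) ?_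
    filter_upwards [ae_restrict_mem measurableSet_Ioc] with t ht
    have e : ‖(K.point o : ℂ) + w * t - K.point o‖ = ‖w‖ * t := by
      rw [add_sub_cancel_left, norm_mul, Complex.norm_real, Real.norm_of_nonneg ht.1.le]
    have h2 := (hb' (K.point o + w * t) (by rw [e]; exact mul_pos hwn ht.1) (by
      rw [e]
      calc ‖w‖ * t ≤ ‖w‖ * δ := by gcongr; exact ht.2
        _ = r / 2 := by simp only [δ]; field_simp
        _ < r := by linarith)).2
    rwa [e, Real.mul_rpow hwn.le ht.1.le, ← mul_assoc] at h2
  have h2 : IntegrableOn (fun t : ℝ => K.form R (K.point o + w * t)) (Icc δ T) :=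
    (hc.mono fun t ht => lt_of_lt_of_le hδ ht.1).integrableOn_Icc
  refine (h1.union h2).mono_set fun t ht => ?_
  rcases le_total t δ with h | h
  · exact Or.inl ⟨ht.1, h⟩
  · exact Or.inr ⟨h, ht.2⟩

/-- All ascending directions give the same value, because the primitive is continuous at the
starting point within the whole closed upper half-plane. -/
lemma PoleFactor.integral_ray (h : K.PoleFactor R) {o : Option ι} (ho : 0 < K.expo o) {w : ℂ}
    (hw : 0 < w.im) :
    ∫ t in Ioi (0 : ℝ), K.form R (K.point o + w * t) * w = -upPrim (K.form R) (K.point o) := by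
  refine h.upDecay.integral_ray (by simp) hw (fun t ht => point_add_mul_mem_cutDomain o hw ht) ?_
    (h.integrableOn_ray ho hw)
  have h1 : ContinuousWithinAt (upPrim (K.form R)) {z | 0 ≤ z.im} (K.point o + w * (0 : ℝ)) := by
    simpa using h.continuousWithinAt_upPrim ho
  refine ContinuousWithinAt.comp (f := fun t : ℝ => (K.point o : ℂ) + w * t) h1 (by fun_prop)
    fun t ht => ?_
  simpa using mul_nonneg hw.le ht

end KernelData

/-- If `v` points upwards, the incoming half of a wedge comes from below. The reflection z ↦ -z
makes it an ascending ray from `-b`, so that vertical primitives in the upward direction suffice. -/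
lemma integral_Iic_eq (b v : ℂ) (F : ℂ → ℂ) :
    ∫ t in Iic (0 : ℝ), F (b + v * t) * v = ∫ t in Ioi (0 : ℝ), F (-(-b + v * t)) * v := by
  have := integral_comp_neg_Ioi (0 : ℝ) (fun t : ℝ => F (b + v * t) * v)
  rw [neg_zero] at this
  rw [← this]
  refine integral_congr_ae (Eventually.of_forall fun t => ?_)
  simp only
  congr 2
  push_cast
  ring

lemma wedgeIntegral_eq (b v w : ℂ) (F : ℂ → ℂ) :
    wedgeIntegral b v w F = (∫ t in Ioi (0 : ℝ), F (-(-b + v * t)) * v) +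
      ∫ t in Ioi (0 : ℝ), F (b + w * t) * w := by
  rw [wedgeIntegral, integral_Iic_eq]

lemma wedgeIntegral_const_mul (b v w c : ℂ) (F : ℂ → ℂ) :
    wedgeIntegral b v w (fun z => c * F z) = c * wedgeIntegral b v w F := by
  simp only [wedgeIntegral, mul_assoc, integral_const_mul, mul_add]

lemma wedgeIntegral_sum {ι : Type*} [Fintype ι] {b v w : ℂ} {F : ι → ℂ → ℂ}
    (hv : ∀ m, IntegrableOn (fun t : ℝ => F m (-(-b + v * t)) * v) (Ioi 0))
    (hw : ∀ m, IntegrableOn (fun t : ℝ => F m (b + w * t) * w) (Ioi 0)) :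
    wedgeIntegral b v w (fun z => ∑ m, F m z) = ∑ m, wedgeIntegral b v w (F m) := by
  simp only [wedgeIntegral_eq, Finset.sum_mul]
  rw [Finset.sum_add_distrib, integral_finsetSum _ fun m _ => hv m,
    integral_finsetSum _ fun m _ => hw m]

lemma rayIntegral_const_mul (b w c : ℂ) (F : ℂ → ℂ) :
    rayIntegral b w (fun z => c * F z) = c * rayIntegral b w F := by
  simp only [rayIntegral, mul_assoc, integral_const_mul]

/-- Conditions under which `ψ` restricts to a multiple of the upper branch of the kernel on the
ascending ray of a wedge and to a multiple of the lower branch on the other ray. -/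
structure KernelData.OnWedge {ι : Type*} [Fintype ι] (K : KernelData ι) (ψ : ℂ → ℂ) (b : ℝ)
    (v w c c' : ℂ) : Prop where
  up_ne : c ≠ 0
  low_ne : c' ≠ 0
  v_im : 0 < v.im
  w_im : 0 < w.im
  base : ∀ o, b ≠ K.point o
  up : ∀ t : ℝ, 0 ≤ t → ψ (b + w * t) = c * K.kern (b + w * t)
  low : ∀ t : ℝ, 0 ≤ t → ψ (-(-b + v * t)) = c' * K.neg.kern (-b + v * t)

namespace KernelData.OnWedge

variable {ι : Type*} [Fintype ι] {K : KernelData ι} {ψ R : ℂ → ℂ} {b : ℝ} {v w c c' : ℂ}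

lemma base_mem (h : K.OnWedge ψ b v w c c') : (b : ℂ) ∈ K.cutDomain :=
  Or.inr (by simpa using h.base)

lemma neg_base_mem (h : K.OnWedge ψ b v w c c') : -(b : ℂ) ∈ K.neg.cutDomain :=
  Or.inr (by simpa using h.base)

/-- Both sides are the value of the one function `ψ` at the base point. This is what links the
constants on the two halves of a wedge. -/
lemma kern_base (h : K.OnWedge ψ b v w c c') : c * K.kern b = c' * K.neg.kern (-b) := by
  have h1 := h.up 0 le_rfl
  have h2 := h.low 0 le_rfl
  simp only [Complex.ofReal_zero, mul_zero, add_zero, neg_neg] at h1 h2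
  rw [← h1, ← h2]

/-- Each half contributes minus the primitive at the base point. The domains `E`, `E'` are left free
because exponentially tilted integrands decay only where the real part is bounded above. -/
lemma wedgeIntegral_eq_upPrim (h : K.OnWedge ψ b v w c c') {E E' : Set ℂ}
    (hE : UpDecay E (K.form R)) (hE' : UpDecay E' (K.neg.form fun z => R (-z)))
    (hw : ∀ t : ℝ, 0 ≤ t → (b : ℂ) + w * t ∈ E) (hv : ∀ t : ℝ, 0 ≤ t → -(b : ℂ) + v * t ∈ E') :
    wedgeIntegral b v w (fun z => ψ z * R z) =
      -(c * upPrim (K.form R) b + c' * upPrim (K.neg.form fun z => R (-z)) (-b)) := by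
  have e1 : ∫ t in Ioi (0 : ℝ), ψ (b + w * t) * R (b + w * t) * w =
      c * ∫ t in Ioi (0 : ℝ), K.form R (b + w * t) * w := by
    rw [← integral_const_mul]
    refine setIntegral_congr_fun measurableSet_Ioi fun t ht => ?_
    simp only [h.up t (le_of_lt ht), form]
    ring
  have e2 : ∫ t in Ioi (0 : ℝ), ψ (-(-b + v * t)) * R (-(-b + v * t)) * v =
      c' * ∫ t in Ioi (0 : ℝ), K.neg.form (fun z => R (-z)) (-b + v * t) * v := by
    rw [← integral_const_mul]
    refine setIntegral_congr_fun measurableSet_Ioi fun t ht => ?_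
    simp only [h.low t (le_of_lt ht), form]
    ring
  rw [wedgeIntegral_eq, e1, e2, hE.integral_ray_of_mem (by simp) h.w_im hw,
    hE'.integral_ray_of_mem (by simp) h.v_im hv]
  ring

lemma integrableOn_up (h : K.OnWedge ψ b v w c c') {E : Set ℂ}
    (hE : UpDecay E (K.form R)) (hw : ∀ t : ℝ, 0 ≤ t → (b : ℂ) + w * t ∈ E) :
    IntegrableOn (fun t : ℝ => ψ (b + w * t) * R (b + w * t) * w) (Ioi 0) := by
  have hw0 : w ≠ 0 := by rintro rfl; simpa using h.w_im
  refine IntegrableOn.congr_fun (((hE.integrableOn_ray b hw0 hw).const_mul c).mul_const w)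
    (fun t ht => ?_) measurableSet_Ioi
  simp only [h.up t (le_of_lt ht), form]
  ring

lemma integrableOn_low (h : K.OnWedge ψ b v w c c') {E' : Set ℂ}
    (hE' : UpDecay E' (K.neg.form fun z => R (-z)))
    (hv : ∀ t : ℝ, 0 ≤ t → -(b : ℂ) + v * t ∈ E') :
    IntegrableOn (fun t : ℝ => ψ (-(-b + v * t)) * R (-(-b + v * t)) * v) (Ioi 0) := by
  have hv0 : v ≠ 0 := by rintro rfl; simpa using h.v_im
  refine IntegrableOn.congr_fun (((hE'.integrableOn_ray (-b) hv0 hv).const_mul c').mul_const v)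
    (fun t ht => ?_) measurableSet_Ioi
  simp only [h.low t (le_of_lt ht), form]
  ring

/-- If the integral of `ψ * ∑ e m / (z - pt m)` over a wedge vanishes, its base point is good. -/
lemma good_of_sum_eq_zero (h : K.OnWedge ψ b v w c c') (e : ι → ℂ)
    (h0 : ∑ m, wedgeIntegral b v w (fun z => ψ z * (e m / (z - K.pt m))) = 0) :
    K.Good (K.poles e) b := by
  have hw : ∀ t : ℝ, 0 ≤ t → (b : ℂ) + w * t ∈ K.cutDomain := fun t ht =>
    add_mul_mem_cutDomain h.base_mem (by simp) h.w_im ht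
  have hv : ∀ t : ℝ, 0 ≤ t → -(b : ℂ) + v * t ∈ K.neg.cutDomain := fun t ht =>
    add_mul_mem_cutDomain h.neg_base_mem (by simp) h.v_im ht
  have hsum : ∑ m, wedgeIntegral b v w (fun z => ψ z * (e m / (z - K.pt m))) =
      wedgeIntegral b v w (fun z => ψ z * K.poles e z) := by
    rw [← wedgeIntegral_sum (F := fun m z => ψ z * (e m / (z - K.pt m)))
      (fun m => h.integrableOn_low (R := fun z => e m / (z - K.pt m))
        (poleFactor_inv m (e m)).neg.upDecay hv)
      (fun m => h.integrableOn_up (R := fun z => e m / (z - K.pt m))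
        (poleFactor_inv m (e m)).upDecay hw)]
    simp only [poles, Finset.mul_sum]
  have hP : K.PoleFactor (K.poles e) := poleFactor_poles e
  rw [hsum, h.wedgeIntegral_eq_upPrim hP.upDecay hP.neg.upDecay hw hv, neg_eq_zero] at h0
  refine (good_iff (K := K) (K.regular_ne_zero (K.cutDomain_subset_regular h.base_mem)) h.up_ne
    h.kern_base).2 h0

end KernelData.OnWedge

/-- If the integral of `ψ * ∑ e m / (z - pt m)` over a ray from a point with a positive exponent
vanishes, then the vertical primitive vanishes at that point. -/
lemma KernelData.upPrim_eq_zero_of_sum_eq_zero {ι : Type*} [Fintype ι] {K : KernelData ι}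
    {ψ : ℂ → ℂ} {w c : ℂ} {o : Option ι} (ho : 0 < K.expo o) (hw : 0 < w.im) (hc : c ≠ 0)
    (h : ∀ t : ℝ, 0 < t → ψ (K.point o + w * t) = c * K.kern (K.point o + w * t)) (e : ι → ℂ)
    (h0 : ∑ m, rayIntegral (K.point o) w (fun z => ψ z * (e m / (z - K.pt m))) = 0) :
    upPrim (K.form (K.poles e)) (K.point o) = 0 := by
  have key : ∀ R : ℂ → ℂ, ∀ t ∈ Ioi (0 : ℝ), ψ (K.point o + w * t) * R (K.point o + w * t) * w =
      c * (K.form R (K.point o + w * t) * w) := by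
    intro R t ht
    rw [h t ht, form]; ring
  have hsum : ∑ m, rayIntegral (K.point o) w (fun z => ψ z * (e m / (z - K.pt m))) =
      rayIntegral (K.point o) w (fun z => ψ z * K.poles e z) := by
    simp only [rayIntegral, poles, Finset.mul_sum, Finset.sum_mul]
    rw [integral_finsetSum]
    intro m _
    exact IntegrableOn.congr_fun
      ((((poleFactor_inv m (e m)).integrableOn_ray ho hw).mul_const w).const_mul c) (fun t ht => (key (fun z => e m / (z - K.pt m)) t ht).symm) measurableSet_Ioi
  rw [hsum, rayIntegral, setIntegral_congr_fun measurableSet_Ioi (key (K.poles e)),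
    integral_const_mul, (poleFactor_poles e).integral_ray ho hw, mul_eq_zero_iff_left hc,
    neg_eq_zero] at h0
  exact h0

/-- Propagation of goodness to a strip next to a singular point. -/
lemma KernelData.PoleFactor.good_step {ι : Type*} [Fintype ι] {K : KernelData ι} {R : ℂ → ℂ}
    (h : K.PoleFactor R) {o : Option ι} {T T' : Set ℝ} (hTo : IsOpen T) (hTc : Convex ℝ T)
    (hT : K.IsFree T) (hTo' : IsOpen T') (hTc' : Convex ℝ T') (hT' : K.IsFree T')
    (hcl : K.point o ∈ closure T) (hcl' : K.point o ∈ closure T')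
    (hg' : ∀ x ∈ T', K.Good R (x : ℝ))
    (hneg : K.expo o < 0 → ∃ b ∈ T, K.Good R (b : ℝ))
    (hpos : 0 < K.expo o → upPrim (K.form R) (K.point o) = 0) : ∀ x ∈ T, K.Good R (x : ℝ) := by
  have hne : K.expo o ≠ 0 := by cases o <;> simp [K.ex_ne]
  intro x hx
  rcases hne.lt_or_gt with ho | ho
  · obtain ⟨b, hb, hgb⟩ := hneg ho
    exact h.good_of_good hTo hTc hT (z₀ := b) (by simpa using hx) (by simpa using hb) hgb
  -- At a zero of the kernel, goodness on `T'` together with the vanishing upper primitive forces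
  -- the lower primitive to vanish too. Then the criterion holds on `T`, whatever the constant
  -- there.
  · obtain ⟨c, hc, h1⟩ := h.good_iff_of_pos ho hTo hTc hT hcl
    obtain ⟨c', hc', h2⟩ := h.good_iff_of_pos ho hTo' hTc' hT' hcl'
    obtain ⟨y, hy⟩ : T'.Nonempty := closure_nonempty_iff.1 ⟨_, hcl'⟩
    have h3 := (h2 y (by simpa using hy)).1 (hg' y hy)
    rw [hpos ho, zero_add, mul_eq_zero_iff_left hc'] at h3
    rw [h1 x (by simpa using hx), hpos ho, h3]
    simp

end

/-! ### Invertibility of the period matrix -/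

noncomputable section

open MeasureTheory Set

namespace JumpModel

variable {r s : ℕ} [NeZero r] (P : JumpModel r s)

lemma expMu_ne (k : Fin r) : P.expMu k ≠ 0 := by
  have := P.alpha_ne k
  have := P.kappa_pos.ne'
  have := P.lam_pos.ne'
  have := P.p_pos.ne'
  simp only [expMu, ne_eq, neg_eq_zero, div_eq_zero_iff, mul_eq_zero]
  tauto

lemma expNu_ne (d : Fin s) : P.expNu d ≠ 0 := by
  have := P.beta_ne d
  have := P.kappa_pos.ne'
  have := P.lam_pos.ne'
  have : P.q ≠ 0 := by
    intro h
    have h1 : P.p = 1 := by unfold q at h; linarith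
    have h2 := P.no_upward h1
    subst h2
    exact d.elim0
  simp only [expNu, ne_eq, neg_eq_zero, div_eq_zero_iff, mul_eq_zero]
  tauto

/-- The kernel data of the model. -/
@[simps] def kernelData : KernelData (Fin r ⊕ Fin s) where
  pt := Sum.elim P.μ fun d => -P.ν d
  ex := Sum.elim P.expMu P.expNu
  pt_ne m := by
    rcases m with k | d
    · exact (P.mu_pos k).ne'
    · exact neg_ne_zero.2 (P.nu_pos d).ne'
  pt_inj := by
    refine P.mu_strictMono.injective.sumElim (neg_injective.comp P.nu_strictMono.injective) ?_
    intro k d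
    have := P.mu_pos k
    have := P.nu_pos d
    exact ne_of_gt (show -P.ν d < P.μ k by linarith)
  ex_ne m := by
    rcases m with k | d
    · exact P.expMu_ne k
    · exact P.expNu_ne d
  sum_ex := by
    have hk := P.kappa_pos
    have hl := P.lam_pos
    have hp := P.p_pos
    have h1 : ∑ k, P.expMu k = -(P.p * P.lam / P.κ) := by
      simp only [expMu, Finset.sum_neg_distrib, ← Finset.sum_div, ← Finset.mul_sum, P.alpha_sum,
        mul_one]
    have h2 : ∑ d, P.expNu d ≤ 0 := by
      rcases P.p_le_one.lt_or_eq with h | h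
      · have : 0 ≤ P.q := sub_nonneg.2 P.p_le_one
        simp only [expNu, Finset.sum_neg_distrib, ← Finset.sum_div, ← Finset.mul_sum, P.beta_sum h,
          mul_one]
        rw [neg_nonpos]
        positivity
      · have := P.no_upward h
        subst this
        simp
    have h3 : 0 < P.p * P.lam / P.κ := by positivity
    rw [Fintype.sum_sum_type]
    simp only [Sum.elim_inl, Sum.elim_inr]
    linarith

variable {P}

namespace Version

variable {S : Set ℂ} (V : P.Version S)

lemma psiNoZero_eq_prod (z : ℂ) : V.psiNoZero z = ∏ m, Complex.exp (P.kernelData.ex m *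
    (Sum.elim V.logMu V.logNu : Fin r ⊕ Fin s → ℂ → ℂ) m z) := by
  simp [psiNoZero, Fintype.prod_sum_type]

lemma continuousOn_log (m : Fin r ⊕ Fin s) :
    ContinuousOn ((Sum.elim V.logMu V.logNu : Fin r ⊕ Fin s → ℂ → ℂ) m) S := by
  rcases m with k | d
  · exact (V.differentiableOn_logMu k).continuousOn.mono V.subset_dom
  · exact (V.differentiableOn_logNu d).continuousOn.mono V.subset_dom

lemma exp_log (m : Fin r ⊕ Fin s) {z : ℂ} (hz : z ∈ S) :
    Complex.exp ((Sum.elim V.logMu V.logNu : Fin r ⊕ Fin s → ℂ → ℂ) m z) =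
      1 * (z - P.kernelData.pt m) := by
  rw [one_mul]
  rcases m with k | d
  · exact V.exp_logMu k z (V.subset_dom hz)
  · simpa using V.exp_logNu d z (V.subset_dom hz)

/-- Logarithms of the same function differ by a constant on a preconnected set. So an arbitrary
version of ψ affects each half of a contour only through a nonzero constant. -/
lemma exists_psiNoZero_eq {S' : Set ℂ} (hS' : IsPreconnected S') (hsub : S' ⊆ S)
    (h : S' ⊆ P.kernelData.cutReg) :
    ∃ c : ℂ, c ≠ 0 ∧ ∀ z ∈ S', V.psiNoZero z = c * P.kernelData.kernReg z := by
  have h₂ : ∀ m, ContinuousOn (fun z => Complex.log (-Complex.I * (z - P.kernelData.pt m))) S' :=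
    fun m => ContinuousOn.clog (by fun_prop) fun z hz => P.kernelData.mem_slitPlane (h hz) m
  obtain ⟨c, hc, he⟩ := exists_prod_exp_eq hS' (ex := P.kernelData.ex)
    (fun m => (V.continuousOn_log m).mono hsub) h₂ (p := fun m z => z - P.kernelData.pt m)
    (fun m z hz => V.exp_log m (hsub hz))
    (fun m z hz => Complex.exp_log (Complex.slitPlane_ne_zero (P.kernelData.mem_slitPlane (h hz) m)))
  exact ⟨c, hc, fun z hz => by rw [V.psiNoZero_eq_prod, he z hz]; rfl⟩

lemma exists_psiNoZero_eq_neg {S' : Set ℂ} (hS' : IsPreconnected S') (hsub : S' ⊆ S)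
    (h : ∀ z ∈ S', -z ∈ P.kernelData.neg.cutReg) :
    ∃ c : ℂ, c ≠ 0 ∧ ∀ z ∈ S', V.psiNoZero z = c * P.kernelData.neg.kernReg (-z) := by
  have h₂ : ∀ m, ContinuousOn
      (fun z => Complex.log (-Complex.I * (-z - P.kernelData.neg.pt m))) S' :=
    fun m => ContinuousOn.clog (by fun_prop) fun z hz =>
      P.kernelData.neg.mem_slitPlane (h z hz) m
  obtain ⟨c, hc, he⟩ := exists_prod_exp_eq hS' (ex := P.kernelData.ex)
    (fun m => (V.continuousOn_log m).mono hsub) h₂ (γ₂ := Complex.I)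
    (p := fun m z => z - P.kernelData.pt m)
    (fun m z hz => V.exp_log m (hsub hz))
    (fun m z hz => by
      rw [Complex.exp_log (Complex.slitPlane_ne_zero
        (P.kernelData.neg.mem_slitPlane (h z hz) m))]
      simp only [KernelData.neg_pt, Complex.ofReal_neg]
      ring)
  exact ⟨c, hc, fun z hz => by rw [V.psiNoZero_eq_prod, he z hz]; rfl⟩

/-- The sign of `c'` comes from z⁻¹ = -(-z)⁻¹ on the reflected half. -/
lemma onWedge {b : ℝ} {v w c c' : ℂ} (hv : 0 < v.im) (hw : 0 < w.im)
    (hb : ∀ o, b ≠ P.kernelData.point o) (hc : c ≠ 0) (hc' : c' ≠ 0)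
    (hup : ∀ t : ℝ, 0 ≤ t → V.psiNoZero (b + w * t) = c * P.kernelData.kernReg (b + w * t))
    (hlow : ∀ t : ℝ, 0 ≤ t → V.psiNoZero (-(-b + v * t)) =
      c' * P.kernelData.neg.kernReg (-b + v * t)) :
    P.kernelData.OnWedge V.psi b v w c (-c') where
  up_ne := hc
  low_ne := neg_ne_zero.2 hc'
  v_im := hv
  w_im := hw
  base := hb
  up t ht := by rw [psi, hup t ht, KernelData.kern]; ring
  low t ht := by rw [psi, hlow t ht, KernelData.kern, inv_neg]; ring

lemma exists_low {b : ℝ} {v w : ℂ} (hv : 0 < v.im) (hb : ∀ o, b ≠ P.kernelData.point o)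
    (hS : wedgeSet b v w ⊆ S) : ∃ c : ℂ, c ≠ 0 ∧ ∀ t : ℝ, 0 ≤ t → V.psiNoZero (-(-b + v * t)) =
      c * P.kernelData.neg.kernReg (-b + v * t) := by
  have hpre : IsPreconnected ((fun t : ℝ => -(-(b : ℂ) + v * t)) '' Ici 0) :=
    isPreconnected_Ici.image _ (by fun_prop)
  obtain ⟨c, hc, h⟩ := V.exists_psiNoZero_eq_neg hpre (by
      rintro _ ⟨t, ht, rfl⟩
      refine hS (Or.inl ⟨-t, by simpa using ht, ?_⟩)
      push_cast
      ring) (by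
      rintro _ ⟨t, ht, rfl⟩
      rw [neg_neg]
      exact P.kernelData.neg.cutDomain_subset_cutReg (KernelData.add_mul_mem_cutDomain
        (Or.inr (by simpa using hb)) (by simp) hv ht))
  exact ⟨c, hc, fun t ht => by simpa using h _ ⟨t, ht, rfl⟩⟩

lemma exists_up {b : ℝ} {v w : ℂ} (hw : 0 < w.im) (hb : ∀ o, b ≠ P.kernelData.point o)
    (hS : wedgeSet b v w ⊆ S) : ∃ c : ℂ, c ≠ 0 ∧ ∀ t : ℝ, 0 ≤ t → V.psiNoZero (b + w * t) =
      c * P.kernelData.kernReg (b + w * t) := by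
  have hpre : IsPreconnected ((fun t : ℝ => (b : ℂ) + w * t) '' Ici 0) :=
    isPreconnected_Ici.image _ (by fun_prop)
  obtain ⟨c, hc, h⟩ := V.exists_psiNoZero_eq hpre (by
      rintro _ ⟨t, ht, rfl⟩
      exact hS (Or.inr ⟨t, ht, rfl⟩)) (by
      rintro _ ⟨t, ht, rfl⟩
      exact P.kernelData.cutDomain_subset_cutReg (KernelData.add_mul_mem_cutDomain
        (Or.inr (by simpa using hb)) (by simp) hw ht))
  exact ⟨c, hc, fun t ht => h _ ⟨t, ht, rfl⟩⟩

lemma exists_onWedge {b : ℝ} {v w : ℂ} (hv : 0 < v.im) (hw : 0 < w.im)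
    (hb : ∀ o, b ≠ P.kernelData.point o) (hS : wedgeSet b v w ⊆ S) :
    ∃ c c' : ℂ, P.kernelData.OnWedge V.psi b v w c c' := by
  obtain ⟨c, hc, h⟩ := V.exists_up hw hb hS
  obtain ⟨c', hc', h'⟩ := V.exists_low hv hb hS
  exact ⟨c, -c', V.onWedge hv hw hb hc hc' h h'⟩

lemma exists_psi_eq_on_ray (o : Option (Fin r ⊕ Fin s)) {w : ℂ} (hw : 0 < w.im)
    (hS : raySet (P.kernelData.point o) w ⊆ S) : ∃ c : ℂ, c ≠ 0 ∧ ∀ t : ℝ, 0 < t →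
      V.psi (P.kernelData.point o + w * t) =
        c * P.kernelData.kern (P.kernelData.point o + w * t) := by
  have hpre : IsPreconnected ((fun t : ℝ => (P.kernelData.point o : ℂ) + w * t) '' Ioi 0) :=
    isPreconnected_Ioi.image _ (by fun_prop)
  obtain ⟨c, hc, h⟩ := V.exists_psiNoZero_eq hpre (by
      rintro _ ⟨t, ht, rfl⟩
      exact hS ⟨t, ht, rfl⟩) (by
      rintro _ ⟨t, ht, rfl⟩
      exact P.kernelData.cutDomain_subset_cutReg
        (KernelData.point_add_mul_mem_cutDomain o hw ht))
  refine ⟨c, hc, fun t ht => ?_⟩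
  rw [psi, h _ ⟨t, ht, rfl⟩, KernelData.kern]
  ring

end Version

variable (P)

lemma below_zero : P.below 0 = 0 := by simp [below]

lemma below_succ {i j : Fin r} (h : j.val + 1 = i.val) : P.below i = P.μ j := by
  have hi : i ≠ 0 := by rintro rfl; simp at h
  rw [below, if_neg hi]
  congr 1
  ext
  simp
  omega

lemma expBelow_zero : P.expBelow 0 = -1 := by simp [expBelow]

lemma expBelow_succ {i j : Fin r} (h : j.val + 1 = i.val) : P.expBelow i = P.expMu j := by
  have hi : i ≠ 0 := by rintro rfl; simp at h
  rw [expBelow, if_neg hi]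
  congr 1
  ext
  simp
  omega

lemma exists_pred {i : Fin r} (h : i ≠ 0) : ∃ j : Fin r, j.val + 1 = i.val := by
  have : i.val ≠ 0 := fun hh => h (Fin.ext (by simpa using hh))
  exact ⟨⟨i.val - 1, by omega⟩, by simp; omega⟩

lemma below_nonneg (i : Fin r) : 0 ≤ P.below i := by
  by_cases h : i = 0
  · rw [h, below_zero]
  · obtain ⟨j, hj⟩ := exists_pred h
    rw [P.below_succ hj]
    exact (P.mu_pos j).le

lemma below_lt (i : Fin r) : P.below i < P.μ i := by
  by_cases h : i = 0
  · rw [h, below_zero]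
    exact P.mu_pos 0
  · obtain ⟨j, hj⟩ := exists_pred h
    rw [P.below_succ hj]
    exact P.mu_strictMono (Fin.lt_def.2 (by omega))

lemma aboveNeg_zero {d : Fin s} (h : d.val = 0) : P.aboveNeg d = 0 := by simp [aboveNeg, h]

lemma aboveNeg_succ {d e : Fin s} (h : e.val + 1 = d.val) : P.aboveNeg d = -P.ν e := by
  rw [aboveNeg, if_neg (by omega)]
  congr 2
  ext
  simp
  omega

lemma aboveNeg_nonpos (d : Fin s) : P.aboveNeg d ≤ 0 := by
  by_cases h : d.val = 0
  · rw [P.aboveNeg_zero h]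
  · rw [P.aboveNeg_succ (e := ⟨d.val - 1, by omega⟩) (by simp; omega)]
    exact neg_nonpos.2 (P.nu_pos _).le

lemma lt_aboveNeg (d : Fin s) : -P.ν d < P.aboveNeg d := by
  by_cases h : d.val = 0
  · rw [P.aboveNeg_zero h]
    exact neg_lt_zero.2 (P.nu_pos d)
  · rw [P.aboveNeg_succ (e := ⟨d.val - 1, by omega⟩) (by simp; omega), neg_lt_neg_iff]
    exact P.nu_strictMono (Fin.lt_def.2 (by simp; omega))

lemma isFree_below (i : Fin r) : P.kernelData.IsFree (Ioo (P.below i) (P.μ i)) := by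
  rintro x ⟨h1, h2⟩ (_ | k | d) rfl
  · exact absurd (P.below_nonneg i) (not_le.2 (by simpa using h1))
  · simp only [KernelData.point_some, kernelData_pt, Sum.elim_inl] at h1 h2
    have h3 := P.mu_strictMono.lt_iff_lt.1 h2
    have hi : i ≠ 0 := by rintro rfl; exact absurd (Fin.lt_def.1 h3) (by simp)
    obtain ⟨j, hj⟩ := exists_pred hi
    rw [P.below_succ hj, P.mu_strictMono.lt_iff_lt] at h1
    rw [Fin.lt_def] at h1 h3
    omega
  · simp only [KernelData.point_some, kernelData_pt, Sum.elim_inr] at h1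
    linarith [P.below_nonneg i, P.nu_pos d]

lemma isFree_above {i : Fin r} (hi : i.val + 1 = r) : P.kernelData.IsFree (Ioi (P.μ i)) := by
  rintro x h1 (_ | k | d) rfl
  · exact absurd (P.mu_pos i) (not_lt.2 (le_of_lt (by simpa using h1)))
  · simp only [KernelData.point_some, kernelData_pt, Sum.elim_inl, mem_Ioi] at h1
    rw [P.mu_strictMono.lt_iff_lt, Fin.lt_def] at h1
    omega
  · simp only [KernelData.point_some, kernelData_pt, Sum.elim_inr, mem_Ioi] at h1
    linarith [P.mu_pos i, P.nu_pos d]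

lemma isFree_aboveNeg (d : Fin s) : P.kernelData.IsFree (Ioo (-P.ν d) (P.aboveNeg d)) := by
  rintro x ⟨h1, h2⟩ (_ | k | e) rfl
  · exact absurd (P.aboveNeg_nonpos d) (not_le.2 (by simpa using h2))
  · simp only [KernelData.point_some, kernelData_pt, Sum.elim_inl] at h2
    linarith [P.aboveNeg_nonpos d, P.mu_pos k]
  · simp only [KernelData.point_some, kernelData_pt, Sum.elim_inr, neg_lt_neg_iff] at h1 h2
    rw [P.nu_strictMono.lt_iff_lt, Fin.lt_def] at h1
    rw [P.aboveNeg_succ (e := ⟨d.val - 1, by omega⟩) (by simp; omega), neg_lt_neg_iff,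
      P.nu_strictMono.lt_iff_lt, Fin.lt_def] at h2
    simp at h2
    omega

lemma isFree_Iio {d : Fin s} (hd : d.val + 1 = s) : P.kernelData.IsFree (Iio (-P.ν d)) := by
  rintro x h1 (_ | k | e) rfl
  · exact absurd (P.nu_pos d) (not_lt.2 (le_of_lt (by simpa using h1)))
  · simp only [KernelData.point_some, kernelData_pt, Sum.elim_inl, mem_Iio] at h1
    linarith [P.mu_pos k, P.nu_pos d]
  · simp only [KernelData.point_some, kernelData_pt, Sum.elim_inr, mem_Iio, neg_lt_neg_iff] at h1
    rw [P.nu_strictMono.lt_iff_lt, Fin.lt_def] at h1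
    omega

lemma isFree_Iio_zero (hs : s = 0) : P.kernelData.IsFree (Iio 0) := by
  rintro x h1 (_ | k | e) rfl
  · simp at h1
  · simp only [KernelData.point_some, kernelData_pt, Sum.elim_inl, mem_Iio] at h1
    linarith [P.mu_pos k]
  · subst hs
    exact e.elim0

variable {P} {R : ℂ → ℂ}

/-- Beyond the largest `μ` everything is good by decay. From there goodness moves leftwards, and the
condition of the contour at `μ i` is what carries it across `μ i`. -/
lemma good_right (h : P.kernelData.PoleFactor R)
    (hneg : ∀ i, P.expMu i < 0 → ∃ b ∈ Ioo (P.below i) (P.μ i), P.kernelData.Good R (b : ℝ))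
    (hpos : ∀ i, 0 < P.expMu i → upPrim (P.kernelData.form R) (P.μ i) = 0) (i : Fin r) :
    ∀ x ∈ Ioo (P.below i) (P.μ i), P.kernelData.Good R (x : ℝ) := by
  induction hn : r - i.val using Nat.strong_induction_on generalizing i with
  | _ n ih =>
  have hlt := P.below_lt i
  have key : ∃ T' : Set ℝ, IsOpen T' ∧ Convex ℝ T' ∧ P.kernelData.IsFree T' ∧ P.μ i ∈ closure T' ∧
      ∀ x ∈ T', P.kernelData.Good R (x : ℝ) := by
    by_cases hi : i.val + 1 = r
    · refine ⟨_, isOpen_Ioi, convex_Ioi _, P.isFree_above hi, by simp, fun x hx => ?_⟩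
      exact h.good_of_unbounded isOpen_Ioi (convex_Ioi _) (P.isFree_above hi) (l := atTop)
        (Ioi_mem_atTop _) tendsto_abs_atTop_atTop (by simpa using hx)
    · have hlt' := P.below_lt ⟨i.val + 1, by omega⟩
      have hb := P.below_succ (i := ⟨i.val + 1, by omega⟩) (j := i) rfl
      refine ⟨_, isOpen_Ioo, convex_Ioo _ _, P.isFree_below ⟨i.val + 1, by omega⟩, ?_,
        ih _ (by rw [← hn]; simp; omega) ⟨i.val + 1, by omega⟩ rfl⟩
      rw [closure_Ioo hlt'.ne, hb]
      exact ⟨le_rfl, by rw [← hb]; exact hlt'.le⟩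
  obtain ⟨T', hTo', hTc', hT', hcl', hg'⟩ := key
  exact h.good_step (o := some (Sum.inl i)) isOpen_Ioo (convex_Ioo _ _) (P.isFree_below i) hTo' hTc'
    hT' (by rw [closure_Ioo hlt.ne]; exact ⟨hlt.le, le_rfl⟩) hcl' hg' (hneg i) (hpos i)

lemma good_left (h : P.kernelData.PoleFactor R)
    (hneg : ∀ d, P.expNu d < 0 → ∃ b ∈ Ioo (-P.ν d) (P.aboveNeg d), P.kernelData.Good R (b : ℝ))
    (hpos : ∀ d, 0 < P.expNu d → upPrim (P.kernelData.form R) ((-P.ν d : ℝ) : ℂ) = 0) (d : Fin s) :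
    ∀ x ∈ Ioo (-P.ν d) (P.aboveNeg d), P.kernelData.Good R (x : ℝ) := by
  induction hn : s - d.val using Nat.strong_induction_on generalizing d with
  | _ n ih =>
  have hlt := P.lt_aboveNeg d
  have key : ∃ T' : Set ℝ, IsOpen T' ∧ Convex ℝ T' ∧ P.kernelData.IsFree T' ∧ -P.ν d ∈ closure T' ∧
      ∀ x ∈ T', P.kernelData.Good R (x : ℝ) := by
    by_cases hi : d.val + 1 = s
    · refine ⟨_, isOpen_Iio, convex_Iio _, P.isFree_Iio hi, by simp, fun x hx => ?_⟩
      exact h.good_of_unbounded isOpen_Iio (convex_Iio _) (P.isFree_Iio hi) (l := atBot)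
        (Iio_mem_atBot _) tendsto_abs_atBot_atTop (by simpa using hx)
    · have hlt' := P.lt_aboveNeg ⟨d.val + 1, by omega⟩
      have hb := P.aboveNeg_succ (d := ⟨d.val + 1, by omega⟩) (e := d) rfl
      refine ⟨_, isOpen_Ioo, convex_Ioo _ _, P.isFree_aboveNeg ⟨d.val + 1, by omega⟩, ?_,
        ih _ (by rw [← hn]; simp; omega) ⟨d.val + 1, by omega⟩ rfl⟩
      rw [closure_Ioo hlt'.ne, hb]
      exact ⟨by rw [← hb]; exact hlt'.le, le_rfl⟩
  obtain ⟨T', hTo', hTc', hT', hcl', hg'⟩ := key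
  exact h.good_step (o := some (Sum.inr d)) isOpen_Ioo (convex_Ioo _ _) (P.isFree_aboveNeg d)
    hTo' hTc' hT' (by rw [closure_Ioo hlt.ne]; exact ⟨le_rfl, hlt.le⟩) hcl' hg' (hneg d) (hpos d)

/-- Every regular real lies in one of the intervals between neighbouring singular points. -/
lemma good_of_intervals (h : P.kernelData.PoleFactor R)
    (hr : ∀ i, ∀ x ∈ Ioo (P.below i) (P.μ i), P.kernelData.Good R (x : ℝ))
    (hl : ∀ d, ∀ x ∈ Ioo (-P.ν d) (P.aboveNeg d), P.kernelData.Good R (x : ℝ)) (x : ℝ)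
    (hx : ∀ o, x ≠ P.kernelData.point o) : P.kernelData.Good R x := by
  have hx0 : x ≠ 0 := hx none
  rcases hx0.lt_or_gt with h0 | h0
  · by_cases hk : ∃ d, -P.ν d < x
    · obtain ⟨d, hd, hmin⟩ := WellFounded.has_min (wellFounded_lt (α := Fin s))
        {d | -P.ν d < x} hk
      refine hl d x ⟨hd, ?_⟩
      by_cases hd0 : d.val = 0
      · rwa [P.aboveNeg_zero hd0]
      · have he : (⟨d.val - 1, by omega⟩ : Fin s).val + 1 = d.val := by simp; omega
        rw [P.aboveNeg_succ he]
        refine lt_of_le_of_ne (not_lt.1 fun hh => hmin _ hh (Fin.lt_def.2 (by omega))) ?_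
        exact hx (some (Sum.inr _))
    · push Not at hk
      by_cases hs : s = 0
      · exact h.good_of_unbounded isOpen_Iio (convex_Iio _) (P.isFree_Iio_zero hs) (l := atBot)
          (Iio_mem_atBot _) tendsto_abs_atBot_atTop (by simpa using h0)
      · have hd : (⟨s - 1, by omega⟩ : Fin s).val + 1 = s := by simp; omega
        refine h.good_of_unbounded isOpen_Iio (convex_Iio _) (P.isFree_Iio hd) (l := atBot)
          (Iio_mem_atBot _) tendsto_abs_atBot_atTop ?_
        exact lt_of_le_of_ne (hk _) (hx (some (Sum.inr _)))
  · by_cases hk : ∃ i, x < P.μ i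
    · obtain ⟨i, hi, hmin⟩ := WellFounded.has_min (wellFounded_lt (α := Fin r))
        {i | x < P.μ i} hk
      refine hr i x ⟨?_, hi⟩
      by_cases hi0 : i = 0
      · rwa [hi0, P.below_zero]
      · obtain ⟨j, hj⟩ := exists_pred hi0
        rw [P.below_succ hj]
        refine lt_of_le_of_ne (not_lt.1 fun hh => hmin _ hh (Fin.lt_def.2 (by omega))) ?_
        exact (hx (some (Sum.inl j))).symm
    · push Not at hk
      have hr0 : 0 < r := Nat.pos_of_ne_zero (NeZero.ne r)
      have hd : (⟨r - 1, by omega⟩ : Fin r).val + 1 = r := by simp; omega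
      refine h.good_of_unbounded isOpen_Ioi (convex_Ioi _) (P.isFree_above hd) (l := atTop)
        (Ioi_mem_atTop _) tendsto_abs_atTop_atTop ?_
      exact lt_of_le_of_ne (hk _) (hx (some (Sum.inl _))).symm

lemma rightIntegral_const_mul (i : Fin r) (b : ℝ) (c : ℂ) (F : ℂ → ℂ) :
    P.rightIntegral i b (fun z => c * F z) = c * P.rightIntegral i b F := by
  unfold rightIntegral
  split_ifs
  · exact wedgeIntegral_const_mul _ _ _ _ _
  · exact rayIntegral_const_mul _ _ _ _

lemma leftIntegral_const_mul (j : Fin s ⊕ Fin r) (b : ℝ) (c : ℂ) (F : ℂ → ℂ) :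
    P.leftIntegral j b (fun z => c * F z) = c * P.leftIntegral j b F := by
  unfold leftIntegral
  split_ifs
  · exact wedgeIntegral_const_mul _ _ _ _ _
  · exact rayIntegral_const_mul _ _ _ _

namespace Contours

variable (C : P.Contours)

/-- The residues that belong to a linear combination of the rows of the matrix `M`. -/
def rowResidue (v : Fin (r + s) → ℂ) : Fin r ⊕ Fin s → ℂ :=
  Sum.elim (fun k => v (Fin.castAdd s k)) fun d => -v (Fin.natAdd r d)

/-- Pairing a row vector with a column amounts to integrating ψ against one rational function. The
sign in `rowResidue` accounts for the entries `-M2`. -/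
lemma sum_right (v : Fin (r + s) → ℂ) (i : Fin r) :
    ∑ m, P.rightIntegral i (C.baseR i) (fun z => (C.verR i).psi z *
      (rowResidue v m / (z - P.kernelData.pt m))) = ∑ n, v n * C.rightCol i n := by
  rw [Fintype.sum_sum_type, Fin.sum_univ_add]
  congr 1
  · refine Finset.sum_congr rfl fun k _ => ?_
    rw [rightCol, Fin.append_left, M1, ← rightIntegral_const_mul]
    congr 1
    funext z
    simp only [rowResidue, Sum.elim_inl, kernelData_pt]
    ring
  · refine Finset.sum_congr rfl fun d _ => ?_
    rw [rightCol, Fin.append_right, M2, mul_neg, ← neg_mul, ← rightIntegral_const_mul]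
    congr 1
    funext z
    simp only [rowResidue, Sum.elim_inr, kernelData_pt, Complex.ofReal_neg, sub_neg_eq_add]
    rw [add_comm z]
    ring

/-- The overall sign arises from 1 / (μ - z) = -1 / (z - μ) in the rows of `N1`, and from the sign
in `rowResidue` in those of `N2`. -/
lemma sum_left (v : Fin (r + s) → ℂ) (j : Fin s ⊕ Fin r) :
    ∑ m, P.leftIntegral j (C.baseL j) (fun z => (C.verL j).psi z *
      (rowResidue v m / (z - P.kernelData.pt m))) = -∑ n, v n * C.leftCol j n := by
  rw [Fintype.sum_sum_type, Fin.sum_univ_add, neg_add, ← Finset.sum_neg_distrib,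
    ← Finset.sum_neg_distrib]
  congr 1
  · refine Finset.sum_congr rfl fun k _ => ?_
    rw [leftCol, Fin.append_left, N1, ← neg_mul, ← leftIntegral_const_mul]
    congr 1
    funext z
    simp only [rowResidue, Sum.elim_inl, kernelData_pt]
    rw [← neg_sub (P.μ k : ℂ) z, div_neg]
    ring
  · refine Finset.sum_congr rfl fun d _ => ?_
    rw [leftCol, Fin.append_right, N2, ← neg_mul, ← leftIntegral_const_mul]
    congr 1
    funext z
    simp only [rowResidue, Sum.elim_inr, kernelData_pt, Complex.ofReal_neg, sub_neg_eq_add]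
    rw [add_comm z]
    ring

/-- The matrix `M` of periods is invertible. -/
theorem det_M_ne_zero : C.M.det ≠ 0 := by
  intro hdet
  -- A left null vector is taken, because combinations of rows are what become residues of a single
  -- integrand.
  obtain ⟨v, hv, hvM⟩ := Matrix.exists_vecMul_eq_zero_iff.2 hdet
  have hcol : ∀ n : Fin (r + s), ∑ m, v m * C.cols n.castSucc m = 0 := fun n => congrFun hvM n
  have hR : ∀ i, ∑ n, v n * C.rightCol i n = 0 := by
    intro i
    have := hcol (Fin.castAdd s i)
    rwa [cols, Fin.snoc_castSucc, Fin.append_left] at this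
  have hL : ∀ d, ∑ n, v n * C.leftCol (Sum.inl d) n = 0 := by
    intro d
    have := hcol (Fin.natAdd r d.rev)
    rwa [cols, Fin.snoc_castSucc, Fin.append_right, Fin.rev_rev] at this
  set e := rowResidue v with he
  set K := P.kernelData with hK
  have hPF : K.PoleFactor (K.poles e) := KernelData.poleFactor_poles e
  have hposR : ∀ i, 0 < P.expMu i → upPrim (K.form (K.poles e)) (P.μ i) = 0 := by
    intro i hi
    have h1 := C.sum_right v i
    rw [hR i] at h1
    obtain ⟨c, hc, hcp⟩ := (C.verR i).exists_psi_eq_on_ray (some (Sum.inl i)) (w := 1 + Complex.I)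
      (by simp) (by rw [rightSet, if_neg (not_lt.2 hi.le)]; rfl)
    simp only [rightIntegral, if_neg (not_lt.2 hi.le)] at h1
    exact KernelData.upPrim_eq_zero_of_sum_eq_zero (K := K) (o := some (Sum.inl i)) hi (by simp) hc hcp e h1
  have hposL : ∀ d, 0 < P.expNu d → upPrim (K.form (K.poles e)) ((-P.ν d : ℝ) : ℂ) = 0 := by
    intro d hd
    have h1 := C.sum_left v (Sum.inl d)
    have hd' : ¬ P.leftExp (Sum.inl d) < 0 := not_lt.2 hd.le
    rw [hL d, neg_zero] at h1
    obtain ⟨c, hc, hcp⟩ := (C.verL (Sum.inl d)).exists_psi_eq_on_ray (some (Sum.inr d))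
      (w := -1 + Complex.I) (by simp) (by
        refine subset_union_of_subset_left ?_ _
        rw [leftSet, if_neg hd']; rfl)
    simp only [leftIntegral, if_neg hd'] at h1
    exact KernelData.upPrim_eq_zero_of_sum_eq_zero (K := K) (o := some (Sum.inr d)) hd (by simp) hc hcp e h1
  have hnegR : ∀ i, P.expMu i < 0 →
      ∃ b ∈ Ioo (P.below i) (P.μ i), K.Good (K.poles e) (b : ℝ) := by
    intro i hi
    refine ⟨C.baseR i, C.baseR_mem i, ?_⟩
    have h1 := C.sum_right v i
    rw [hR i] at h1
    obtain ⟨c, c', hw⟩ := (C.verR i).exists_onWedge (v := -1 + Complex.I) (w := 1 + Complex.I)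
      (b := C.baseR i) (by simp) (by simp) (P.isFree_below i _ (C.baseR_mem i))
      (by rw [rightSet, if_pos hi])
    simp only [rightIntegral, if_pos hi] at h1
    exact hw.good_of_sum_eq_zero e h1
  have hnegL : ∀ d, P.expNu d < 0 →
      ∃ b ∈ Ioo (-P.ν d) (P.aboveNeg d), K.Good (K.poles e) (b : ℝ) := by
    intro d hd
    have hd' : P.leftExp (Sum.inl d) < 0 := hd
    refine ⟨C.baseL (Sum.inl d), C.baseL_mem (Sum.inl d), ?_⟩
    have h1 := C.sum_left v (Sum.inl d)
    rw [hL d, neg_zero] at h1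
    obtain ⟨c, c', hw⟩ := (C.verL (Sum.inl d)).exists_onWedge (v := 1 + Complex.I)
      (w := -1 + Complex.I) (b := C.baseL (Sum.inl d)) (by simp) (by simp)
      (P.isFree_aboveNeg d _ (C.baseL_mem (Sum.inl d)))
      (by refine subset_union_of_subset_left ?_ _; rw [leftSet, if_pos hd'])
    simp only [leftIntegral, if_pos hd'] at h1
    exact hw.good_of_sum_eq_zero e h1
  -- The contour of the origin is not needed: the origin has exponent -1, and goodness reaches it
  -- independently from both sides.
  have he0 : e = 0 := KernelData.eq_zero_of_good
    (good_of_intervals hPF (good_right hPF hnegR hposR) (good_left hPF hnegL hposL)) (by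
      rintro (_ | k | d) ho
      · norm_num at ho
      · exact hposR k ho
      · exact hposL d ho)
  apply hv
  funext n
  refine Fin.addCases (fun k => ?_) (fun d => ?_) n
  · exact congrFun he0 (Sum.inl k)
  · simpa [he, rowResidue] using congrFun he0 (Sum.inr d)

end Contours

end JumpModel

end

/-! ### Hankel's integral -/

noncomputable section

open MeasureTheory Set

/-- Laplace transform of a power, for a complex argument. -/
def powLaplace (a : ℝ) (u : ℂ) : ℂ := ∫ t in Ioi (0 : ℝ), ((t ^ (a - 1) : ℝ) : ℂ) * Complex.exp (-(u * t))

lemma norm_pow_mul_exp (a : ℝ) (u : ℂ) {t : ℝ} (ht : 0 < t) :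
    ‖((t ^ (a - 1) : ℝ) : ℂ) * Complex.exp (-(u * t))‖ = t ^ (a - 1) * Real.exp (-u.re * t) := by
  rw [norm_mul, Complex.norm_real, Real.norm_of_nonneg (by positivity), Complex.norm_exp]
  simp

lemma integrableOn_rpow_mul_exp {a c : ℝ} (ha : 0 < a) (hc : 0 < c) :
    IntegrableOn (fun t : ℝ => t ^ (a - 1) * Real.exp (-c * t)) (Ioi 0) := by
  simpa using integrableOn_rpow_mul_exp_neg_mul_rpow (s := a - 1) (p := 1) (b := c) (by linarith)
    one_pos hc

lemma continuousOn_pow_mul_exp (a : ℝ) (u : ℂ) :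
    ContinuousOn (fun t : ℝ => ((t ^ (a - 1) : ℝ) : ℂ) * Complex.exp (-(u * t))) (Ioi 0) := by
  refine ContinuousOn.mul (Complex.continuous_ofReal.comp_continuousOn
    (continuousOn_id.rpow_const fun t ht => Or.inl (ne_of_gt ht))) (by fun_prop)

lemma integrableOn_pow_mul_exp {a : ℝ} (ha : 0 < a) {u : ℂ} (hu : 0 < u.re) :
    IntegrableOn (fun t : ℝ => ((t ^ (a - 1) : ℝ) : ℂ) * Complex.exp (-(u * t))) (Ioi 0) := by
  refine Integrable.mono' (integrableOn_rpow_mul_exp ha hu)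
    ((continuousOn_pow_mul_exp a u).aestronglyMeasurable measurableSet_Ioi) ?_
  filter_upwards [ae_restrict_mem measurableSet_Ioi] with t ht
  exact (norm_pow_mul_exp a u ht).le

lemma hasDerivAt_powLaplace {a : ℝ} (ha : 0 < a) {u : ℂ} (hu : 0 < u.re) :
    HasDerivAt (powLaplace a) (-powLaplace (a + 1) u) u := by
  have h := hasDerivAt_integral_of_dominated_loc_of_deriv_le (μ := volume.restrict (Ioi (0 : ℝ)))
    (F := fun (u : ℂ) (t : ℝ) => ((t ^ (a - 1) : ℝ) : ℂ) * Complex.exp (-(u * t)))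
    (F' := fun (u : ℂ) (t : ℝ) => -(((t ^ (a + 1 - 1) : ℝ) : ℂ) * Complex.exp (-(u * t))))
    (x₀ := u) (s := {y : ℂ | u.re / 2 < y.re})
    (bound := fun t => t ^ (a + 1 - 1) * Real.exp (-(u.re / 2) * t))
    ((isOpen_lt continuous_const Complex.continuous_re).mem_nhds
      (show u.re / 2 < u.re by linarith))
    (Eventually.of_forall fun y =>
      (continuousOn_pow_mul_exp a y).aestronglyMeasurable measurableSet_Ioi)
    (integrableOn_pow_mul_exp ha hu)
    ((continuousOn_pow_mul_exp (a + 1) u).neg.aestronglyMeasurable measurableSet_Ioi) ?_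
    (integrableOn_rpow_mul_exp (by linarith) (by linarith)) ?_
  · refine h.2.congr_deriv ?_
    rw [powLaplace, integral_neg]
  · filter_upwards [ae_restrict_mem measurableSet_Ioi] with t ht y hy
    replace ht : 0 < t := ht
    replace hy : u.re / 2 < y.re := hy
    rw [norm_neg, norm_pow_mul_exp _ _ ht]
    gcongr
  · filter_upwards [ae_restrict_mem measurableSet_Ioi] with t ht y hy
    replace ht : 0 < t := ht
    have h1 : HasDerivAt (fun y : ℂ => -(y * t)) (-(t : ℂ)) y := by
      simpa using ((hasDerivAt_id y).mul_const (t : ℂ)).fun_neg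
    refine (h1.cexp.const_mul _).congr_deriv ?_
    rw [show a + 1 - 1 = (a - 1) + 1 by ring, Real.rpow_add_one ht.ne']
    push_cast
    ring

/-- Integration by parts of t^a e^{-ut}; the boundary terms vanish because `a` and `u.re` are
positive. -/
lemma powLaplace_add_one {a : ℝ} (ha : 0 < a) {u : ℂ} (hu : 0 < u.re) :
    u * powLaplace (a + 1) u = a * powLaplace a u := by
  have hder : ∀ t ∈ Ioi (0 : ℝ), HasDerivAt
      (fun t : ℝ => ((t ^ a : ℝ) : ℂ) * Complex.exp (-(u * t)))
      (a * (((t ^ (a - 1) : ℝ) : ℂ) * Complex.exp (-(u * t))) -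
        u * (((t ^ (a + 1 - 1) : ℝ) : ℂ) * Complex.exp (-(u * t)))) t := by
    intro t ht
    have h1 : HasDerivAt (fun t : ℝ => ((t ^ a : ℝ) : ℂ)) ((a * t ^ (a - 1) : ℝ) : ℂ) t :=
      (Real.hasDerivAt_rpow_const (Or.inl (ne_of_gt ht))).ofReal_comp
    have h2 : HasDerivAt (fun t : ℝ => -(u * (t : ℂ))) (-u) t := by
      simpa using ((Complex.ofRealCLM.hasDerivAt (x := t)).const_mul u).fun_neg
    refine (h1.mul h2.cexp).congr_deriv ?_
    rw [add_sub_cancel_right]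
    push_cast
    ring
  have hlim : Tendsto (fun t : ℝ => ((t ^ a : ℝ) : ℂ) * Complex.exp (-(u * t))) atTop (𝓝 0) := by
    refine squeeze_zero_norm' ?_ (tendsto_rpow_mul_exp_neg_mul_atTop_nhds_zero a u.re hu)
    filter_upwards [eventually_gt_atTop 0] with t ht
    have := norm_pow_mul_exp (a + 1) u ht
    rw [add_sub_cancel_right] at this
    exact this.le
  have hcont : ContinuousWithinAt (fun t : ℝ => ((t ^ a : ℝ) : ℂ) * Complex.exp (-(u * t))) (Ici 0) 0 := by
    refine ContinuousAt.continuousWithinAt (ContinuousAt.mul ?_ (by fun_prop))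
    exact Complex.continuous_ofReal.continuousAt.comp
      (Real.continuousAt_rpow_const 0 a (Or.inr ha.le))
  have i1 := (integrableOn_pow_mul_exp ha hu).const_mul (a : ℂ)
  have i2 := (integrableOn_pow_mul_exp (a := a + 1) (by linarith) hu).const_mul u
  have h := integral_Ioi_of_hasDerivAt_of_tendsto hcont hder (i1.sub i2) hlim
  rw [integral_sub i1 i2, integral_const_mul, integral_const_mul] at h
  simp only [Real.zero_rpow ha.ne', Complex.ofReal_zero, zero_mul, sub_zero] at h
  rw [powLaplace, powLaplace]
  exact (sub_eq_zero.1 h).symm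

/-- The Laplace transform of a power in terms of the Gamma function. -/
lemma powLaplace_eq {a : ℝ} (ha : 0 < a) {u : ℂ} (hu : 0 < u.re) :
    powLaplace a u = Complex.exp (-(a * Complex.log u)) * (Real.Gamma a : ℂ) := by
  -- The function y^a times the Laplace transform has derivative zero on the right half-plane, and
  -- its value at 1 is Γ(a).
  have hder : ∀ y ∈ {y : ℂ | 0 < y.re},
      HasDerivAt (fun y => Complex.exp (a * Complex.log y) * powLaplace a y) 0 y := by
    intro y hy
    have hy0 : y ≠ 0 := by rintro rfl; simp at hy
    have h1 := ((Complex.hasDerivAt_log (Or.inl hy)).const_mul (a : ℂ)).cexp.mul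
      (hasDerivAt_powLaplace ha hy)
    refine h1.congr_deriv ?_
    have := powLaplace_add_one ha hy
    have e : powLaplace (a + 1) y = a * y⁻¹ * powLaplace a y := by
      field_simp
      linear_combination this
    rw [e]
    ring
  have hconv : Convex ℝ {y : ℂ | 0 < y.re} := (convex_Ioi (0 : ℝ)).linear_preimage Complex.reLm
  have hopen : IsOpen {y : ℂ | 0 < y.re} := isOpen_lt continuous_const Complex.continuous_re
  have h := hopen.is_const_of_deriv_eq_zero hconv.isPreconnected
    (fun y hy => (hder y hy).differentiableAt.differentiableWithinAt)
    (fun y hy => (hder y hy).deriv) hu (show (1 : ℂ) ∈ {y : ℂ | 0 < y.re} by simp)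
  have h1 : powLaplace a 1 = (Real.Gamma a : ℂ) := by
    rw [Real.Gamma_eq_integral ha, powLaplace]
    refine Eq.trans ?_ integral_complex_ofReal
    refine setIntegral_congr_fun measurableSet_Ioi fun t ht => ?_
    push_cast
    rw [one_mul, mul_comm]
  simp only [Complex.log_one, mul_zero, Complex.exp_zero, one_mul, h1] at h
  rw [← h, ← mul_assoc, ← Complex.exp_add, neg_add_cancel, Complex.exp_zero, one_mul]

/-- The direction of the ascending ray of a left contour. -/
def leftDir : ℂ := -1 + Complex.I

lemma leftDir_re_im (x t : ℝ) : ((x : ℂ) + leftDir * t).re = x - t ∧ ((x : ℂ) + leftDir * t).im = t := by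
  constructor <;> simp [leftDir]
  ring

lemma norm_left_ge {x t : ℝ} (hx : 0 ≤ x) (ht : 0 ≤ t) :
    x / 2 ≤ ‖(x : ℂ) + leftDir * t‖ ∧ t ≤ ‖(x : ℂ) + leftDir * t‖ ∧
      ‖(x : ℂ) + leftDir * t‖ ≤ x + 2 * t := by
  obtain ⟨h1, h2⟩ := leftDir_re_im x t
  have h3 : ‖(x : ℂ) + leftDir * t‖ ^ 2 = (x - t) ^ 2 + t ^ 2 := by
    rw [Complex.sq_norm, Complex.normSq_apply, h1, h2]; ring
  refine ⟨?_, ?_, ?_⟩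
  · refine (abs_le_of_sq_le_sq' ?_ (norm_nonneg _)).2
    rw [h3]; nlinarith [sq_nonneg (x - 2 * t)]
  · refine (abs_le_of_sq_le_sq' ?_ (norm_nonneg _)).2
    rw [h3]; nlinarith [sq_nonneg (x - t)]
  · refine (abs_le_of_sq_le_sq' ?_ (by positivity)).2
    rw [h3]; nlinarith [mul_nonneg hx ht]

/-- The rate 1/4 leaves room along left rays: there ‖z‖ ≤ x + 2t, so e^{‖z‖/4} grows at most like
e^{t/2}, while the integrands carry e^{-t}. -/
lemma exists_rpow_le_exp (b : ℝ) {y₀ : ℝ} (hy₀ : 0 < y₀) :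
    ∃ C : ℝ, 0 < C ∧ ∀ y, y₀ ≤ y → y ^ b ≤ C * Real.exp (y / 4) := by
  rcases le_or_gt b 0 with hb | hb
  · refine ⟨y₀ ^ b, by positivity, fun y hy => ?_⟩
    have h1 := Real.rpow_le_rpow_of_nonpos hy₀ hy hb
    have h2 : 1 ≤ Real.exp (y / 4) := Real.one_le_exp (by linarith)
    nlinarith [Real.rpow_pos_of_pos hy₀ b]
  · refine ⟨(4 * b) ^ b, by positivity, fun y hy => ?_⟩
    have hy0 : 0 < y := hy₀.trans_le hy
    have h1 : y / (4 * b) ≤ Real.exp (y / (4 * b)) := by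
      linarith [Real.add_one_le_exp (y / (4 * b))]
    have h2 : (y / (4 * b)) ^ b ≤ Real.exp (y / 4) := by
      refine (Real.rpow_le_rpow (by positivity) h1 hb.le).trans (le_of_eq ?_)
      rw [← Real.exp_mul]
      congr 1
      field_simp
    rw [Real.div_rpow hy0.le (by positivity), div_le_iff₀ (by positivity)] at h2
    linarith

/-- Integrability of powers times a decaying exponential along a left ray. -/
lemma integrableOn_norm_left {x b : ℝ} (hx : 0 ≤ x) (h : 0 < x ∨ 0 < b) :
    IntegrableOn (fun t : ℝ => ‖(x : ℂ) + leftDir * t‖ ^ (b - 1) * Real.exp (-t)) (Ioi 0) := by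
  have hm : ContinuousOn (fun t : ℝ => ‖(x : ℂ) + leftDir * t‖ ^ (b - 1) * Real.exp (-t)) (Ioi 0) := by
    refine ContinuousOn.mul (ContinuousOn.rpow_const (by fun_prop) fun t ht => Or.inl ?_) (by fun_prop)
    exact (lt_of_lt_of_le ht (norm_left_ge hx (le_of_lt ht)).2.1).ne'
  rcases hx.eq_or_lt with rfl | hx0
  · have hb : 0 < b := h.resolve_left (lt_irrefl _)
    refine IntegrableOn.congr_fun ((integrableOn_rpow_mul_exp hb one_pos).const_mul
      (‖leftDir‖ ^ (b - 1))) (fun t ht => ?_) measurableSet_Ioi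
    replace ht : 0 < t := ht
    simp only [Complex.ofReal_zero, zero_add]
    rw [norm_mul, Complex.norm_real, Real.norm_of_nonneg ht.le,
      Real.mul_rpow (norm_nonneg _) ht.le, neg_one_mul]
    ring
  · obtain ⟨C, hC, hb⟩ := exists_rpow_le_exp (b - 1) (show 0 < x / 2 by positivity)
    refine Integrable.mono' ((integrableOn_rpow_mul_exp (a := 1) one_pos
      (show (0 : ℝ) < 1 / 2 by norm_num)).const_mul (C * Real.exp (x / 4)))
      (hm.aestronglyMeasurable measurableSet_Ioi) ?_
    filter_upwards [ae_restrict_mem measurableSet_Ioi] with t ht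
    replace ht : 0 < t := ht
    obtain ⟨h1, h2, h3⟩ := norm_left_ge hx ht.le
    rw [Real.norm_of_nonneg (by positivity), sub_self, Real.rpow_zero, one_mul]
    calc _ ≤ C * Real.exp (‖(x : ℂ) + leftDir * t‖ / 4) * Real.exp (-t) := by
          gcongr; exact hb _ h1
      _ ≤ C * Real.exp ((x + 2 * t) / 4) * Real.exp (-t) := by gcongr
      _ = C * Real.exp (x / 4) * Real.exp (-(1 / 2) * t) := by
          rw [mul_assoc, mul_assoc, ← Real.exp_add, ← Real.exp_add]
          congr 2
          ring

/-- The integrand `z ^ (a - 1) e ^ z` of Hankel's integral. -/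
def hankelFun (a : ℝ) (z : ℂ) : ℂ := Complex.exp (a * Complex.log z) * z⁻¹ * Complex.exp z

/-- The upper half of Hankel's integral. -/
def hankelHalf (a x : ℝ) : ℂ := ∫ t in Ioi (0 : ℝ), hankelFun a (x + leftDir * t) * leftDir

lemma left_mem_slitPlane {x t : ℝ} (ht : 0 ≤ t) (h : 0 < x ∨ 0 < t) :
    (x : ℂ) + leftDir * t ∈ Complex.slitPlane := by
  rw [Complex.mem_slitPlane_iff, (leftDir_re_im x t).1, (leftDir_re_im x t).2]
  rcases ht.eq_or_lt with rfl | ht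
  · left; rcases h with h | h
    · linarith
    · exact absurd h (lt_irrefl _)
  · exact Or.inr ht.ne'

lemma norm_hankelFun (a : ℝ) {z : ℂ} (hz : z ≠ 0) :
    ‖hankelFun a z‖ = ‖z‖ ^ (a - 1) * Real.exp z.re := by
  rw [hankelFun, norm_mul, norm_mul, KernelData.norm_exp_mul_log hz, norm_inv, Complex.norm_exp,
    Real.rpow_sub_one (norm_ne_zero_iff.2 hz), div_eq_mul_inv]

lemma hasDerivAt_hankelFun (a : ℝ) {z : ℂ} (hz : z ∈ Complex.slitPlane) :
    HasDerivAt (fun z => Complex.exp (a * Complex.log z) * Complex.exp z)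
      (a * hankelFun a z + hankelFun (a + 1) z) z := by
  have h1 := ((Complex.hasDerivAt_log hz).const_mul (a : ℂ)).cexp.mul (Complex.hasDerivAt_exp z)
  refine h1.congr_deriv ?_
  have hz0 := Complex.slitPlane_ne_zero hz
  simp only [hankelFun]
  push_cast
  rw [add_mul, one_mul, Complex.exp_add, Complex.exp_log hz0]
  field_simp

lemma differentiableOn_hankelFun (a : ℝ) : DifferentiableOn ℂ (hankelFun a) Complex.slitPlane := by
  intro z hz
  refine DifferentiableAt.differentiableWithinAt ?_
  have hz0 := Complex.slitPlane_ne_zero hz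
  exact (((Complex.differentiableAt_log hz).const_mul _).cexp.mul (differentiableAt_inv hz0)).mul
    Complex.differentiableAt_exp

lemma continuousOn_hankelFun_left (a x : ℝ) :
    ContinuousOn (fun t : ℝ => hankelFun a (x + leftDir * t) * leftDir) (Ioi 0) :=
  ((differentiableOn_hankelFun a).continuousOn.comp (by fun_prop)
    fun _ ht => left_mem_slitPlane (le_of_lt ht) (Or.inr ht)).mul_const _

lemma norm_hankelFun_left (a : ℝ) {x t : ℝ} (ht : 0 < t) :
    ‖hankelFun a (x + leftDir * t) * leftDir‖ =
      ‖leftDir‖ * Real.exp x * (‖(x : ℂ) + leftDir * t‖ ^ (a - 1) * Real.exp (-t)) := by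
  rw [norm_mul, norm_hankelFun a (Complex.slitPlane_ne_zero
    (left_mem_slitPlane ht.le (Or.inr ht))), (leftDir_re_im x t).1, sub_eq_add_neg x t, Real.exp_add]
  ring

lemma integrableOn_hankelFun {a x : ℝ} (hx : 0 ≤ x) (h : 0 < x ∨ 0 < a) :
    IntegrableOn (fun t : ℝ => hankelFun a (x + leftDir * t) * leftDir) (Ioi 0) := by
  refine Integrable.mono' ((integrableOn_norm_left hx h).const_mul (‖leftDir‖ * Real.exp x))
    ((continuousOn_hankelFun_left a x).aestronglyMeasurable measurableSet_Ioi) ?_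
  filter_upwards [ae_restrict_mem measurableSet_Ioi] with t ht
  exact (norm_hankelFun_left a ht).le

lemma exp_log_ofReal_im (a : ℝ) {x : ℝ} (hx : 0 < x) :
    (Complex.exp (a * Complex.log x) * Complex.exp x).im = 0 := by
  rw [← Complex.ofReal_log hx.le, ← Complex.ofReal_mul, ← Complex.ofReal_exp, ← Complex.ofReal_exp,
    ← Complex.ofReal_mul, Complex.ofReal_im]

/-- Integration by parts. -/
lemma hankelHalf_add_one_im (a : ℝ) {x : ℝ} (hx : 0 < x) :
    (hankelHalf (a + 1) x).im = -a * (hankelHalf a x).im := by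
  have hline : ∀ t : ℝ, HasDerivAt (fun t : ℝ => (x : ℂ) + leftDir * (t : ℂ)) leftDir t := fun t => by
    simpa using ((Complex.ofRealCLM.hasDerivAt (x := t)).const_mul leftDir).const_add (x : ℂ)
  have hder : ∀ t ∈ Ici (0 : ℝ), HasDerivAt
      (fun t : ℝ => Complex.exp (a * Complex.log (x + leftDir * t)) * Complex.exp (x + leftDir * t))
      (a * (hankelFun a (x + leftDir * t) * leftDir) +
        hankelFun (a + 1) (x + leftDir * t) * leftDir) t := by
    intro t ht
    have h1 := HasDerivAt.comp
      (h₂ := fun z => Complex.exp (a * Complex.log z) * Complex.exp z) t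
      (hasDerivAt_hankelFun a (left_mem_slitPlane ht (Or.inl hx))) (hline t)
    exact h1.congr_deriv (by ring)
  have i1 := (integrableOn_hankelFun (a := a) hx.le (Or.inl hx)).const_mul (a : ℂ)
  have i2 := integrableOn_hankelFun (a := a + 1) hx.le (Or.inl hx)
  have hlim : Tendsto (fun t : ℝ => Complex.exp (a * Complex.log (x + leftDir * t)) *
      Complex.exp (x + leftDir * t)) atTop (𝓝 0) := by
    obtain ⟨C, hC, hb⟩ := exists_rpow_le_exp a (show 0 < x / 2 by positivity)
    have h0 : Tendsto (fun t : ℝ => C * Real.exp (x / 4 + x) * Real.exp (-(1 / 2) * t)) atTop (𝓝 0) := by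
      rw [← mul_zero (C * Real.exp (x / 4 + x))]
      refine Tendsto.const_mul _ (Real.tendsto_exp_atBot.comp ?_)
      exact tendsto_id.const_mul_atTop_of_neg (by norm_num)
    refine squeeze_zero_norm' ?_ h0
    filter_upwards [eventually_ge_atTop 0] with t ht
    obtain ⟨h1, h2, h3⟩ := norm_left_ge hx.le ht
    rw [norm_mul, KernelData.norm_exp_mul_log (Complex.slitPlane_ne_zero
      (left_mem_slitPlane ht (Or.inl hx))), Complex.norm_exp, (leftDir_re_im x t).1]
    calc _ ≤ C * Real.exp (‖(x : ℂ) + leftDir * t‖ / 4) * Real.exp (x - t) := by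
          gcongr; exact hb _ h1
      _ ≤ C * Real.exp ((x + 2 * t) / 4) * Real.exp (x - t) := by gcongr
      _ = _ := by
          rw [mul_assoc, mul_assoc, ← Real.exp_add, ← Real.exp_add]
          congr 2
          ring
  have h := integral_Ioi_of_hasDerivAt_of_tendsto' hder (i1.add i2) hlim
  rw [integral_add i1 i2, integral_const_mul] at h
  simp only [Complex.ofReal_zero, mul_zero, add_zero, zero_sub] at h
  -- The boundary term x^a e^x is real, so it disappears from the imaginary part.
  have h2 := congrArg Complex.im h
  rw [Complex.neg_im, exp_log_ofReal_im a hx, Complex.add_im, Complex.im_ofReal_mul] at h2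
  simp only [hankelHalf]
  linarith

/-- The imaginary part of the half integral does not depend on the base point. -/
lemma hankelHalf_im_eq_of_le {a x y : ℝ} (ha : a ≤ -1) (hx : 0 < x) (hy : 0 < y) :
    (hankelHalf a x).im = (hankelHalf a y).im := by
  set B := max x y + 1
  -- On `E` the exponential is bounded, and `a ≤ -1` makes the power decay quadratically.
  set E : Set ℂ := {z | 0 < z.im ∨ 0 < z.re} ∩ {z | z.re < B}
  have hE : UpDecay E (hankelFun a) := by
    refine ⟨?_, ?_, ?_, ?_⟩
    · exact ((isOpen_lt continuous_const Complex.continuous_im).union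
        (isOpen_lt continuous_const Complex.continuous_re)).inter
        (isOpen_lt Complex.continuous_re continuous_const)
    · rintro z ⟨h1, h2⟩ t ht
      refine ⟨?_, by simpa using h2⟩
      rcases h1 with h | h
      · left; simp; linarith
      · right; simpa using h
    · refine (differentiableOn_hankelFun a).mono ?_
      rintro z ⟨h | h, -⟩
      · exact Or.inr h.ne'
      · exact Or.inl h
    · refine ⟨Real.exp B, 1, by positivity, one_pos, ?_⟩
      rintro z ⟨-, h2⟩ hz
      replace h2 : z.re < B := h2
      have hz0 : 0 < ‖z‖ := by linarith
      rw [norm_hankelFun a (norm_pos_iff.1 hz0), mul_comm, div_eq_mul_inv]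
      have h3 : ‖z‖ ^ (a - 1) ≤ (‖z‖ ^ 2)⁻¹ := by
        rw [← Real.rpow_two, ← Real.rpow_neg hz0.le]
        exact Real.rpow_le_rpow_of_exponent_le hz (by linarith)
      gcongr
  have hmem : ∀ u : ℝ, 0 < u → u < B → ∀ t : ℝ, 0 ≤ t → (u : ℂ) + leftDir * t ∈ E := by
    intro u hu huB t ht
    refine ⟨?_, ?_⟩
    · change 0 < ((u : ℂ) + leftDir * t).im ∨ 0 < ((u : ℂ) + leftDir * t).re
      rw [(leftDir_re_im u t).1, (leftDir_re_im u t).2]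
      rcases ht.eq_or_lt with rfl | ht
      · right; linarith
      · left; exact ht
    · change ((u : ℂ) + leftDir * t).re < B
      rw [(leftDir_re_im u t).1]
      linarith
  have hval : ∀ u : ℝ, 0 < u → u < B → hankelHalf a u = -upPrim (hankelFun a) u := fun u hu huB =>
    hE.integral_ray_of_mem (by simp) (by simp [leftDir]) (hmem u hu huB)
  -- The integrand is real on the positive axis, so moving the base point does not change the
  -- imaginary part of the primitive.
  have hder : ∀ u ∈ Ioo 0 B, HasDerivAt (fun u : ℝ => (upPrim (hankelFun a) u).im) 0 u := by
    intro u hu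
    have hm : (u : ℂ) ∈ E := by simpa using hmem u hu.1 hu.2 0 le_rfl
    have h1 := (hE.hasDerivAt_upPrim hm).comp_ofReal
    have h2 := (Complex.imCLM.hasFDerivAt (x := upPrim (hankelFun a) u)).comp_hasDerivAt u h1
    refine h2.congr_deriv ?_
    have h3 : hankelFun a u = (Complex.exp (a * Complex.log u) * Complex.exp u) * ((u⁻¹ : ℝ) : ℂ) := by
      rw [hankelFun]; push_cast; ring
    rw [Complex.imCLM_apply, h3, Complex.im_mul_ofReal, exp_log_ofReal_im a hu.1, zero_mul]
  have hxB : x < B := by simp only [B]; linarith [le_max_left x y]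
  have hyB : y < B := by simp only [B]; linarith [le_max_right x y]
  have h := isOpen_Ioo.is_const_of_deriv_eq_zero (s := Ioo 0 B) isPreconnected_Ioo
    (fun u hu => (hder u hu).differentiableAt.differentiableWithinAt)
    (fun u hu => (hder u hu).deriv) (x := x) (y := y) ⟨hx, hxB⟩ ⟨hy, hyB⟩
  rw [hval x hx hxB, hval y hy hyB, Complex.neg_im, Complex.neg_im]
  exact congrArg Neg.neg h

/-- Two integrations by parts lower the exponent by two and reduce the claim to `a ≤ -1`. -/
lemma hankelHalf_im_eq {a x y : ℝ} (ha : a ≤ 1) (hx : 0 < x) (hy : 0 < y) :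
    (hankelHalf a x).im = (hankelHalf a y).im := by
  have h1 : ∀ u : ℝ, 0 < u → (hankelHalf a u).im = -(a - 1) * (-(a - 2) * (hankelHalf (a - 2) u).im) := by
    intro u hu
    have e1 := hankelHalf_add_one_im (a - 1) hu
    have e2 := hankelHalf_add_one_im (a - 2) hu
    rw [show a - 1 + 1 = a by ring] at e1
    rw [show a - 2 + 1 = a - 1 by ring] at e2
    rw [e1, e2]
  rw [h1 x hx, h1 y hy, hankelHalf_im_eq_of_le (by linarith) hx hy]

/-- Along the ray from the origin the integral is a Laplace transform at `-leftDir`. The phase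
arises since the principal logarithms of `leftDir` and `-leftDir` differ by iπ. -/
lemma hankelHalf_zero {a : ℝ} (ha : 0 < a) :
    hankelHalf a 0 = Complex.exp (a * (Real.pi * Complex.I)) * (Real.Gamma a : ℂ) := by
  have hre : 0 < (-leftDir).re := by simp [leftDir]
  have hw0 : leftDir ≠ 0 := by intro h; rw [h] at hre; simp at hre
  have h1 : hankelHalf a 0 = Complex.exp (a * Complex.log leftDir) * powLaplace a (-leftDir) := by
    rw [hankelHalf, powLaplace, ← integral_const_mul]
    refine setIntegral_congr_fun measurableSet_Ioi fun t ht => ?_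
    replace ht : 0 < t := ht
    have ht0 : (t : ℂ) ≠ 0 := by exact_mod_cast ht.ne'
    have e : Complex.log (leftDir * t) = Real.log t + Complex.log leftDir := by
      rw [mul_comm, Complex.log_ofReal_mul ht hw0]
    have e' : Complex.exp (-(-leftDir * t)) = Complex.exp (leftDir * t) := by
      rw [neg_mul, neg_neg]
    rw [hankelFun, Complex.ofReal_zero, zero_add, e', e, mul_add, Complex.exp_add, Real.rpow_sub_one ht.ne', Real.rpow_def_of_pos ht]
    push_cast
    rw [mul_comm (a : ℂ) (Real.log t : ℂ)]
    field_simp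
  have hlog : Complex.log (-leftDir) = Complex.log leftDir - Real.pi * Complex.I := by
    rw [Complex.log, Complex.log, norm_neg, Complex.arg_neg_eq_arg_sub_pi_of_im_pos (by simp [leftDir])]
    push_cast
    ring
  rw [h1, powLaplace_eq ha hre, hlog, ← mul_assoc, ← Complex.exp_add]
  congr 2
  ring

lemma hankelHalf_zero_ne {a : ℝ} (ha : 0 < a) : hankelHalf a 0 ≠ 0 := by
  rw [hankelHalf_zero ha]
  exact mul_ne_zero (Complex.exp_ne_zero _) (by exact_mod_cast (Real.Gamma_pos_of_pos ha).ne')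

/-- The base point may be moved to the origin, where the imaginary part is sin(πa) Γ(a); the
reflection formula for Γ concludes. -/
lemma hankelHalf_im_of_mem_Ioo {a x : ℝ} (ha : 0 < a) (ha1 : a < 1) (hx : 0 < x) :
    (hankelHalf a x).im = Real.pi / Real.Gamma (1 - a) := by
  have hlim : Tendsto (fun y : ℝ => hankelHalf a y) (𝓝[>] 0) (𝓝 (hankelHalf a 0)) := by
    refine tendsto_integral_filter_of_dominated_convergence
      (fun t => ‖leftDir‖ * Real.exp 1 * (t ^ (a - 1) * Real.exp (-1 * t))) ?_ ?_ ?_ ?_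
    · filter_upwards [self_mem_nhdsWithin] with y hy
      exact (continuousOn_hankelFun_left a y).aestronglyMeasurable measurableSet_Ioi
    · filter_upwards [Ioo_mem_nhdsGT one_pos] with y hy
      filter_upwards [ae_restrict_mem measurableSet_Ioi] with t ht
      replace ht : 0 < t := ht
      rw [norm_hankelFun_left a ht, neg_one_mul]
      have h1 := (norm_left_ge hy.1.le ht.le).2.1
      have h2 : ‖(y : ℂ) + leftDir * t‖ ^ (a - 1) ≤ t ^ (a - 1) :=
        Real.rpow_le_rpow_of_nonpos ht h1 (by linarith)
      have h3 : y ≤ 1 := hy.2.le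
      gcongr
    · exact (integrableOn_rpow_mul_exp ha one_pos).const_mul _
    · filter_upwards [ae_restrict_mem measurableSet_Ioi] with t ht
      refine Tendsto.mul_const _ (Tendsto.mono_left ?_ nhdsWithin_le_nhds)
      have hm := left_mem_slitPlane (x := 0) (le_of_lt ht) (Or.inr ht)
      have h1 := ((differentiableOn_hankelFun a).differentiableAt
        (Complex.isOpen_slitPlane.mem_nhds hm)).continuousAt
      exact ContinuousAt.comp (f := fun y : ℝ => (y : ℂ) + leftDir * t) h1 (by fun_prop)
  have h1 : (hankelHalf a x).im = (hankelHalf a 0).im := by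
    refine tendsto_nhds_unique (f := fun _ : ℝ => (hankelHalf a x).im) (l := 𝓝[>] 0)
      tendsto_const_nhds (((Complex.continuous_im.tendsto _).comp hlim).congr' ?_)
    filter_upwards [self_mem_nhdsWithin] with y hy
    exact hankelHalf_im_eq ha1.le hy hx
  have h2 : (Complex.exp (a * (Real.pi * Complex.I))).im = Real.sin (Real.pi * a) := by
    rw [show (a : ℂ) * (Real.pi * Complex.I) = ((Real.pi * a : ℝ) : ℂ) * Complex.I by push_cast; ring,
      Complex.exp_ofReal_mul_I_im]
  have h3 := Real.Gamma_mul_Gamma_one_sub a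
  have hs : 0 < Real.sin (Real.pi * a) :=
    Real.sin_pos_of_pos_of_lt_pi (by positivity) (by nlinarith [Real.pi_pos])
  have hg : 0 < Real.Gamma (1 - a) := Real.Gamma_pos_of_pos (by linarith)
  rw [h1, hankelHalf_zero ha, Complex.im_mul_ofReal, h2]
  rw [eq_div_iff hs.ne'] at h3
  rw [eq_div_iff hg.ne']
  linarith

/-- The limit a → 0+ of the preceding formula with `x` fixed, as Γ(1) = 1. -/
lemma hankelHalf_zero_im {x : ℝ} (hx : 0 < x) : (hankelHalf 0 x).im = Real.pi := by
  have hlim : Tendsto (fun a : ℝ => hankelHalf a x) (𝓝[>] 0) (𝓝 (hankelHalf 0 x)) := by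
    -- For `0 < a < 1` the power is at most the sum of the powers for a = 0 and a = 1, which gives a
    -- majorant independent of `a`.
    refine tendsto_integral_filter_of_dominated_convergence
      (fun t => ‖leftDir‖ * Real.exp x * (‖(x : ℂ) + leftDir * t‖ ^ ((0 : ℝ) - 1) * Real.exp (-t) +
        ‖(x : ℂ) + leftDir * t‖ ^ ((1 : ℝ) - 1) * Real.exp (-t))) ?_ ?_ ?_ ?_
    · exact Eventually.of_forall fun a =>
        (continuousOn_hankelFun_left a x).aestronglyMeasurable measurableSet_Ioi
    · filter_upwards [Ioo_mem_nhdsGT one_pos] with a ha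
      filter_upwards [ae_restrict_mem measurableSet_Ioi] with t ht
      replace ht : 0 < t := ht
      rw [norm_hankelFun_left a ht, ← add_mul]
      have hpos : 0 < ‖(x : ℂ) + leftDir * t‖ := ht.trans_le (norm_left_ge hx.le ht.le).2.1
      have h2 : ‖(x : ℂ) + leftDir * t‖ ^ (a - 1) ≤
          ‖(x : ℂ) + leftDir * t‖ ^ ((0 : ℝ) - 1) + ‖(x : ℂ) + leftDir * t‖ ^ ((1 : ℝ) - 1) := by
        rcases le_total ‖(x : ℂ) + leftDir * t‖ 1 with h | h
        · exact (Real.rpow_le_rpow_of_exponent_ge hpos h (by linarith [ha.1])).trans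
            (le_add_of_nonneg_right (by positivity))
        · exact (Real.rpow_le_rpow_of_exponent_le h (by linarith [ha.2])).trans
            (le_add_of_nonneg_left (by positivity))
      gcongr
    · exact ((integrableOn_norm_left hx.le (Or.inl hx)).add
        (integrableOn_norm_left hx.le (Or.inl hx))).const_mul _
    · filter_upwards [ae_restrict_mem measurableSet_Ioi] with t ht
      refine Tendsto.mono_left ?_ (nhdsWithin_le_nhds (a := (0 : ℝ)))
      have : Continuous fun a : ℝ => hankelFun a (x + leftDir * t) * leftDir := by
        unfold hankelFun
        fun_prop
      exact this.tendsto 0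
  have h1 := (Complex.continuous_im.tendsto _).comp hlim
  have h2 : Tendsto (fun a : ℝ => Real.pi / Real.Gamma (1 - a)) (𝓝[>] 0) (𝓝 Real.pi) := by
    have hc : ContinuousAt (fun a : ℝ => Real.pi / Real.Gamma (1 - a)) 0 := by
      have hd : ContinuousAt Real.Gamma (1 - 0) := by
        rw [sub_zero]
        refine (Real.differentiableAt_Gamma fun m => ?_).continuousAt
        have : (0 : ℝ) ≤ m := Nat.cast_nonneg m
        linarith
      refine continuousAt_const.div (ContinuousAt.comp (f := fun a : ℝ => 1 - a) hd (by fun_prop)) ?_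
      simp
    have := hc.tendsto.mono_left (nhdsWithin_le_nhds (s := Ioi 0))
    simpa using this
  refine tendsto_nhds_unique h1 (h2.congr' ?_)
  filter_upwards [Ioo_mem_nhdsGT one_pos] with a ha
  exact (hankelHalf_im_of_mem_Ioo ha.1 ha.2 hx).symm

/-- Hankel's integral does not vanish for nonpositive exponents. -/
lemma hankelHalf_im_ne_zero {a x : ℝ} (ha : a ≤ 0) (hx : 0 < x) : (hankelHalf a x).im ≠ 0 := by
  -- The explicit values cover [0, 1). By the recurrence, a zero at `a` would produce a zero at `a +
  -- 1`.
  have key : ∀ n : ℕ, ∀ a : ℝ, -(n : ℝ) ≤ a → a < 1 → (hankelHalf a x).im ≠ 0 := by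
    intro n
    induction n with
    | zero =>
      intro a h0 h1
      rcases (show 0 ≤ a by simpa using h0).eq_or_lt with rfl | h0
      · rw [hankelHalf_zero_im hx]; exact Real.pi_ne_zero
      · rw [hankelHalf_im_of_mem_Ioo h0 h1 hx]
        exact div_ne_zero Real.pi_ne_zero (Real.Gamma_pos_of_pos (by linarith)).ne'
    | succ n ih =>
      intro a h0 h1
      rcases le_or_gt (-(n : ℝ)) a with h | h
      · exact ih a h h1
      · have hn : (0 : ℝ) ≤ n := Nat.cast_nonneg n
        intro hz
        push_cast at h0
        refine ih (a + 1) (by linarith) (by linarith) ?_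
        rw [hankelHalf_add_one_im a hx, hz, mul_zero]
  obtain ⟨n, hn⟩ := exists_nat_ge (-a)
  exact key n a (by linarith) (by linarith)

end

/-! ### Watson's lemma along left rays -/

noncomputable section

open MeasureTheory Set

lemma log_neg_I_mul {z : ℂ} (hz : z ≠ 0) (him : 0 ≤ z.im) :
    Complex.log (-Complex.I * z) = Complex.log z - (Real.pi / 2 : ℝ) * Complex.I := by
  have h1 : 0 ≤ Complex.arg z := Complex.arg_nonneg_iff.2 him
  have h2 := Complex.arg_le_pi z
  have h3 := Real.pi_pos
  rw [(Complex.log_mul_eq_add_log_iff (by simp) hz).2, Complex.log_neg_I]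
  · push_cast
    ring
  · rw [Complex.arg_neg_I]
    constructor <;> linarith

/-- The closed region swept by the left rays with base points in `[p, p + x₀]`. -/
def leftSweep (p x₀ : ℝ) : Set ℂ := {z | 0 ≤ z.im ∧ p ≤ z.re + z.im ∧ z.re + z.im ≤ p + x₀}

lemma isClosed_leftSweep (p x₀ : ℝ) : IsClosed (leftSweep p x₀) :=
  (isClosed_le continuous_const Complex.continuous_im).inter
    ((isClosed_le continuous_const (Complex.continuous_re.add Complex.continuous_im)).inter
      (isClosed_le (Complex.continuous_re.add Complex.continuous_im) continuous_const))

lemma mem_leftSweep {p x₀ x t : ℝ} (hx : 0 ≤ x) (hx' : x ≤ x₀) (ht : 0 ≤ t) :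
    (p : ℂ) + (x + leftDir * t) ∈ leftSweep p x₀ := by
  obtain ⟨h1, h2⟩ := leftDir_re_im x t
  refine ⟨?_, ?_, ?_⟩ <;> simp only [Complex.add_re, Complex.add_im, Complex.ofReal_re,
    Complex.ofReal_im] at h1 h2 ⊢ <;> linarith

/-- Polynomial growth of the regular factor of a function that is bounded at infinity. -/
lemma exists_factor_bound {f G : ℂ → ℂ} {p x₀ α C₀ ρ : ℝ}
    (hf : ∀ z ∈ leftSweep p x₀, z ≠ p →
      f z = (z - p)⁻¹ * Complex.exp (α * Complex.log (-Complex.I * (z - p))) * G z)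
    (hG : ContinuousOn G (leftSweep p x₀))
    (hb : ∀ z ∈ leftSweep p x₀, ρ ≤ ‖z‖ → ‖f z‖ ≤ C₀ / ‖z‖ ^ 2) :
    ∃ C : ℝ, 0 < C ∧ ∀ z ∈ leftSweep p x₀, ‖G z‖ ≤ C * (1 + ‖z - p‖ ^ |1 - α|) := by
  set ρ' := max ρ 1 + |p|
  have hcomp : IsCompact (Metric.closedBall (p : ℂ) ρ' ∩ leftSweep p x₀) :=
    (isCompact_closedBall _ _).inter_right (isClosed_leftSweep p x₀)
  obtain ⟨M, hM⟩ := hcomp.exists_bound_of_continuousOn (hG.mono inter_subset_right)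
  refine ⟨|M| + |C₀| + 1, by positivity, fun z hz => ?_⟩
  have hpow : 0 ≤ ‖z - p‖ ^ |1 - α| := by positivity
  rcases le_total ‖z - p‖ ρ' with h | h
  · have h1 := hM z ⟨by simpa [dist_eq_norm] using h, hz⟩
    have h2 := le_abs_self M
    have h3 := abs_nonneg C₀
    have h4 := abs_nonneg M
    nlinarith
  · have h1 : 1 ≤ ‖z - p‖ := by
      have := le_max_right ρ 1
      have := abs_nonneg p
      simp only [ρ'] at h
      linarith
    have h1' : 0 < ‖z - p‖ := by linarith
    have h2 : max ρ 1 ≤ ‖z‖ := by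
      have := norm_sub_le z p
      rw [Complex.norm_real, Real.norm_eq_abs] at this
      simp only [ρ'] at h
      linarith
    have hzp : z - p ≠ 0 := norm_pos_iff.1 h1'
    have h3 := hb z hz ((le_max_left _ _).trans h2)
    have h4 : 1 ≤ ‖z‖ := (le_max_right _ _).trans h2
    -- Boundedness of `f` far out is enough: solving the factorisation for `G` costs a factor ‖z -
    -- p‖^(1 - α).
    have h5 : ‖f z‖ ≤ |C₀| := by
      refine h3.trans ?_
      rw [div_le_iff₀ (by positivity)]
      exact (le_abs_self _).trans (le_mul_of_one_le_right (abs_nonneg _) (one_le_pow₀ h4))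
    rw [hf z hz (sub_ne_zero.1 hzp), norm_mul, norm_mul,
      KernelData.norm_exp_mul_log (mul_ne_zero (by simp) hzp), norm_inv, norm_mul, norm_neg,
      Complex.norm_I, one_mul] at h5
    have e : ‖z - p‖⁻¹ * ‖z - p‖ ^ α = (‖z - p‖ ^ (1 - α))⁻¹ := by
      rw [← Real.rpow_neg h1'.le, neg_sub, Real.rpow_sub_one h1'.ne', div_eq_inv_mul]
    have h6 : ‖z - p‖ ^ (1 - α) ≤ ‖z - p‖ ^ |1 - α| :=
      Real.rpow_le_rpow_of_exponent_le h1 (le_abs_self _)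
    rw [e, inv_mul_le_iff₀ (by positivity)] at h5
    have h7 := abs_nonneg C₀
    have h8 := abs_nonneg M
    nlinarith [mul_le_mul_of_nonneg_right h6 h7]

/-- Watson's lemma along left rays with base points that approach `p`. -/
lemma tendsto_scaled_left_integral {f G : ℂ → ℂ} {p x₀ α a C N : ℝ} (hx₀ : 0 < x₀) (ha : 0 ≤ a)
    (haα : 0 < a ∨ 0 < α) (hN : 0 ≤ N)
    (hf : ∀ z ∈ leftSweep p x₀, z ≠ p →
      f z = (z - p)⁻¹ * Complex.exp (α * Complex.log (-Complex.I * (z - p))) * G z)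
    (hG : ContinuousOn G (leftSweep p x₀))
    (hb : ∀ z ∈ leftSweep p x₀, ‖G z‖ ≤ C * (1 + ‖z - p‖ ^ N)) :
    Tendsto (fun L : ℝ => ((Real.exp (-(L * p)) * L ^ α : ℝ) : ℂ) *
      ∫ t in Ioi (0 : ℝ), f ((p + a / L : ℝ) + leftDir * t) *
        Complex.exp (L * ((p + a / L : ℝ) + leftDir * t)) * leftDir) atTop
      (𝓝 (G p * Complex.exp (-(α * ((Real.pi / 2 : ℝ) * Complex.I))) * hankelHalf α a)) := by
  set e₀ := Complex.exp (-(α * ((Real.pi / 2 : ℝ) * Complex.I)))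
  have hmem : ∀ᶠ L : ℝ in atTop, 1 ≤ L ∧ ∀ t : ℝ, 0 ≤ t →
      (p : ℂ) + (L⁻¹ : ℝ) * (a + leftDir * t) ∈ leftSweep p x₀ := by
    filter_upwards [eventually_ge_atTop 1, eventually_ge_atTop (a / x₀)] with L h1 h2
    refine ⟨h1, fun t ht => ?_⟩
    have hL : 0 < L := by linarith
    have := mem_leftSweep (p := p) (x₀ := x₀) (x := L⁻¹ * a) (t := L⁻¹ * t) (by positivity) (by
      rw [div_le_iff₀ hx₀] at h2
      rw [inv_mul_le_iff₀ hL]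
      linarith) (by positivity)
    convert this using 2
    push_cast
    ring
  -- This is the integral after the substitution z = p + ζ / L with ζ = a + leftDir t: the singular
  -- factors become Hankel's integrand, and `G` is frozen at `p` in the limit.
  have key : Tendsto (fun L : ℝ => ∫ t in Ioi (0 : ℝ), G (p + (L⁻¹ : ℝ) * (a + leftDir * t)) *
      (e₀ * (hankelFun α (a + leftDir * t) * leftDir))) atTop
      (𝓝 (∫ t in Ioi (0 : ℝ), G p * (e₀ * (hankelFun α (a + leftDir * t) * leftDir)))) := by
    refine tendsto_integral_filter_of_dominated_convergence
      (fun t => C * ‖e₀‖ * (‖leftDir‖ * Real.exp a) *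
        (‖(a : ℂ) + leftDir * t‖ ^ (α - 1) * Real.exp (-t) +
          ‖(a : ℂ) + leftDir * t‖ ^ (α + N - 1) * Real.exp (-t))) ?_ ?_ ?_ ?_
    · filter_upwards [hmem] with L hL
      refine ContinuousOn.aestronglyMeasurable (ContinuousOn.mul ?_
        (continuousOn_const.mul (continuousOn_hankelFun_left α a))) measurableSet_Ioi
      exact hG.comp (by fun_prop) fun t ht => hL.2 t (le_of_lt ht)
    · filter_upwards [hmem] with L hL
      filter_upwards [ae_restrict_mem measurableSet_Ioi] with t ht
      replace ht : 0 < t := ht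
      have hL0 : 0 < L := by linarith [hL.1]
      have hpos : 0 < ‖(a : ℂ) + leftDir * t‖ := ht.trans_le (norm_left_ge ha ht.le).2.1
      have hCpos : 0 ≤ C := by
        have := (norm_nonneg _).trans (hb _ (hL.2 t ht.le))
        exact nonneg_of_mul_nonneg_left this (by positivity)
      have h1 := hb _ (hL.2 t ht.le)
      have h2 : ‖(p : ℂ) + (L⁻¹ : ℝ) * (a + leftDir * t) - p‖ ^ N ≤ ‖(a : ℂ) + leftDir * t‖ ^ N := by
        refine Real.rpow_le_rpow (norm_nonneg _) ?_ hN
        rw [add_sub_cancel_left, norm_mul, Complex.norm_real, Real.norm_of_nonneg (by positivity)]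
        have : L⁻¹ ≤ 1 := inv_le_one_of_one_le₀ hL.1
        nlinarith
      rw [norm_mul, norm_mul, norm_hankelFun_left α ht,
        show α + N - 1 = (α - 1) + N by ring, Real.rpow_add hpos]
      calc _ ≤ (C * (1 + ‖(a : ℂ) + leftDir * t‖ ^ N)) * (‖e₀‖ * (‖leftDir‖ * Real.exp a *
            (‖(a : ℂ) + leftDir * t‖ ^ (α - 1) * Real.exp (-t)))) := by
            refine mul_le_mul_of_nonneg_right (h1.trans ?_) (by positivity)
            gcongr
        _ = _ := by ring
    · exact ((integrableOn_norm_left ha haα).add (integrableOn_norm_left ha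
        (haα.imp_right fun h => by linarith))).const_mul _
    · filter_upwards [ae_restrict_mem measurableSet_Ioi] with t ht
      refine Tendsto.mul_const _ ?_
      have hp : (p : ℂ) ∈ leftSweep p x₀ := by
        simpa using mem_leftSweep (p := p) (x₀ := x₀) le_rfl hx₀.le le_rfl
      refine (hG p hp).tendsto.comp (tendsto_nhdsWithin_iff.2 ⟨?_, ?_⟩)
      · have h1 : Tendsto (fun L : ℝ => ((L⁻¹ : ℝ) : ℂ)) atTop (𝓝 ((0 : ℝ) : ℂ)) :=
          (Complex.continuous_ofReal.tendsto _).comp tendsto_inv_atTop_zero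
        simpa using (h1.mul_const ((a : ℂ) + leftDir * t)).const_add (p : ℂ)
      · filter_upwards [hmem] with L hL
        exact hL.2 t (le_of_lt ht)
  rw [integral_const_mul, integral_const_mul, ← mul_assoc] at key
  refine key.congr' ?_
  filter_upwards [hmem] with L hL
  have hL0 : 0 < L := by linarith [hL.1]
  have hLc : (L : ℂ) ≠ 0 := by exact_mod_cast hL0.ne'
  have hsub := integral_comp_mul_left_Ioi (fun t : ℝ => f ((p + a / L : ℝ) + leftDir * t) *
        Complex.exp (L * ((p + a / L : ℝ) + leftDir * t)) * leftDir) 0 (inv_pos.2 hL0)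
  rw [mul_zero, inv_inv] at hsub
  -- The Jacobian 1 / L of the substitution is to be cancelled by the L that comes out of (z - p)⁻¹.
  have hsub' : ∀ I : ℂ, ((Real.exp (-(L * p)) * L ^ α : ℝ) : ℂ) * I =
      ((Real.exp (-(L * p)) * L ^ α * L⁻¹ : ℝ) : ℂ) * (L • I) := by
    intro I
    rw [Complex.real_smul]
    push_cast
    field_simp
  rw [hsub', ← hsub, ← integral_const_mul]
  refine setIntegral_congr_fun measurableSet_Ioi fun t ht => ?_
  replace ht : 0 < t := ht
  set ζ : ℂ := a + leftDir * t
  have hζ : ζ ≠ 0 := norm_pos_iff.1 (ht.trans_le (norm_left_ge ha ht.le).2.1)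
  have him : 0 ≤ ζ.im := by rw [(leftDir_re_im a t).2]; exact ht.le
  have hz : ((p + a / L : ℝ) : ℂ) + leftDir * ((L⁻¹ * t : ℝ) : ℂ) = p + (L⁻¹ : ℝ) * ζ := by
    simp only [ζ]
    push_cast
    field_simp
    ring
  have hne : (p : ℂ) + (L⁻¹ : ℝ) * ζ ≠ p := by
    rw [ne_eq, add_eq_left, mul_eq_zero, not_or]
    exact ⟨by exact_mod_cast (inv_pos.2 hL0).ne', hζ⟩
  have hlog : Complex.log (-Complex.I * (p + (L⁻¹ : ℝ) * ζ - p)) =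
      Complex.log ζ - (Real.pi / 2 : ℝ) * Complex.I - Real.log L := by
    rw [add_sub_cancel_left, ← log_neg_I_mul hζ him, mul_left_comm, mul_comm,
      Complex.log_mul_ofReal _ (inv_pos.2 hL0) _ (mul_ne_zero (by simp) hζ), Real.log_inv]
    push_cast
    ring
  have hexp : Complex.exp (L * (p + (L⁻¹ : ℝ) * ζ)) = Complex.exp (L * p) * Complex.exp ζ := by
    rw [← Complex.exp_add]
    congr 1
    push_cast
    field_simp
  have hsweep : (p : ℂ) + (L⁻¹ : ℝ) * ζ ∈ leftSweep p x₀ := hL.2 t ht.le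
  simp only [hz]
  rw [hf _ hsweep hne, hlog, hexp, hankelFun, Real.rpow_def_of_pos hL0]
  have e1 : Complex.exp (α * (Complex.log ζ - (Real.pi / 2 : ℝ) * Complex.I - Real.log L)) =
      Complex.exp (α * Complex.log ζ) * e₀ * (Complex.exp (Real.log L * α))⁻¹ := by
    rw [← Complex.exp_neg, ← Complex.exp_add, ← Complex.exp_add]
    congr 1
    ring
  rw [e1, add_sub_cancel_left]
  clear_value ζ
  push_cast
  rw [Complex.exp_neg]
  have h1 := Complex.exp_ne_zero (L * p)
  have h2 := Complex.exp_ne_zero (Complex.log L * α)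
  field_simp

namespace KernelData

variable {ι : Type*} [Fintype ι] (K : KernelData ι)

/-- The factor of the kernel that belongs to one singular point. -/
def fac : Option ι → ℂ → ℂ := fun o z =>
  o.elim z⁻¹ fun m => Complex.exp (K.ex m * Complex.log (-Complex.I * (z - K.pt m)))

open Classical in
/-- The product of the factors of the kernel that belong to the other points. -/
def rest (o : Option ι) (z : ℂ) : ℂ := ∏ o' ∈ Finset.univ.erase o, K.fac o' z

/-- The exponent by which the kernel divided by `z - pt m` differs from a simple pole. -/
def scaleExp : Option ι → ℝ := fun o => o.elim 0 K.ex

open Classical in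
/-- The regular factor at `point o` of `(z - pt m)⁻¹`. -/
def quo (o : Option ι) (m : ι) (z : ℂ) : ℂ :=
  if o = some m then 1 else (if o = none then 1 else z - K.point o) * (z - K.pt m)⁻¹

lemma kern_eq_prod (z : ℂ) : K.kern z = ∏ o, K.fac o z := by
  rw [Fintype.prod_option]; rfl

lemma fac_mul_rest (o : Option ι) (z : ℂ) : K.fac o z * K.rest o z = K.kern z := by
  classical
  rw [kern_eq_prod, rest]
  convert Finset.mul_prod_erase Finset.univ (fun o => K.fac o z) (Finset.mem_univ o)

lemma rest_none (z : ℂ) : K.rest none z = K.kernReg z := by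
  classical
  have h : (Finset.univ.erase none : Finset (Option ι)) = Finset.univ.map Function.Embedding.some := by
    ext o
    cases o <;> simp
  rw [rest, kernReg]
  convert Finset.prod_map Finset.univ Function.Embedding.some (fun o => K.fac o z)
  rfl

/-- A common normal form: simple pole, times a power, times a regular factor. If `o` is a nonzero
point other than `pt m`, the artificial simple pole is compensated by a zero of `quo` at `point o`.
This is why the contour of μ_j contributes at leading order to the j-th equation only. -/
lemma fac_mul_inv (o : Option ι) (m : ι) {z : ℂ} (hz : z ≠ K.point o) :
    K.fac o z * (z - K.pt m)⁻¹ = (z - K.point o)⁻¹ *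
      Complex.exp (K.scaleExp o * Complex.log (-Complex.I * (z - K.point o))) * K.quo o m z := by
  have hz' := sub_ne_zero.2 hz
  rcases o with _ | m'
  · simp [fac, scaleExp, quo]
  · by_cases h : m' = m
    · subst h
      simp [fac, scaleExp, quo, mul_comm]
    · simp only [point_some] at hz'
      simp [fac, scaleExp, quo, h]
      field_simp

lemma rest_ne_zero (o : Option ι) : K.rest o (K.point o) ≠ 0 := by
  classical
  refine Finset.prod_ne_zero_iff.2 fun o' ho' => ?_
  rcases o' with _ | m
  · have h : o ≠ none := (Finset.ne_of_mem_erase ho').symm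
    simpa [fac] using fun h' => h (K.point_injective (by simpa using h'))
  · exact Complex.exp_ne_zero _

/-- No singular points in `(point o, point o + x₀]`. -/
def Clear (o : Option ι) (x₀ : ℝ) : Prop := ∀ o', o' ≠ o → K.point o' ∉ Icc (K.point o) (K.point o + x₀)

variable {K}

lemma Clear.of_isFree {o : Option ι} {y x₀ : ℝ} (h : K.IsFree (Ioo (K.point o) y))
    (hx : K.point o + x₀ < y) : K.Clear o x₀ := by
  rintro o' ho' ⟨h1, h2⟩
  refine h (K.point o') ⟨lt_of_le_of_ne h1 fun h' => ho' (K.point_injective h'.symm), by linarith⟩ o' rfl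

/-- The sweep touches the real axis only in `[point o, point o + x₀]`, so it avoids the cuts that
hang down from the other points. -/
lemma Clear.ne {o o' : Option ι} {x₀ : ℝ} (h : K.Clear o x₀) (ho : o' ≠ o) {z : ℂ}
    (hz : z ∈ leftSweep (K.point o) x₀) : 0 < z.im ∨ z.re ≠ K.point o' := by
  obtain ⟨h1, h2, h3⟩ := hz
  rcases h1.eq_or_lt with h0 | h0
  · right
    intro h'
    rw [← h0, h', add_zero] at h2 h3
    exact h o' ho ⟨h2, h3⟩
  · exact Or.inl h0

lemma Clear.sub_ne {o o' : Option ι} {x₀ : ℝ} (h : K.Clear o x₀) (ho : o' ≠ o) {z : ℂ}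
    (hz : z ∈ leftSweep (K.point o) x₀) : z - K.point o' ≠ 0 := by
  intro h'
  rw [sub_eq_zero] at h'
  rcases h.ne ho hz with h1 | h1
  · simp [h'] at h1
  · simp [h'] at h1

lemma Clear.mem_cutDomain {o : Option ι} {x₀ : ℝ} (h : K.Clear o x₀) {z : ℂ}
    (hz : z ∈ leftSweep (K.point o) x₀) (hne : z ≠ K.point o) : z ∈ K.cutDomain := by
  refine mem_cutDomain_of_regular (fun o' => ?_) hz.1
  by_cases ho : o' = o
  · rwa [ho]
  · exact sub_ne_zero.1 (h.sub_ne ho hz)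

lemma Clear.continuousOn_rest {o : Option ι} {x₀ : ℝ} (h : K.Clear o x₀) :
    ContinuousOn (K.rest o) (leftSweep (K.point o) x₀) := by
  classical
  refine continuousOn_finsetProd _ fun o' ho' => ?_
  replace ho' := Finset.ne_of_mem_erase ho'
  rcases o' with _ | m
  · refine ContinuousOn.inv₀ continuousOn_id fun z hz => ?_
    simpa using h.sub_ne ho' hz
  · refine (ContinuousOn.const_mul (ContinuousOn.clog (by fun_prop) fun z hz => ?_) _).cexp
    rw [Complex.mem_slitPlane_iff]
    rcases h.ne ho' hz with h1 | h1
    · left; simpa using h1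
    · right; simpa [sub_eq_zero] using fun h' => h1 h'.symm

lemma Clear.continuousOn_quo {o : Option ι} {x₀ : ℝ} (h : K.Clear o x₀) (m : ι) :
    ContinuousOn (K.quo o m) (leftSweep (K.point o) x₀) := by
  classical
  by_cases ho : o = some m
  · exact (continuousOn_const (c := (1 : ℂ))).congr fun z _ => by simp [quo, ho]
  · refine ContinuousOn.congr
      (f := fun z : ℂ => (if o = none then 1 else z - K.point o) * (z - K.pt m)⁻¹) ?_
      fun z _ => by simp [quo, ho]
    refine ContinuousOn.mul (by split_ifs <;> fun_prop) (ContinuousOn.inv₀ (by fun_prop) fun z hz => ?_)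
    exact h.sub_ne (o' := some m) (fun h => ho h.symm) hz

lemma form_inv_eq {o : Option ι} (m : ι) {z : ℂ} (hne : z ≠ K.point o) :
    K.form (fun z => 1 / (z - K.pt m)) z = (z - K.point o)⁻¹ *
      Complex.exp (K.scaleExp o * Complex.log (-Complex.I * (z - K.point o))) *
        (K.rest o z * K.quo o m z) := by
  rw [form, one_div, ← K.fac_mul_rest o z, mul_right_comm, K.fac_mul_inv o m hne]
  ring

/-- The asymptotics of tilted integrals along left rays near a singular point. -/
lemma Clear.tendsto_scaled {o : Option ι} {x₀ a : ℝ} (h : K.Clear o x₀) (hx₀ : 0 < x₀) (ha : 0 ≤ a)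
    (haα : 0 < a ∨ 0 < K.scaleExp o) (m : ι) :
    Tendsto (fun L : ℝ => ((Real.exp (-(L * K.point o)) * L ^ K.scaleExp o : ℝ) : ℂ) *
      ∫ t in Ioi (0 : ℝ), K.form (fun z => 1 / (z - K.pt m)) ((K.point o + a / L : ℝ) + leftDir * t) *
        Complex.exp (L * ((K.point o + a / L : ℝ) + leftDir * t)) * leftDir) atTop
      (𝓝 (K.rest o (K.point o) * K.quo o m (K.point o) *
        Complex.exp (-(K.scaleExp o * ((Real.pi / 2 : ℝ) * Complex.I))) *
          hankelHalf (K.scaleExp o) a)) := by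
  have hG : ContinuousOn (fun z => K.rest o z * K.quo o m z) (leftSweep (K.point o) x₀) :=
    h.continuousOn_rest.mul (h.continuousOn_quo m)
  obtain ⟨C₀, ρ, -, hρ, hb⟩ := (poleFactor_inv (K := K) m 1).upDecay.bound
  obtain ⟨C, -, hC⟩ := exists_factor_bound (f := K.form fun z => 1 / (z - K.pt m))
    (G := fun z => K.rest o z * K.quo o m z) (C₀ := C₀)
    (ρ := ρ + |K.point o| + 1)
    (fun z _ hne => form_inv_eq m hne) hG fun z hz hn => by
      refine hb z (h.mem_cutDomain hz ?_) (by linarith [abs_nonneg (K.point o)])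
      rintro rfl
      rw [Complex.norm_real, Real.norm_eq_abs] at hn
      linarith
  exact tendsto_scaled_left_integral (f := K.form fun z => 1 / (z - K.pt m))
    (G := fun z => K.rest o z * K.quo o m z) hx₀ ha haα (abs_nonneg _)
    (fun z _ hne => form_inv_eq m hne) hG hC

end KernelData

end

/-! ### Exponentially tilted contour integrals -/

noncomputable section

open MeasureTheory Set ComplexConjugate

namespace KernelData

variable {ι : Type*} [Fintype ι] (K : KernelData ι)

/-- Schwarz reflection: points and exponents are real, and the principal logarithm commutes with
conjugation off its cut. The sign is that of (-conj z)⁻¹. -/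
lemma neg_kern_neg_conj {z : ℂ} (hz : z ∈ K.cutDomain) :
    K.neg.kern (-conj z) = -conj (K.kern z) := by
  have h : ∀ m, Complex.exp (K.neg.ex m * Complex.log (-Complex.I * (-conj z - K.neg.pt m))) =
      conj (Complex.exp (K.ex m * Complex.log (-Complex.I * (z - K.pt m)))) := by
    intro m
    have h1 := Complex.slitPlane_arg_ne_pi (K.mem_slitPlane (K.cutDomain_subset_cutReg hz) m)
    rw [← Complex.exp_conj, map_mul, Complex.conj_ofReal, ← Complex.log_conj _ h1]
    simp only [neg_ex, neg_pt, map_mul, map_sub, map_neg, Complex.conj_I, Complex.conj_ofReal,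
      Complex.ofReal_neg]
    congr 3
    ring
  rw [kern, kern, kernReg, kernReg, map_mul, map_prod, Finset.prod_congr rfl fun m _ => h m,
    inv_neg, map_inv₀]
  ring

/-- Reflection of the primitive for factors that commute with conjugation. -/
lemma upPrim_neg_form {R : ℂ → ℂ} (hR : ∀ z, R (conj z) = conj (R z)) (x : ℝ) :
    upPrim (K.neg.form fun z => R (-z)) (-x) = conj (upPrim (K.form R) x) := by
  rw [upPrim, upPrim, map_neg, ← integral_conj]
  congr 1
  refine setIntegral_congr_fun measurableSet_Ioi fun t ht => ?_
  replace ht : 0 < t := ht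
  have e : -(x : ℂ) + Complex.I * t = -conj ((x : ℂ) + Complex.I * t) := by
    simp
    ring
  have hz : (x : ℂ) + Complex.I * t ∈ K.cutDomain := Or.inl (by simpa using ht)
  simp only [form]
  rw [e, K.neg_kern_neg_conj hz, neg_neg, hR, map_mul, map_mul, Complex.conj_I]
  ring

/-- The exponentially tilted simple pole `e ^ (L z) / (z - pt m)`. -/
def tilt (m : ι) (L : ℝ) (z : ℂ) : ℂ := 1 / (z - K.pt m) * Complex.exp (L * z)

lemma tilt_conj (m : ι) (L : ℝ) (z : ℂ) : K.tilt m L (conj z) = conj (K.tilt m L z) := by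
  simp [tilt, ← Complex.exp_conj]

lemma form_tilt (m : ι) (L : ℝ) (z : ℂ) :
    K.form (K.tilt m L) z = K.form (fun z => 1 / (z - K.pt m)) z * Complex.exp (L * z) := by
  simp only [form, tilt]
  ring

lemma differentiableOn_tilt (m : ι) (L : ℝ) : DifferentiableOn ℂ (K.tilt m L) K.regular := by
  refine DifferentiableOn.mul ?_ (by fun_prop)
  exact (poleFactor_inv (K := K) m 1).differentiableOn

lemma exists_tilt_bound (m : ι) {L : ℝ} (hL : 0 ≤ L) (B : ℝ) :
    ∃ C ρ : ℝ, ∀ z : ℂ, z.re < B → ρ ≤ ‖z‖ → ‖K.tilt m L z‖ ≤ C / ‖z‖ := by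
  obtain ⟨C, ρ, hb⟩ := (poleFactor_inv (K := K) m 1).infty
  refine ⟨C * Real.exp (L * B), ρ, fun z hz hn => ?_⟩
  have h1 := hb z hn
  have h2 : Real.exp (L * z.re) ≤ Real.exp (L * B) :=
    Real.exp_le_exp.2 (mul_le_mul_of_nonneg_left hz.le hL)
  rw [tilt, norm_mul, Complex.norm_exp, Complex.re_ofReal_mul]
  calc _ ≤ C / ‖z‖ * Real.exp (L * B) :=
        mul_le_mul h1 h2 (Real.exp_pos _).le ((norm_nonneg _).trans h1)
    _ = _ := by ring

lemma upDecay_tilt (m : ι) {L : ℝ} (hL : 0 ≤ L) (B : ℝ) :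
    UpDecay (K.cutDomain ∩ Complex.re ⁻¹' Iio B) (K.form (K.tilt m L)) := by
  obtain ⟨C, ρ, hb⟩ := K.exists_tilt_bound m hL B
  exact K.upDecay isOpen_Iio (K.differentiableOn_tilt m L) ⟨C, ρ, fun z hz hn => hb z hz hn⟩

lemma upDecay_neg_tilt (m : ι) {L : ℝ} (hL : 0 ≤ L) (B : ℝ) :
    UpDecay (K.neg.cutDomain ∩ Complex.re ⁻¹' Ioi (-B)) (K.neg.form fun z => K.tilt m L (-z)) := by
  obtain ⟨C, ρ, hb⟩ := K.exists_tilt_bound m hL B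
  refine K.neg.upDecay (R := fun z => K.tilt m L (-z)) isOpen_Ioi ?_ ⟨C, ρ, fun z hz hn => ?_⟩
  · exact (K.differentiableOn_tilt m L).comp (differentiableOn_neg _)
      fun z hz => K.mem_neg_regular.1 hz
  · have h1 : (-z).re < B := by
      rw [Complex.neg_re]
      exact neg_lt.1 hz
    simpa using hb (-z) h1 (by simpa using hn)

lemma leftDir_im : 0 < leftDir.im := by simp [leftDir]

variable {K}

/-- Tilted wedge integrals reduce to one half of the wedge with the apex moved along the strip. -/
lemma OnWedge.wedgeIntegral_tilt {ψ : ℂ → ℂ} {b y : ℝ} {c c' : ℂ} {o : Option ι}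
    (h : K.OnWedge ψ b (1 + Complex.I) leftDir c c') (hfree : K.IsFree (Ioo (K.point o) y))
    (hb : b ∈ Ioo (K.point o) y) (m : ι) {L : ℝ} (hL : 0 ≤ L) {x : ℝ} (hx : x ∈ Ioo (K.point o) y) :
    wedgeIntegral b (1 + Complex.I) leftDir (fun z => ψ z * K.tilt m L z) =
      c * (∫ t in Ioi (0 : ℝ), K.form (K.tilt m L) (x + leftDir * t) * leftDir) +
      c' * conj (∫ t in Ioi (0 : ℝ), K.form (K.tilt m L) (x + leftDir * t) * leftDir) := by
  have hE := K.upDecay_tilt m hL y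
  have hE' := K.upDecay_neg_tilt m hL y
  have hmem : ∀ u ∈ Ioo (K.point o) y, ∀ t : ℝ, 0 ≤ t →
      (u : ℂ) + leftDir * t ∈ K.cutDomain ∩ Complex.re ⁻¹' Iio y := by
    intro u hu t ht
    refine ⟨add_mul_mem_cutDomain (hfree.mem_cutDomain (by simpa using hu)) (by simp) leftDir_im ht, ?_⟩
    rw [mem_preimage, (leftDir_re_im u t).1, mem_Iio]
    linarith [hu.2]
  have hmem' : ∀ t : ℝ, 0 ≤ t →
      -(b : ℂ) + (1 + Complex.I) * t ∈ K.neg.cutDomain ∩ Complex.re ⁻¹' Ioi (-y) := by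
    intro t ht
    refine ⟨add_mul_mem_cutDomain (hfree.neg_mem_cutDomain (by simpa using hb)) (by simp)
      (by simp) ht, ?_⟩
    simp
    linarith [hb.2]
  rw [h.wedgeIntegral_eq_upPrim hE hE' (hmem b hb) hmem']
  obtain ⟨e, he0, he⟩ := hfree.exists_kern_eq (convex_Ioo _ _)
  have hbk := h.kern_base
  have hk : K.neg.kern (-b) ≠ 0 := K.neg.kern_ne_zero (neg_ne_zero.2
    (hfree.ne_zero (z := b) (by simpa using hb)))
  have hc' : c' = c * e := by
    rw [he b (by simpa using hb), ← mul_assoc] at hbk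
    exact (mul_right_cancel₀ hk hbk).symm
  -- The base point is moved from `b` to `x`; reflection then expresses the lower half through the
  -- conjugate of the upper one.
  rw [upPrim_combination_eq hE hE' isOpen_Ioo (convex_Ioo (K.point o) y)
    (fun z hz => ⟨hfree.mem_cutDomain hz, hz.2⟩)
    (fun z hz => ⟨hfree.neg_mem_cutDomain hz, by simpa using hz.2⟩)
    (fun z hz => by rw [he z hz, hc', mul_assoc]) (z := b) (z₀ := x) (by simpa using hb)
    (by simpa using hx), K.upPrim_neg_form (K.tilt_conj m L),
    hE.integral_ray_of_mem (by simp) leftDir_im (hmem x hx), map_neg]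
  ring

lemma fac_eq (o : Option ι) (z : ℂ) : K.fac o z = (if o = none then (z - K.point o)⁻¹ else 1) *
    Complex.exp (K.scaleExp o * Complex.log (-Complex.I * (z - K.point o))) := by
  cases o <;> simp [fac, scaleExp]

lemma quo_conj (o : Option ι) (m : ι) : conj (K.quo o m (K.point o)) = K.quo o m (K.point o) := by
  simp only [quo]
  split_ifs <;> simp

lemma IsFree.exists_add_lt {o : Option ι} {y : ℝ} (hy : K.point o < y) :
    ∃ x₀, 0 < x₀ ∧ K.point o + x₀ < y := ⟨(y - K.point o) / 2, by linarith, by linarith⟩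

/-- The phase of the kernel at a singular point. -/
def phase (K : KernelData ι) (o : Option ι) : ℂ :=
  K.rest o (K.point o) * Complex.exp (-(K.scaleExp o * ((Real.pi / 2 : ℝ) * Complex.I)))

lemma phase_ne_zero (o : Option ι) : K.phase o ≠ 0 :=
  mul_ne_zero (K.rest_ne_zero o) (Complex.exp_ne_zero _)

/-- On the real interval next to `point o` the kernel is a real multiple of `rest * ε`, and the
reflected kernel is minus its conjugate. Matching the branches and letting x → `point o` yields the
relation. It makes the two halves of a tilted wedge combine to a multiple of H - conj H. -/
lemma OnWedge.mul_phase {ψ : ℂ → ℂ} {b y : ℝ} {v w c c' : ℂ} {o : Option ι}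
    (h : K.OnWedge ψ b v w c c') (hfree : K.IsFree (Ioo (K.point o) y))
    (hb : b ∈ Ioo (K.point o) y) : c' * conj (K.phase o) = -(c * K.phase o) := by
  obtain ⟨e, he0, he⟩ := hfree.exists_kern_eq (convex_Ioo _ _)
  have hbk := h.kern_base
  have hk : K.neg.kern (-b) ≠ 0 := K.neg.kern_ne_zero (neg_ne_zero.2
    (hfree.ne_zero (z := b) (by simpa using hb)))
  have hc' : c' = c * e := by
    rw [he b (by simpa using hb), ← mul_assoc] at hbk
    exact (mul_right_cancel₀ hk hbk).symm
  obtain ⟨x₀, hx₀, hxy⟩ := IsFree.exists_add_lt (hb.1.trans hb.2)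
  have hclear : K.Clear o x₀ := Clear.of_isFree hfree hxy
  set ε := Complex.exp (-(K.scaleExp o * ((Real.pi / 2 : ℝ) * Complex.I)))
  have hε : ∀ x : ℝ, 0 < x → Complex.exp (K.scaleExp o * Complex.log (-Complex.I * x)) =
      ((x ^ K.scaleExp o : ℝ) : ℂ) * ε := by
    intro x hx
    rw [log_neg_I_mul (by exact_mod_cast hx.ne') (by simp), Real.rpow_def_of_pos hx,
      ← Complex.ofReal_log hx.le]
    push_cast
    rw [← Complex.exp_add]
    congr 1
    push_cast
    ring
  have hmem : ∀ x ∈ Ioo (K.point o) (K.point o + x₀), (x : ℂ) ∈ leftSweep (K.point o) x₀ := by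
    rintro x ⟨hx1, hx2⟩
    simp only [leftSweep, mem_ofPred_eq, Complex.ofReal_re, Complex.ofReal_im, add_zero]
    exact ⟨le_rfl, hx1.le, hx2.le⟩
  have hreal : ∀ x ∈ Ioo (K.point o) (K.point o + x₀),
      c' * conj (K.rest o x * ε) = -(c * (K.rest o x * ε)) := by
    intro x hx
    have hxy : x ∈ Ioo (K.point o) y := ⟨hx.1, by linarith [hx.2]⟩
    have hx3 : 0 < x - K.point o := by linarith [hx.1]
    obtain ⟨ρ, hρ, hk⟩ : ∃ ρ : ℝ, ρ ≠ 0 ∧ K.kern x = ρ * (K.rest o x * ε) := by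
      refine ⟨(if o = none then (x - K.point o)⁻¹ else 1) * (x - K.point o) ^ K.scaleExp o, ?_, ?_⟩
      · refine mul_ne_zero ?_ (Real.rpow_pos_of_pos hx3 _).ne'
        split_ifs
        · exact inv_ne_zero hx3.ne'
        · exact one_ne_zero
      · rw [← K.fac_mul_rest o, fac_eq, ← Complex.ofReal_sub, hε _ hx3]
        push_cast
        split_ifs <;> push_cast <;> ring
    have hcut : (x : ℂ) ∈ K.cutDomain := hfree.mem_cutDomain (by simpa using hxy)
    have h1 := he x (by simpa using hxy)
    have h2 := K.neg_kern_neg_conj hcut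
    rw [Complex.conj_ofReal] at h2
    rw [h2, hk, map_mul, Complex.conj_ofReal] at h1
    have hρ' : (ρ : ℂ) ≠ 0 := by exact_mod_cast hρ
    rw [hc']
    refine mul_left_cancel₀ hρ' ?_
    linear_combination c * h1
  have hlim : Tendsto (fun x : ℝ => K.rest o x * ε) (𝓝[>] (K.point o)) (𝓝 (K.phase o)) := by
    refine Tendsto.mul_const _ ?_
    have hp : (K.point o : ℂ) ∈ leftSweep (K.point o) x₀ := by
      simp only [leftSweep, mem_ofPred_eq, Complex.ofReal_re, Complex.ofReal_im, add_zero]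
      exact ⟨le_rfl, le_rfl, by linarith⟩
    refine (hclear.continuousOn_rest _ hp).tendsto.comp (tendsto_nhdsWithin_iff.2 ⟨?_, ?_⟩)
    · exact (Complex.continuous_ofReal.tendsto _).mono_left nhdsWithin_le_nhds
    · filter_upwards [Ioo_mem_nhdsGT (show K.point o < K.point o + x₀ by linarith)] with x hx
      exact hmem x hx
  refine tendsto_nhds_unique (((Complex.continuous_conj.tendsto _).comp hlim).const_mul c')
    ((hlim.const_mul c).neg.congr' ?_)
  filter_upwards [Ioo_mem_nhdsGT (show K.point o < K.point o + x₀ by linarith)] with x hx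
  exact (hreal x hx).symm

/-- The scale of the tilted integrals at a singular point. -/
def scale (K : KernelData ι) (o : Option ι) (L : ℝ) : ℝ :=
  Real.exp (-(L * K.point o)) * L ^ K.scaleExp o

lemma scale_pos (o : Option ι) {L : ℝ} (hL : 0 < L) : 0 < K.scale o L := by
  unfold scale
  positivity

/-- Asymptotics of the tilted integrals over a wedge. -/
lemma OnWedge.tendsto_tilt {ψ : ℂ → ℂ} {b y a : ℝ} {c c' : ℂ} {o : Option ι}
    (h : K.OnWedge ψ b (1 + Complex.I) leftDir c c') (hfree : K.IsFree (Ioo (K.point o) y))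
    (hb : b ∈ Ioo (K.point o) y) (ha : 0 < a) (m : ι) :
    Tendsto (fun L : ℝ => (K.scale o L : ℂ) *
      wedgeIntegral b (1 + Complex.I) leftDir (fun z => ψ z * K.tilt m L z)) atTop
      (𝓝 (c * K.phase o * (hankelHalf (K.scaleExp o) a - conj (hankelHalf (K.scaleExp o) a)) *
        K.quo o m (K.point o))) := by
  obtain ⟨x₀, hx₀, hxy⟩ := IsFree.exists_add_lt (hb.1.trans hb.2)
  have hlim := (Clear.of_isFree hfree hxy).tendsto_scaled hx₀ ha.le (Or.inl ha) m
  have hlim' := (hlim.const_mul c).add (((Complex.continuous_conj.tendsto _).comp hlim).const_mul c')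
  have hph := h.mul_phase hfree hb
  have hval : ∀ H : ℂ, c * (K.rest o (K.point o) * K.quo o m (K.point o) *
      Complex.exp (-(K.scaleExp o * ((Real.pi / 2 : ℝ) * Complex.I))) * H) +
      c' * conj (K.rest o (K.point o) * K.quo o m (K.point o) *
        Complex.exp (-(K.scaleExp o * ((Real.pi / 2 : ℝ) * Complex.I))) * H) =
      c * K.phase o * (H - conj H) * K.quo o m (K.point o) := by
    intro H
    rw [show K.rest o (K.point o) * K.quo o m (K.point o) *
        Complex.exp (-(K.scaleExp o * ((Real.pi / 2 : ℝ) * Complex.I))) * H =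
        K.phase o * K.quo o m (K.point o) * H by rw [phase]; ring,
      map_mul, map_mul, quo_conj]
    linear_combination K.quo o m (K.point o) * conj H * hph
  rw [hval] at hlim'
  refine hlim'.congr' ?_
  filter_upwards [eventually_gt_atTop 0, eventually_gt_atTop (a / x₀)] with L hL hL'
  -- The apex follows the scale 1 / L of Watson's lemma, and is within the free interval once a / L
  -- < x₀.
  have hx : K.point o + a / L ∈ Ioo (K.point o) y := by
    rw [div_lt_iff₀ hx₀] at hL'
    have h1 : a / L < x₀ := by rw [div_lt_iff₀ hL]; linarith
    have h2 : 0 < a / L := by positivity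
    exact ⟨by linarith, by linarith⟩
  rw [h.wedgeIntegral_tilt hfree hb m hL.le hx]
  simp only [Function.comp, map_mul, Complex.conj_ofReal, form_tilt, scale]
  ring

/-- Asymptotics of the tilted integrals over a ray from a point with a positive exponent. -/
lemma tendsto_tilt_ray {ψ : ℂ → ℂ} {y : ℝ} {c : ℂ} {o : Option ι} (ho : 0 < K.expo o)
    (hψ : ∀ t : ℝ, 0 < t → ψ (K.point o + leftDir * t) = c * K.kern (K.point o + leftDir * t))
    (hfree : K.IsFree (Ioo (K.point o) y)) (hy : K.point o < y) (m : ι) :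
    Tendsto (fun L : ℝ => (K.scale o L : ℂ) *
      rayIntegral (K.point o) leftDir (fun z => ψ z * K.tilt m L z)) atTop
      (𝓝 (c * K.phase o * hankelHalf (K.scaleExp o) 0 * K.quo o m (K.point o))) := by
  obtain ⟨x₀, hx₀, hxy⟩ := IsFree.exists_add_lt hy
  have ho' : 0 < K.scaleExp o := by
    rcases o with _ | m'
    · simp only [expo_none] at ho
      linarith
    · exact ho
  have hlim := ((Clear.of_isFree hfree hxy).tendsto_scaled hx₀ le_rfl (Or.inr ho') m).const_mul c
  rw [show c * (K.rest o (K.point o) * K.quo o m (K.point o) *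
      Complex.exp (-(K.scaleExp o * ((Real.pi / 2 : ℝ) * Complex.I))) * hankelHalf (K.scaleExp o) 0) =
      c * K.phase o * hankelHalf (K.scaleExp o) 0 * K.quo o m (K.point o) by rw [phase]; ring] at hlim
  refine hlim.congr fun L => ?_
  rw [← mul_assoc, mul_comm c, mul_assoc, ← integral_const_mul, scale, rayIntegral]
  congr 1
  refine setIntegral_congr_fun measurableSet_Ioi fun t ht => ?_
  simp only [zero_div, add_zero]
  rw [hψ t ht, ← form_tilt, form]
  ring

lemma tendsto_inv_scale {o : Option ι} (ho : K.point o < 0) :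
    Tendsto (fun L => (K.scale o L)⁻¹) atTop (𝓝 0) := by
  have h := tendsto_rpow_mul_exp_neg_mul_atTop_nhds_zero (-K.scaleExp o) (-K.point o) (by linarith)
  refine h.congr' ?_
  filter_upwards [eventually_gt_atTop 0] with L hL
  rw [scale, mul_inv, ← Real.exp_neg, Real.rpow_neg hL.le, mul_comm]
  congr 2
  ring

lemma tendsto_scale {o : Option ι} (ho : 0 < K.point o) :
    Tendsto (fun L => K.scale o L) atTop (𝓝 0) := by
  have h := tendsto_rpow_mul_exp_neg_mul_atTop_nhds_zero (K.scaleExp o) (K.point o) ho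
  refine h.congr fun L => ?_
  rw [scale, mul_comm]
  congr 2
  ring

lemma sub_conj_hankelHalf_ne {α a : ℝ} (hα : α ≤ 0) (ha : 0 < a) :
    hankelHalf α a - conj (hankelHalf α a) ≠ 0 := by
  rw [Complex.sub_conj]
  have := hankelHalf_im_ne_zero hα ha
  simp [this]

/-- The lower half of the wedge is the mirror image of the upper half, traversed in the opposite
sense. This identifies the integral over Γ̃_a with Hankel's integral of exponent zero. -/
lemma wedgeIntegral_inv_mul_exp (a : ℝ) :
    wedgeIntegral a (1 + Complex.I) leftDir (fun z => z⁻¹ * Complex.exp z) =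
      hankelHalf 0 a - conj (hankelHalf 0 a) := by
  have hz : ∀ t : ℝ, conj ((a : ℂ) + leftDir * t) = -(-(a : ℂ) + (1 + Complex.I) * t) := by
    intro t
    simp [leftDir]
    ring
  rw [wedgeIntegral_eq, add_comm, sub_eq_add_neg]
  congr 1
  · simp [hankelHalf, hankelFun]
  · rw [hankelHalf, ← integral_conj, ← integral_neg]
    refine integral_congr_ae (Eventually.of_forall fun t => ?_)
    simp only [hankelFun, Complex.ofReal_zero, zero_mul, Complex.exp_zero, one_mul, map_mul, map_inv₀,
      ← Complex.exp_conj, hz]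
    rw [show conj leftDir = -(1 + Complex.I) by simp [leftDir]; ring]
    ring

end KernelData

end

/-! ### Asymptotics of the entries N³ -/

noncomputable section

open MeasureTheory Set

namespace JumpModel

variable {r s : ℕ} [NeZero r] {P : JumpModel r s}

/-- The singular point of a left contour. -/
def leftOpt (r s : ℕ) [NeZero r] : Fin s ⊕ Fin r → Option (Fin r ⊕ Fin s) :=
  Sum.elim (fun d => some (Sum.inr d)) fun j =>
    if j = 0 then none
    else some (Sum.inl ⟨j.val - 1, lt_of_le_of_lt (Nat.sub_le _ _) j.isLt⟩)

lemma leftOpt_zero : leftOpt r s (Sum.inr 0) = none := by simp [leftOpt]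

lemma leftOpt_succ {i j : Fin r} (h : j.val + 1 = i.val) :
    leftOpt r s (Sum.inr i) = some (Sum.inl j) := by
  have hi : i ≠ 0 := by rintro rfl; simp at h
  simp only [leftOpt, Sum.elim_inr, if_neg hi, Option.some.injEq, Sum.inl.injEq]
  ext
  simp
  omega

lemma point_leftOpt (j : Fin s ⊕ Fin r) :
    P.kernelData.point (leftOpt r s j) = P.leftPoint j := by
  rcases j with d | i
  · rfl
  · by_cases h : i = 0
    · subst h
      simp [leftOpt_zero, leftPoint, below_zero]
    · obtain ⟨j, hj⟩ := exists_pred h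
      simp [leftOpt_succ hj, leftPoint, P.below_succ hj]

lemma expo_leftOpt (j : Fin s ⊕ Fin r) : P.kernelData.expo (leftOpt r s j) = P.leftExp j := by
  rcases j with d | i
  · rfl
  · by_cases h : i = 0
    · subst h
      simp [leftOpt_zero, leftExp, expBelow_zero]
    · obtain ⟨j, hj⟩ := exists_pred h
      simp [leftOpt_succ hj, leftExp, P.expBelow_succ hj]

lemma isFree_left (j : Fin s ⊕ Fin r) :
    P.kernelData.IsFree (Ioo (P.leftPoint j) (P.leftNext j)) := by
  rcases j with d | i
  · exact P.isFree_aboveNeg d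
  · exact P.isFree_below i

lemma leftExp_ne (j : Fin s ⊕ Fin r) : P.leftExp j ≠ 0 := by
  rw [← expo_leftOpt]
  cases leftOpt r s j with
  | none => simp
  | some m => exact P.kernelData.ex_ne m

lemma scaleExp_nonpos {o : Option (Fin r ⊕ Fin s)} (h : P.kernelData.expo o < 0) :
    P.kernelData.scaleExp o ≤ 0 := by
  rcases o with _ | m
  · exact le_rfl
  · exact h.le

namespace Contours

variable (C : P.Contours)

lemma N3_eq (L : ℝ) (j : Fin s ⊕ Fin r) (k : Fin r) :
    C.N3 (-L) j k = P.leftIntegral j (C.baseL j)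
      (fun z => (C.verL j).psi z * P.kernelData.tilt (Sum.inl k) L z) := by
  rw [N3]
  congr 1
  ext z
  simp only [KernelData.tilt, kernelData_pt, Sum.elim_inl, Complex.ofReal_neg, neg_mul, neg_neg]
  ring

/-- The limit involves ψ_{∖0}(0) for the chosen version, so the constant on the ascending ray has to
be tied to the value at the origin; the segment from 0 to the base point provides the link. -/
lemma exists_onWedge_zero : ∃ c c' : ℂ, P.kernelData.OnWedge (C.verL (Sum.inr 0)).psi
    (C.baseL (Sum.inr 0)) (1 + Complex.I) leftDir c c' ∧
      c * P.kernelData.kernReg 0 = (C.verL (Sum.inr 0)).psiNoZero 0 := by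
  set b := C.baseL (Sum.inr 0) with hbdef
  set V := C.verL (Sum.inr 0)
  have hb : b ∈ Ioo (P.leftPoint (Sum.inr 0)) (P.leftNext (Sum.inr 0)) := C.baseL_mem (Sum.inr 0)
  have hne : ∀ o, b ≠ P.kernelData.point o := isFree_left (Sum.inr 0) b hb
  have hb0 : 0 < b := by simpa [leftPoint, below_zero] using hb.1
  have hset : P.leftSet (Sum.inr 0) b = wedgeSet b (1 + Complex.I) leftDir := by
    rw [leftSet, if_pos (by simp [leftExp, expBelow_zero]), leftDir]
  have hS : wedgeSet b (1 + Complex.I) leftDir ⊆ P.leftRegion (Sum.inr 0) b :=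
    hset ▸ subset_union_left
  -- The segment and the ascending ray form one connected set. It contains the origin, which is
  -- admissible for the kernel without the factor z⁻¹.
  set S' : Set ℂ := ((fun x : ℝ => (x : ℂ)) '' Icc 0 b) ∪ ((fun t : ℝ => (b : ℂ) + leftDir * t) '' Ici 0)
  have hpre : IsPreconnected S' := by
    refine IsPreconnected.union (b : ℂ) ⟨b, ⟨hb0.le, le_rfl⟩, rfl⟩ ⟨0, mem_Ici.2 le_rfl, by simp⟩
      (isPreconnected_Icc.image _ (by fun_prop)) (isPreconnected_Ici.image _ (by fun_prop))
  obtain ⟨c, hc, h⟩ := V.exists_psiNoZero_eq hpre (by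
      rintro _ (⟨x, hx, rfl⟩ | ⟨t, ht, rfl⟩)
      · exact Or.inr ⟨rfl, x, hx.1, hx.2, rfl⟩
      · exact hS (Or.inr ⟨t, ht, rfl⟩)) (by
      rintro _ (⟨x, hx, rfl⟩ | ⟨t, ht, rfl⟩)
      · refine Or.inr fun m => ?_
        rcases hx.1.eq_or_lt with h0 | h0
        · rw [← h0]
          simpa using (P.kernelData.pt_ne m).symm
        · refine isFree_left (Sum.inr 0) x ⟨?_, hx.2.trans_lt hb.2⟩ (some m)
          simpa [leftPoint, below_zero] using h0
      · exact P.kernelData.cutDomain_subset_cutReg (KernelData.add_mul_mem_cutDomain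
          (Or.inr (by simpa using hne)) (by simp) KernelData.leftDir_im ht))
  obtain ⟨c', hc', h'⟩ := V.exists_low (by simp) hne hS
  refine ⟨c, -c', V.onWedge (by simp) KernelData.leftDir_im hne hc hc'
    (fun t ht => h _ (Or.inr ⟨t, ht, rfl⟩)) h', ?_⟩
  exact (h 0 (Or.inl ⟨0, ⟨le_rfl, hb0.le⟩, by simp⟩)).symm

/-- Asymptotics of `N³` for the contour of the origin. -/
lemma tendsto_N3_zero {a : ℝ} (ha : 0 < a) (k : Fin r) :
    Tendsto (fun L : ℝ => C.N3 (-L) (Sum.inr 0) k) atTop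
      (𝓝 ((C.verL (Sum.inr 0)).psiNoZero 0 * wedgeIntegral a (1 + Complex.I) leftDir
        (fun z => z⁻¹ * Complex.exp z) * (-(1 / P.μ k)))) := by
  obtain ⟨c, c', h, hc⟩ := C.exists_onWedge_zero
  have hb := C.baseL_mem (Sum.inr 0)
  have hfree := isFree_left (P := P) (Sum.inr 0)
  rw [← point_leftOpt, leftOpt_zero] at hb hfree
  have hlim := h.tendsto_tilt hfree hb ha (Sum.inl k)
  rw [KernelData.wedgeIntegral_inv_mul_exp, ← hc]
  have e : c * P.kernelData.phase none = c * P.kernelData.kernReg 0 := by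
    simp [KernelData.phase, KernelData.rest_none, KernelData.scaleExp]
  have e' : P.kernelData.quo none (Sum.inl k) (P.kernelData.point none) = -(1 / P.μ k) := by
    simp [KernelData.quo, inv_neg]
  rw [e, e'] at hlim
  refine hlim.congr fun L => ?_
  have hs : P.leftExp (Sum.inr 0) < 0 := by simp [leftExp, expBelow_zero]
  rw [N3_eq, leftIntegral, if_pos hs]
  simp [KernelData.scale, KernelData.scaleExp, leftDir]

/-- Asymptotics of `N³`. -/
lemma exists_tendsto_N3 (j : Fin s ⊕ Fin r) : ∃ κ : ℂ, κ ≠ 0 ∧ ∀ k,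
    Tendsto (fun L : ℝ => (P.kernelData.scale (leftOpt r s j) L : ℂ) * C.N3 (-L) j k) atTop
      (𝓝 (κ * P.kernelData.quo (leftOpt r s j) (Sum.inl k)
        (P.kernelData.point (leftOpt r s j)))) := by
  have hb := C.baseL_mem j
  have hne := isFree_left (P := P) j _ hb
  have hfree := isFree_left (P := P) j
  rw [← point_leftOpt] at hb hfree
  rcases (leftExp_ne (P := P) j).lt_or_gt with hs | hs
  · have hset : P.leftSet j (C.baseL j) = wedgeSet (C.baseL j) (1 + Complex.I) leftDir := by
      rw [leftSet, if_pos hs, leftDir]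
    have hS : wedgeSet (C.baseL j) (1 + Complex.I) leftDir ⊆ P.leftRegion j (C.baseL j) :=
      hset ▸ subset_union_left
    obtain ⟨c, c', h⟩ := (C.verL j).exists_onWedge (by simp) KernelData.leftDir_im hne hS
    -- The constant contains the Hankel integral with base point 1, an arbitrary positive choice.
    refine ⟨_, mul_ne_zero (mul_ne_zero h.up_ne (KernelData.phase_ne_zero _))
      (KernelData.sub_conj_hankelHalf_ne (scaleExp_nonpos (by rwa [expo_leftOpt])) one_pos),
      fun k => (h.tendsto_tilt hfree hb one_pos (Sum.inl k)).congr fun L => ?_⟩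
    rw [N3_eq, leftIntegral, if_pos hs, leftDir]
  · have hset : P.leftSet j (C.baseL j) = raySet (P.leftPoint j) leftDir := by
      rw [leftSet, if_neg hs.not_gt, leftDir]
    rw [← point_leftOpt] at hset
    have hS : raySet (P.kernelData.point (leftOpt r s j)) leftDir ⊆ P.leftRegion j (C.baseL j) :=
      hset ▸ subset_union_left
    obtain ⟨c, hc, h⟩ := (C.verL j).exists_psi_eq_on_ray _ KernelData.leftDir_im hS
    have ho : 0 < P.kernelData.expo (leftOpt r s j) := by rwa [expo_leftOpt]
    have ho' : 0 < P.kernelData.scaleExp (leftOpt r s j) := by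
      cases hl : leftOpt r s j with
      | none => rw [hl] at ho; norm_num at ho
      | some m => rw [hl] at ho; exact ho
    refine ⟨_, mul_ne_zero (mul_ne_zero hc (KernelData.phase_ne_zero _)) (hankelHalf_zero_ne ho'),
      fun k => (KernelData.tendsto_tilt_ray ho h hfree (hb.1.trans hb.2) (Sum.inl k)).congr
        fun L => ?_⟩
    rw [N3_eq, leftIntegral, if_neg hs.not_gt, point_leftOpt, leftDir]

/-- At a negative point the scale tends to infinity exponentially, so boundedness of the scaled
integral forces the integral to zero. -/
lemma tendsto_N3_neg (d : Fin s) (k : Fin r) :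
    Tendsto (fun L : ℝ => C.N3 (-L) (Sum.inl d) k) atTop (𝓝 0) := by
  obtain ⟨κ, -, h⟩ := C.exists_tendsto_N3 (Sum.inl d)
  have hp : P.kernelData.point (leftOpt r s (Sum.inl d)) < 0 := by
    rw [point_leftOpt]
    exact neg_lt_zero.2 (P.nu_pos d)
  have h1 := ((Complex.continuous_ofReal.tendsto _).comp (KernelData.tendsto_inv_scale hp)).mul (h k)
  rw [Complex.ofReal_zero, zero_mul] at h1
  refine h1.congr' ?_
  filter_upwards [eventually_gt_atTop 0] with L hL
  have := (P.kernelData.scale_pos (leftOpt r s (Sum.inl d)) hL).ne'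
  simp only [Function.comp, Complex.ofReal_inv]
  rw [inv_mul_cancel_left₀ (by exact_mod_cast this)]

/-- Asymptotics of `N³` for the contour of the point preceding `μ i`. -/
lemma exists_tendsto_N3_succ {i j : Fin r} (hij : j.val + 1 = i.val) : ∃ κ : ℂ, κ ≠ 0 ∧ ∀ k,
    Tendsto (fun L : ℝ => (P.kernelData.scale (some (Sum.inl j)) L : ℂ) * C.N3 (-L) (Sum.inr i) k)
      atTop (𝓝 (if k = j then κ else 0)) := by
  obtain ⟨κ, hκ, h⟩ := C.exists_tendsto_N3 (Sum.inr i)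
  rw [leftOpt_succ hij] at h
  refine ⟨κ, hκ, fun k => ?_⟩
  convert h k using 2
  by_cases hk : k = j
  · subst hk
    simp [KernelData.quo]
  · simp [KernelData.quo, hk, Ne.symm hk]

end Contours

end JumpModel

end

/-! ### The limit system and its solution -/

noncomputable section

open Set

/-- Solutions of linear systems whose matrices converge to an invertible limit. -/
lemma tendsto_solution {m n β : Type*} [Fintype m] [Fintype n] (hcard : Fintype.card m = Fintype.card n)
    {l : Filter β} {B : β → Matrix m n ℂ} {B₀ : Matrix m n ℂ}
    (hB : ∀ i j, Tendsto (fun b => B b i j) l (𝓝 (B₀ i j)))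
    (hinj : ∀ y : n → ℂ, B₀.mulVec y = 0 → y = 0) (v : m → ℂ) :
    (∀ᶠ b in l, ∃! y : n → ℂ, (B b).mulVec y = v) ∧
      ∃ y₀ : n → ℂ, B₀.mulVec y₀ = v ∧ ∀ y : β → n → ℂ, (∀ᶠ b in l, (B b).mulVec (y b) = v) →
        Tendsto y l (𝓝 y₀) := by
  classical
  -- Rows and columns have different index types; some bijection is needed to form determinants, and
  -- none of the conclusions depends on it.
  let e : n ≃ m := (Fintype.equivOfCardEq hcard).symm
  have hsub : ∀ (X : Matrix m n ℂ) (y : n → ℂ),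
      (X.submatrix e id).mulVec y = v ∘ e ↔ X.mulVec y = v := by
    intro X y
    constructor
    · intro h
      ext i
      have := congrFun h (e.symm i)
      simpa [Matrix.mulVec, dotProduct] using this
    · intro h
      ext i
      exact congrFun h (e i)
  have hdet₀ : (B₀.submatrix e id).det ≠ 0 := by
    intro h
    obtain ⟨y, hy, hy'⟩ := Matrix.exists_mulVec_eq_zero_iff.2 h
    refine hy (hinj y ?_)
    ext i
    have := congrFun hy' (e.symm i)
    simpa [Matrix.mulVec, dotProduct] using this
  have hT : Tendsto (fun b => (B b).submatrix e id) l (𝓝 (B₀.submatrix e id)) :=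
    tendsto_pi_nhds.2 fun i => tendsto_pi_nhds.2 fun j => hB (e i) j
  have hdet : Tendsto (fun b => ((B b).submatrix e id).det) l (𝓝 (B₀.submatrix e id).det) :=
    ((continuous_id.matrix_det).tendsto _).comp hT
  have hev := hdet.eventually_ne hdet₀
  have hsol : ∀ X : Matrix n n ℂ, X.det ≠ 0 → ∀ y, X.mulVec y = v ∘ e ↔
      y = X.det⁻¹ • X.adjugate.mulVec (v ∘ e) := by
    intro X hX y
    constructor
    · intro h
      rw [← h, Matrix.mulVec_mulVec, Matrix.adjugate_mul, Matrix.smul_mulVec, Matrix.one_mulVec,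
        smul_smul, inv_mul_cancel₀ hX, one_smul]
    · rintro rfl
      rw [Matrix.mulVec_smul, Matrix.mulVec_mulVec, Matrix.mul_adjugate, Matrix.smul_mulVec,
        Matrix.one_mulVec, smul_smul, inv_mul_cancel₀ hX, one_smul]
  refine ⟨?_, _, (hsub _ _).1 ((hsol _ hdet₀ _).2 rfl), fun y hy => ?_⟩
  · filter_upwards [hev] with b hb
    exact ⟨_, (hsub _ _).1 ((hsol _ hb _).2 rfl), fun y hy => (hsol _ hb _).1 ((hsub _ _).2 hy)⟩
  · have hadj : Tendsto (fun b => ((B b).submatrix e id).adjugate.mulVec (v ∘ e)) l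
        (𝓝 ((B₀.submatrix e id).adjugate.mulVec (v ∘ e))) :=
      ((Continuous.matrix_mulVec continuous_id.matrix_adjugate continuous_const).tendsto _).comp hT
    refine ((hdet.inv₀ hdet₀).smul hadj).congr' ?_
    filter_upwards [hev, hy] with b hb hyb
    exact ((hsol _ hb _).1 ((hsub _ _).2 hyb)).symm

/-- The alternating minors give a linear relation between `n + 1` vectors. -/
lemma sum_minors_eq_zero {n : ℕ} (c : Fin (n + 1) → Fin n → ℂ) (i : Fin n) :
    ∑ j : Fin (n + 1), (-1) ^ (j : ℕ) * c j i *
      (Matrix.of fun row col => c (j.succAbove col) row).det = 0 := by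
  -- The square matrix with the `i`-th row repeated on top has determinant zero; its expansion along
  -- the top row is the relation.
  have h := Matrix.det_succ_row_zero
    (Matrix.of fun (row : Fin (n + 1)) j => (Fin.cons (c j i) (c j) : Fin (n + 1) → ℂ) row)
  rw [Matrix.det_zero_of_row_eq (i := 0) (j := i.succ) (Fin.succ_ne_zero i).symm
    (by ext j; simp)] at h
  rw [h]
  refine Finset.sum_congr rfl fun j _ => ?_
  congr 1

/-- A relation between `n + 1` vectors in terms of minors. -/
lemma relation_eq_minor {n : ℕ} (c : Fin (n + 1) → Fin n → ℂ)
    (hdet : (Matrix.of fun row (col : Fin n) => c col.castSucc row).det ≠ 0) {v : Fin (n + 1) → ℂ}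
    (hv : ∀ i, ∑ j, v j * c j i = 0) (j : Fin n) :
    v j.castSucc = (-1) ^ (n - (j.val + 1)) *
      ((Matrix.of fun row col => c (j.castSucc.succAbove col) row).det /
        (Matrix.of fun row (col : Fin n) => c col.castSucc row).det) * -v (Fin.last n) := by
  set D := (Matrix.of fun row (col : Fin n) => c col.castSucc row).det
  set w : Fin (n + 1) → ℂ := fun j => (-1) ^ (j : ℕ) *
    (Matrix.of fun row col => c (j.succAbove col) row).det
  have hw : ∀ i, ∑ j, w j * c j i = 0 := fun i => by
    rw [← sum_minors_eq_zero c i]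
    exact Finset.sum_congr rfl fun j _ => by simp only [w]; ring
  have hwl : w (Fin.last n) = (-1) ^ n * D := by simp [w, D]
  -- The combination of the given relation and the relation of minors without last coefficient; the
  -- first `n` vectors are independent, so it is trivial.
  set u : Fin (n + 1) → ℂ := fun j => w (Fin.last n) * v j - v (Fin.last n) * w j
  have hul : u (Fin.last n) = 0 := by simp only [u]; ring
  have hu : ∀ i, ∑ j, u j * c j i = 0 := by
    intro i
    have : ∀ j, u j * c j i = w (Fin.last n) * (v j * c j i) - v (Fin.last n) * (w j * c j i) :=
      fun j => by simp only [u]; ring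
    simp only [this, Finset.sum_sub_distrib, ← Finset.mul_sum, hv, hw, mul_zero, sub_zero]
  have hz : (fun j : Fin n => u j.castSucc) = 0 := by
    refine Matrix.eq_zero_of_mulVec_eq_zero hdet ?_
    ext i
    have := hu i
    rw [Fin.sum_univ_castSucc, hul, zero_mul, add_zero] at this
    simpa [Matrix.mulVec, dotProduct, mul_comm] using this
  have h := congrFun hz j
  simp only [u, hwl, Pi.zero_apply, w, Fin.val_castSucc] at h
  have hsign : ((-1 : ℂ)) ^ (n - (j.val + 1)) * (-1) ^ n * (-1) = (-1) ^ (j : ℕ) := by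
    rw [← pow_add, ← pow_succ, neg_one_pow_eq_pow_mod_two, neg_one_pow_eq_pow_mod_two (n := (j : ℕ))]
    congr 1
    omega
  have hs1 : ((-1 : ℂ)) ^ n * (-1) ^ n = 1 := by rw [← mul_pow]; simp
  rw [← hsign] at h
  field_simp
  linear_combination (-1) ^ n * h + (-(v j.castSucc * D) - (-1) ^ (n - (j.val + 1)) * v (Fin.last n) *
    (Matrix.of fun row col => c (j.castSucc.succAbove col) row).det) * hs1

namespace JumpModel

namespace Contours

variable {r s : ℕ} [NeZero r] {P : JumpModel r s} (C : P.Contours)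

/-- The scales of the unknowns. -/
def unknownScale (P : JumpModel r s) (L : ℝ) : Fin r ⊕ (Fin s ⊕ Fin r) → ℂ :=
  Sum.elim 1 (Sum.elim 1 fun i => P.kernelData.scale (leftOpt r s (Sum.inr i)) L)

lemma unknownScale_ne_zero {L : ℝ} (hL : 0 < L) (x : Fin r ⊕ (Fin s ⊕ Fin r)) :
    unknownScale P L x ≠ 0 := by
  rcases x with i | d | i
  · exact one_ne_zero
  · exact one_ne_zero
  · exact Complex.ofReal_ne_zero.2 (P.kernelData.scale_pos _ hL).ne'

lemma unknownScale_zero (L : ℝ) : unknownScale P L (Sum.inr (Sum.inr 0)) = 1 := by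
  simp [unknownScale, leftOpt_zero, KernelData.scale, KernelData.scaleExp]

lemma tendsto_unknownScale {i : Fin r} (hi : i ≠ 0) :
    Tendsto (fun L => unknownScale P L (Sum.inr (Sum.inr i))) atTop (𝓝 0) := by
  obtain ⟨j, hj⟩ := exists_pred hi
  have h : Tendsto (fun L => P.kernelData.scale (some (Sum.inl j)) L) atTop (𝓝 0) :=
    KernelData.tendsto_scale (by simpa using P.mu_pos j)
  simpa [unknownScale, leftOpt_succ hj, Function.comp_def] using (Complex.continuous_ofReal.tendsto _).comp h

open Classical in
/-- The limit of the matrix of the system after scaling of the unknowns. -/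
def limitMatrix (κ : Fin r → ℂ) : Matrix (Fin r ⊕ (Fin r ⊕ Fin s)) (Fin r ⊕ (Fin s ⊕ Fin r)) ℂ :=
  Matrix.fromBlocks
    0 (Matrix.of fun k => Sum.elim 0 fun i =>
      if i = 0 then κ 0 * (-(1 / P.μ k)) else if k.val + 1 = i.val then κ i else 0)
    (Matrix.fromRows (Matrix.of fun k i => C.M1 i k) (Matrix.of fun d i => -C.M2 i d))
    (Matrix.fromRows
      (Matrix.of fun k => Sum.elim (fun d => C.N1 (Sum.inl d) k)
        fun i => if i = 0 then C.N1 (Sum.inr 0) k else 0)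
      (Matrix.of fun d => Sum.elim (fun e => C.N2 (Sum.inl e) d)
        fun i => if i = 0 then C.N2 (Sum.inr 0) d else 0))

/-- Columns behave in three ways. At negative points the `N³` entries vanish in the limit, and at
the origin they converge. At μ_j the entry of row j blows up like the inverse of the scale, so the
unknown is divided by the scale; the period entries of that column are thereby multiplied by it and
vanish in the limit. -/
lemma exists_tendsto_limitMatrix {a : ℝ} (ha : 0 < a) : ∃ κ : Fin r → ℂ, (∀ i, κ i ≠ 0) ∧
    κ 0 = (C.verL (Sum.inr 0)).psiNoZero 0 * wedgeIntegral a (1 + Complex.I) leftDir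
      (fun z => z⁻¹ * Complex.exp z) ∧
    ∀ x y, Tendsto (fun L => C.A (-L) x y * unknownScale P L y) atTop (𝓝 (C.limitMatrix κ x y)) := by
  have h0 : (C.verL (Sum.inr 0)).psiNoZero 0 * wedgeIntegral a (1 + Complex.I) leftDir
      (fun z => z⁻¹ * Complex.exp z) ≠ 0 := by
    refine mul_ne_zero (mul_ne_zero ?_ ?_) ?_
    · exact Finset.prod_ne_zero_iff.2 fun _ _ => Complex.exp_ne_zero _
    · exact Finset.prod_ne_zero_iff.2 fun _ _ => Complex.exp_ne_zero _
    · rw [KernelData.wedgeIntegral_inv_mul_exp]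
      exact KernelData.sub_conj_hankelHalf_ne le_rfl ha
  have h1 : ∀ i : Fin r, ∃ κ : ℂ, κ ≠ 0 ∧ (i = 0 → κ = (C.verL (Sum.inr 0)).psiNoZero 0 *
      wedgeIntegral a (1 + Complex.I) leftDir (fun z => z⁻¹ * Complex.exp z)) ∧
      (i ≠ 0 → ∀ k : Fin r, Tendsto (fun L : ℝ => C.N3 (-L) (Sum.inr i) k *
        unknownScale P L (Sum.inr (Sum.inr i))) atTop
        (𝓝 (if k.val + 1 = i.val then κ else 0))) := by
    intro i
    by_cases hi : i = 0
    · exact ⟨_, h0, fun _ => rfl, fun h => absurd hi h⟩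
    · obtain ⟨j, hj⟩ := exists_pred hi
      obtain ⟨κ, hκ, h⟩ := C.exists_tendsto_N3_succ hj
      refine ⟨κ, hκ, fun h => absurd h hi, fun _ k => ?_⟩
      have e : (k.val + 1 = i.val) ↔ k = j := by rw [Fin.ext_iff]; omega
      simp only [e]
      refine (h k).congr fun L => ?_
      simp [unknownScale, leftOpt_succ hj, mul_comm]
  choose κ hκ hκ0 hκs using h1
  refine ⟨κ, hκ, hκ0 0 rfl, ?_⟩
  rintro (k | k | d) (i | e | i)
  · simp [A, limitMatrix]
  · simpa [A, limitMatrix, unknownScale] using C.tendsto_N3_neg e k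
  · by_cases hi : i = 0
    · subst hi
      have := C.tendsto_N3_zero ha k
      rw [← hκ0 0 rfl] at this
      simpa [A, limitMatrix, unknownScale_zero] using this
    · simpa [A, limitMatrix, hi] using hκs i hi k
  · simp [A, limitMatrix, unknownScale]
  · simp [A, limitMatrix, unknownScale]
  · by_cases hi : i = 0
    · subst hi
      simp [A, limitMatrix, unknownScale_zero]
    · simpa [A, limitMatrix, hi] using (tendsto_unknownScale (P := P) hi).const_mul (C.N1 (Sum.inr i) k)
  · simp [A, limitMatrix, unknownScale]
  · simp [A, limitMatrix, unknownScale]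
  · by_cases hi : i = 0
    · subst hi
      simp [A, limitMatrix, unknownScale_zero]
    · simpa [A, limitMatrix, hi] using (tendsto_unknownScale (P := P) hi).const_mul (C.N2 (Sum.inr i) d)

/-- The coefficients of `cols` that correspond to a vector of unknowns. -/
def colCoeff (y : Fin r ⊕ (Fin s ⊕ Fin r) → ℂ) : Fin (r + s + 1) → ℂ :=
  Fin.snoc (α := fun _ => ℂ)
    (Fin.append (fun i => y (Sum.inl i)) fun n : Fin s => y (Sum.inr (Sum.inl n.rev)))
    (y (Sum.inr (Sum.inr 0)))

lemma sum_colCoeff_mul_cols (y : Fin r ⊕ (Fin s ⊕ Fin r) → ℂ) (row : Fin (r + s)) :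
    ∑ j, colCoeff y j * C.cols j row = ∑ i, y (Sum.inl i) * C.rightCol i row +
      ∑ d, y (Sum.inr (Sum.inl d)) * C.leftCol (Sum.inl d) row +
        y (Sum.inr (Sum.inr 0)) * C.leftCol (Sum.inr 0) row := by
  have h := Equiv.sum_comp Fin.revPerm fun d : Fin s =>
    y (Sum.inr (Sum.inl d)) * C.leftCol (Sum.inl d) row
  rw [← h, Fin.sum_univ_castSucc, Fin.sum_univ_add]
  simp [colCoeff, cols, -Fin.castSucc_natAdd]

/-- The columns at the positive points have dropped out, so the lower equations are a relation
between the `r + s + 1` vectors `cols`. -/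
lemma limitMatrix_mulVec_bot (κ : Fin r → ℂ) (y : Fin r ⊕ (Fin s ⊕ Fin r) → ℂ)
    (h : ∀ x, (C.limitMatrix κ).mulVec y (Sum.inr x) = 0) (row : Fin (r + s)) :
    ∑ j, colCoeff y j * C.cols j row = 0 := by
  rw [sum_colCoeff_mul_cols]
  refine Fin.addCases (fun k => ?_) (fun d => ?_) row
  · have := h (Sum.inl k)
    simp only [Matrix.mulVec, dotProduct, limitMatrix, Fintype.sum_sum_type] at this
    simp [ite_mul] at this
    simp only [rightCol, leftCol, Fin.append_left, mul_comm (y _)]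
    linear_combination this
  · have := h (Sum.inr d)
    simp only [Matrix.mulVec, dotProduct, limitMatrix, Fintype.sum_sum_type] at this
    simp [ite_mul] at this
    simp only [rightCol, leftCol, Fin.append_right, mul_comm (y _)]
    simp
    linear_combination this

lemma limitMatrix_mulVec_top (κ : Fin r → ℂ) (y : Fin r ⊕ (Fin s ⊕ Fin r) → ℂ) (k : Fin r) :
    (C.limitMatrix κ).mulVec y (Sum.inl k) = κ 0 * (-(1 / P.μ k)) * y (Sum.inr (Sum.inr 0)) +
      ∑ i : Fin r, if k.val + 1 = i.val then κ i * y (Sum.inr (Sum.inr i)) else 0 := by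
  have h : ∀ i : Fin r, (if i = 0 then κ 0 * (-(1 / (P.μ k : ℂ))) else
      if k.val + 1 = i.val then κ i else 0) * y (Sum.inr (Sum.inr i)) =
      (if i = 0 then κ 0 * (-(1 / (P.μ k : ℂ))) * y (Sum.inr (Sum.inr 0)) else 0) +
        if k.val + 1 = i.val then κ i * y (Sum.inr (Sum.inr i)) else 0 := by
    intro i
    by_cases hi : i = 0
    · subst hi
      simp
    · simp [hi]
  simp only [Matrix.mulVec, dotProduct, limitMatrix, Fintype.sum_sum_type]
  simp only [Matrix.fromBlocks_apply₁₁, Matrix.fromBlocks_apply₁₂, Matrix.zero_apply, zero_mul,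
    Finset.sum_const_zero, zero_add, Matrix.of_apply, Sum.elim_inl, Sum.elim_inr, Pi.zero_apply]
  rw [Finset.sum_congr rfl fun i _ => h i, Finset.sum_add_distrib]
  simp

/-- The top row of the last index only involves the unknown of the origin. -/
lemma limitMatrix_mulVec_last (κ : Fin r → ℂ) (y : Fin r ⊕ (Fin s ⊕ Fin r) → ℂ) {k : Fin r}
    (hk : k.val + 1 = r) :
    (C.limitMatrix κ).mulVec y (Sum.inl k) = κ 0 * (-(1 / P.μ k)) * y (Sum.inr (Sum.inr 0)) := by
  rw [limitMatrix_mulVec_top, Finset.sum_eq_zero, add_zero]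
  intro i _
  rw [if_neg (by omega)]

lemma exists_last (r : ℕ) [NeZero r] : ∃ k : Fin r, k.val + 1 = r := by
  have := NeZero.pos r
  exact ⟨⟨r - 1, by omega⟩, by simp; omega⟩

/-- The last upper equation kills the unknown of the origin, the other upper equations kill those of
the positive points one by one, and invertibility of `M` kills the rest. -/
lemma limitMatrix_injective {κ : Fin r → ℂ} (hκ : ∀ i, κ i ≠ 0)
    (y : Fin r ⊕ (Fin s ⊕ Fin r) → ℂ) (h : (C.limitMatrix κ).mulVec y = 0) : y = 0 := by
  obtain ⟨k₀, hk₀⟩ := exists_last r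
  have hμ : ∀ k, (P.μ k : ℂ) ≠ 0 := fun k => by exact_mod_cast (P.mu_pos k).ne'
  have h0 : y (Sum.inr (Sum.inr 0)) = 0 := by
    have h1 := congrFun h (Sum.inl k₀)
    rw [C.limitMatrix_mulVec_last κ y hk₀] at h1
    simpa [hκ, hμ] using h1
  have hi : ∀ i, y (Sum.inr (Sum.inr i)) = 0 := by
    intro i
    by_cases hi : i = 0
    · rwa [hi]
    · obtain ⟨k, hk⟩ := exists_pred hi
      have h1 := congrFun h (Sum.inl k)
      have e : ∀ j : Fin r, k.val + 1 = j.val ↔ j = i := fun j => by rw [Fin.ext_iff]; omega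
      rw [limitMatrix_mulVec_top, h0, mul_zero, zero_add] at h1
      simpa [e, hκ] using h1
  have hb := C.limitMatrix_mulVec_bot κ y fun x => congrFun h (Sum.inr x)
  have hz := relation_eq_minor C.cols C.det_M_ne_zero hb
  have hlast : colCoeff y (Fin.last (r + s)) = 0 := by simpa [colCoeff] using h0
  simp only [hlast, neg_zero, mul_zero] at hz
  ext x
  rcases x with i | d | i
  · simpa [colCoeff] using hz (Fin.castAdd s i)
  · simpa [colCoeff, -Fin.castSucc_natAdd] using hz (Fin.natAdd r d.rev)
  · exact hi i

/-- In the last upper equation the factors 1/μ_r cancel, and the unknown of the origin is -1/κ₀.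
Inserted into the relation between the columns, it fixes the other coefficients through minors. -/
lemma solution_limitMatrix {κ : Fin r → ℂ} (hκ : ∀ i, κ i ≠ 0)
    {y : Fin r ⊕ (Fin s ⊕ Fin r) → ℂ} (h : (C.limitMatrix κ).mulVec y = P.rhs) (i : Fin r) :
    y (Sum.inl i) = (-1) ^ (r + s - (i.val + 1)) * ((C.Mdel i).det / C.M.det) * (κ 0)⁻¹ := by
  obtain ⟨k₀, hk₀⟩ := exists_last r
  have hμ : (P.μ k₀ : ℂ) ≠ 0 := by exact_mod_cast (P.mu_pos k₀).ne'
  have h0 : -y (Sum.inr (Sum.inr 0)) = (κ 0)⁻¹ := by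
    have h1 := congrFun h (Sum.inl k₀)
    rw [C.limitMatrix_mulVec_last κ y hk₀] at h1
    simp only [rhs, Sum.elim_inl] at h1
    have := hκ 0
    field_simp at h1 ⊢
    linear_combination h1
  have hb := C.limitMatrix_mulVec_bot κ y fun x => congrFun h (Sum.inr x)
  have hz := relation_eq_minor C.cols C.det_M_ne_zero hb (Fin.castAdd s i)
  have hlast : colCoeff y (Fin.last (r + s)) = y (Sum.inr (Sum.inr 0)) := by simp [colCoeff]
  rw [hlast, h0] at hz
  simpa [colCoeff, Mdel, M] using hz

end Contours

end JumpModel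

end

/-- The sign exponent is r + s - (i + 1) because `i` starts at zero; the subtraction does not
truncate, as i < r. -/
theorem corollary4p2 {r s : ℕ} [NeZero r] (P : JumpModel r s) (C : P.Contours)
    (a : ℝ) (ha : 0 < a) :
    C.M.det ≠ 0 ∧
    (∀ᶠ l : ℝ in atBot, ∃! x : Fin r ⊕ (Fin s ⊕ Fin r) → ℂ, (C.A l).mulVec x = P.rhs) ∧
    ∀ x : ℝ → Fin r ⊕ (Fin s ⊕ Fin r) → ℂ,
      (∀ᶠ l : ℝ in atBot, (C.A l).mulVec (x l) = P.rhs) →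
      ∀ i : Fin r,
        Tendsto (fun l => x l (Sum.inl i)) atBot
          (𝓝 ((-1) ^ (r + s - (i.val + 1)) * ((C.Mdel i).det / C.M.det) *
            ((C.verL (Sum.inr 0)).psiNoZero 0 *
              wedgeIntegral a (1 + Complex.I) (-1 + Complex.I)
                (fun z => z⁻¹ * Complex.exp z))⁻¹)) := by
  obtain ⟨κ, hκ, hκ0, hlim⟩ := C.exists_tendsto_limitMatrix ha
  have hmul : ∀ (L : ℝ) (y : Fin r ⊕ (Fin s ⊕ Fin r) → ℂ),
      (Matrix.of fun i j => C.A (-L) i j * JumpModel.Contours.unknownScale P L j).mulVec y =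
        (C.A (-L)).mulVec fun j => JumpModel.Contours.unknownScale P L j * y j := by
    intro L y
    ext i
    simp [Matrix.mulVec, dotProduct, mul_assoc]
  obtain ⟨hex, y₀, hy₀, hconv⟩ := tendsto_solution
    (B := fun L => Matrix.of fun i j => C.A (-L) i j * JumpModel.Contours.unknownScale P L j)
    (by simp [add_comm]) hlim (C.limitMatrix_injective hκ) P.rhs
  refine ⟨C.det_M_ne_zero, ?_, fun x hx i => ?_⟩
  · have h1 := tendsto_neg_atBot_atTop.eventually (hex.and (eventually_gt_atTop 0))
    filter_upwards [h1] with l hl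
    obtain ⟨⟨y, hy, huniq⟩, hl0⟩ := hl
    have hu := JumpModel.Contours.unknownScale_ne_zero (P := P) hl0
    rw [hmul, neg_neg] at hy
    refine ⟨_, hy, fun x hx => ?_⟩
    -- Rescaling the unknowns by nonzero factors is a bijection between the solutions of the two
    -- systems, so uniqueness carries over.
    have h2 := huniq (fun j => (JumpModel.Contours.unknownScale P (-l) j)⁻¹ * x j) (by
      refine (hmul _ _).trans ?_
      simp only [mul_inv_cancel_left₀ (hu _), neg_neg]
      exact hx)
    ext j
    rw [← h2, mul_inv_cancel_left₀ (hu j)]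
  · have h1 : ∀ᶠ L : ℝ in atTop, (C.A (-L)).mulVec (x (-L)) = P.rhs :=
      tendsto_neg_atTop_atBot.eventually hx
    have h2 := hconv (fun L j => (JumpModel.Contours.unknownScale P L j)⁻¹ * x (-L) j) (by
      filter_upwards [h1, eventually_gt_atTop 0] with L hL hL0
      rw [hmul, ← hL]
      congr 1
      ext j
      rw [mul_inv_cancel_left₀ (JumpModel.Contours.unknownScale_ne_zero hL0 j)])
    have h3 := (tendsto_pi_nhds.1 h2 (Sum.inl i)).comp tendsto_neg_atBot_atTop
    rw [C.solution_limitMatrix hκ hy₀ i, hκ0] at h3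
    simpa [Function.comp_def, JumpModel.Contours.unknownScale, leftDir] using h3
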